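/- Let $m\in\mathbb{N}$ and $1\le p<\infty$, and let $f:\mathbb{R}^{m\times 2}\times\mathbb{R}^{m\times 2\times 2}\to\mathbb{R}$ be Borel measurable. For $v\in\mathbb{R}^{m\times 2}$, $\xi\in\mathbb{R}^{m\times 2\times 2}$ let \[ Q_2f(v,\xi)=\inf\left\{\int_{Q}f(v,\xi+\nabla^2\varphi)\,dx:\ \varphi\in W^{2,\infty}_0(Q;\mathbb{R}^m)\right\},\qquad Q=[-1/2,1/2]^2, \] be the 2-quasiconvexification of $f$ in its second variable, where $W^{2,\infty}_0=W^{2,\infty}\cap W^{2,1}_0$ and $W^{2,1}_0$ is the closure of $C_c^\infty$ in $W^{2,1}$. Assume that there is a constant $C$ such that for all $v,\tilde v\in\mathbb{R}^{m\times 2}$ and $\xi\in\mathbb{R}^{m\times 2\times 2}$ \[ \begin{split} 0\le f(v,\xi)&\le C(1+|\xi|^p),\\ |f(v,\xi)-f(\tilde v,\xi)|&\le C|v-\tilde v|\max\big(f(v,\xi),f(\tilde v,\xi)\big),\\ |Q_2f(v,\xi)-Q_2f(\tilde v,\xi)|&\le C|v-\tilde v|\max\big(Q_2f(v,\xi),Q_2f(\tilde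 v,\xi)\big). \end{split} \] Let $\Omega\subset\mathbb{R}^2$ be open and bounded with smooth boundary, let $u\in W^{2,p}(\Omega;\mathbb{R}^m)$ and $\delta>0$. Then there exists $w\in W^{2,p}(\Omega;\mathbb{R}^m)$ such that \[ \|u-w\|_{W^{1,p}(\Omega;\mathbb{R}^m)}<\delta \qquad\text{and}\qquad \int_\Omega f(\nabla w,\nabla^2w)\,dx<\int_\Omega Q_2f(\nabla u,\nabla^2u)\,dx+\delta, \] where the integrands $f(\nabla w,\nabla^2 w)$ and $Q_2f(\nabla u,\nabla^2u)$ are integrable over $\Omega$. -/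

import Mathlib

open MeasureTheory Set
open scoped ENNReal ContDiff

/-- The Euclidean plane `ℝ²`. -/
abbrev Plane : Type := EuclideanSpace ℝ (Fin 2)

/-- The values of the maps: `ℝᵐ`. -/
abbrev Vec (m : ℕ) : Type := EuclideanSpace ℝ (Fin m)

/-- `ℝ^{m×2}` with the Euclidean (Frobenius) norm; the entry `(i, j)` of a gradient is `∂ⱼ uᵢ`. -/
abbrev GradSpace (m : ℕ) : Type := EuclideanSpace ℝ (Fin m × Fin 2)

/-- `ℝ^{m×2×2}` with the Euclidean norm; the entry `(i, j, k)` of a Hessian is `∂ₖ ∂ⱼ uᵢ`. -/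
abbrev HessSpace (m : ℕ) : Type := EuclideanSpace ℝ (Fin m × Fin 2 × Fin 2)

/-- The `k`-th standard basis vector of the plane. -/
noncomputable def planeBasis (k : Fin 2) : Plane := EuclideanSpace.single k (1 : ℝ)

/-- `h` is the weak partial derivative `∂ₖ g` on the open set `Ω`. -/
def HasWeakPartial (Ω : Set Plane) (k : Fin 2) (g h : Plane → ℝ) : Prop :=
  LocallyIntegrableOn g Ω volume ∧ LocallyIntegrableOn h Ω volume ∧
    ∀ φ : Plane → ℝ, ContDiff ℝ ∞ φ → HasCompactSupport φ → tsupport φ ⊆ Ω →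
      ∫ x in Ω, g x * fderiv ℝ φ x (planeBasis k) = - ∫ x in Ω, h x * φ x

/-- `u ∈ W^{2,q}(Ω; ℝᵐ)`, with weak gradient (represented by) `Du` and weak Hessian
(represented by) `D2u`. Both are determined by `u` almost everywhere in `Ω`. -/
structure IsSobolev2 {m : ℕ} (Ω : Set Plane) (q : ℝ≥0∞) (u : Plane → Vec m)
    (Du : Plane → GradSpace m) (D2u : Plane → HessSpace m) : Prop where
  memLp : MemLp u q (volume.restrict Ω)
  memLp_grad : MemLp Du q (volume.restrict Ω)
  memLp_hess : MemLp D2u q (volume.restrict Ω)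
  weak_grad : ∀ i j, HasWeakPartial Ω j (fun x => u x i) (fun x => Du x (i, j))
  weak_hess : ∀ i j k, HasWeakPartial Ω k (fun x => Du x (i, j)) (fun x => D2u x (i, j, k))

/-- The norm `(∫_Ω |u|^p + ∫_Ω |∇u|^p)^{1/p}` of `W^{1,p}(Ω; ℝᵐ)`, for a map `u` with weak
gradient `Du`. -/
noncomputable def sobolev1Norm {m : ℕ} (Ω : Set Plane) (p : ℝ) (u : Plane → Vec m)
    (Du : Plane → GradSpace m) : ℝ≥0∞ :=
  ((∫⁻ x in Ω, ‖u x‖ₑ ^ p) + ∫⁻ x in Ω, ‖Du x‖ₑ ^ p) ^ (1 / p)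

/-- The classical gradient of a smooth map. -/
noncomputable def classicalGrad {m : ℕ} (ψ : Plane → Vec m) (x : Plane) : GradSpace m :=
  WithLp.toLp 2 fun a => fderiv ℝ (fun y => ψ y a.1) x (planeBasis a.2)

/-- The classical Hessian of a smooth map. -/
noncomputable def classicalHess {m : ℕ} (ψ : Plane → Vec m) (x : Plane) : HessSpace m :=
  WithLp.toLp 2 fun a =>
    fderiv ℝ (fun y => classicalGrad ψ y (a.1, a.2.1)) x (planeBasis a.2.2)

/-- `φ ∈ W^{2,∞}_0(Ω; ℝᵐ) = W^{2,∞}(Ω; ℝᵐ) ∩ W^{2,1}_0(Ω; ℝᵐ)`, with weak gradient `Dφ` and weak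
Hessian `D2φ`, where `W^{2,1}_0` is the closure of the smooth maps with compact support in `Ω`
with respect to the norm of `W^{2,1}`. -/
structure IsSobolev2InfZero {m : ℕ} (Ω : Set Plane) (φ : Plane → Vec m)
    (Dφ : Plane → GradSpace m) (D2φ : Plane → HessSpace m) : Prop where
  isSobolev : IsSobolev2 Ω ⊤ φ Dφ D2φ
  approx : ∀ ε : ℝ, 0 < ε → ∃ ψ : Plane → Vec m,
    ContDiff ℝ ∞ ψ ∧ HasCompactSupport ψ ∧ tsupport ψ ⊆ Ω ∧
      (∫⁻ x in Ω, ‖φ x - ψ x‖ₑ) + (∫⁻ x in Ω, ‖Dφ x - classicalGrad ψ x‖ₑ)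
        + (∫⁻ x in Ω, ‖D2φ x - classicalHess ψ x‖ₑ) < ENNReal.ofReal ε

/-- The (open) unit square centred at the origin; its boundary is a null set. -/
def unitSquare : Set Plane := {x | ∀ i, |x i| < 1 / 2}

/-- The 2-quasiconvexification of `g : ℝ^{m×2×2} → ℝ`: the infimum of `∫_Q g(ξ + ∇²φ) dx` over
`φ ∈ W^{2,∞}_0(Q; ℝᵐ)`, where `Q` is the unit square. -/
noncomputable def quasiconvexification2 {m : ℕ} (g : HessSpace m → ℝ) (ξ : HessSpace m) : ℝ :=
  sInf {I : ℝ | ∃ (φ : Plane → Vec m) (Dφ : Plane → GradSpace m) (D2φ : Plane → HessSpace m),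
    IsSobolev2InfZero unitSquare φ Dφ D2φ ∧ I = ∫ x in unitSquare, g (ξ + D2φ x)}

/-- The set `Ω` has smooth boundary: near each boundary point it is the sublevel set of a smooth
function with non-vanishing differential. -/
def HasSmoothBoundary (Ω : Set Plane) : Prop :=
  ∀ x ∈ frontier Ω, ∃ (U : Set Plane) (ρ : Plane → ℝ), IsOpen U ∧ x ∈ U ∧ ContDiff ℝ ∞ ρ ∧
    ρ x = 0 ∧ fderiv ℝ ρ x ≠ 0 ∧ Ω ∩ U = {y | ρ y < 0} ∩ U

/-! Since `f` is only Borel in the Hessian, its energy can be controlled through a nearly optimal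
test map `φ` only where the Hessian takes exactly the values `ξ₀ + D2φ`. On a square of side `r`
around `x₀`, a smooth `ψ` is therefore replaced, up to a thin boundary layer, by a quadratic map
with Hessian `ξ₀ = ∇²ψ(x₀)` (`taylorGap`), to which a rescaled `φ` is added. The quadratic
correction has a small Hessian for small `r`, so cutting it off keeps the Hessian bounded in the
layer, which costs little because it is thin (`exists_insertion`). The gradient hardly moves, and
the relative Lipschitz condition turns this into a factor close to one. This gives
`exists_local_perturbation`; Vitali's theorem then fills almost all of an open set with disjoint
squares of this kind (`exists_global_perturbation`).

The same insertion, with a purely quadratic map, shows that `Q₂f` is continuous along symmetric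
Hessians although `f` is not (`exists_quasiconvexification2_le_add`). Together with the growth and
Lipschitz bounds it yields an upper estimate for `∫ Q₂f` that is stable under perturbations small in
`L^p` (`exists_relaxed_density_le`). Weak Hessians are symmetric almost everywhere, so this
suffices.

For general `u`, take a cutoff `χ` equal to one on `V ⊆ Ω`, where `V` fills almost all of `Ω`, a
mollification `ψ` of `χ u`, the small error `E = ψ - χ u`, and `w = u + E + θ` with `θ` supported in
a union `S ⊆ V` of squares. On `V` the map `u + E` has the derivatives of `ψ`, so the energy on `S`
is controlled by `Q₂f`. On `Ω \ S` the Hessian is that of `u + E`, and growth together with small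
measure suffices (`setIntegral_le_of_split`). As `w` corrects `u` itself, no smooth approximation up
to the boundary is required. -/

/-! ### Calculus of weak partial derivatives. -/

theorem integrable_mul_cutoff {Ω : Set Plane} {g χ : Plane → ℝ}
    (hg : LocallyIntegrableOn g Ω volume) (hc : Continuous χ) (hcs : HasCompactSupport χ)
    (hs : tsupport χ ⊆ Ω) : Integrable (fun x => g x * χ x) volume := by
  have h1 : IntegrableOn g (tsupport χ) volume := hg.integrableOn_compact_subset hs hcs
  have h2 : IntegrableOn (fun x => g x * χ x) (tsupport χ) volume :=
    h1.mul_continuousOn hc.continuousOn hcs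
  refine h2.integrable_of_forall_notMem_eq_zero fun x hx => ?_
  rw [image_eq_zero_of_notMem_tsupport hx, mul_zero]

theorem contDiff_partial {g : Plane → ℝ} (hg : ContDiff ℝ ∞ g) (e : Plane) :
    ContDiff ℝ ∞ (fun x => fderiv ℝ g x e) :=
  (hg.fderiv_right (m := ∞) (by simp)).clm_apply contDiff_const

theorem setIntegral_mul_cutoff {Ω : Set Plane} {g χ : Plane → ℝ} (hs : tsupport χ ⊆ Ω) :
    ∫ x in Ω, g x * χ x = ∫ x, g x * χ x :=
  setIntegral_eq_integral_of_forall_compl_eq_zero fun x hx => by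
    rw [image_eq_zero_of_notMem_tsupport (fun h => hx (hs h)), mul_zero]

namespace HasWeakPartial

theorem integral_eq {Ω : Set Plane} {k : Fin 2} {g h φ : Plane → ℝ}
    (H : HasWeakPartial Ω k g h) (hφ : ContDiff ℝ ∞ φ) (hc : HasCompactSupport φ)
    (hs : tsupport φ ⊆ Ω) :
    ∫ x, g x * fderiv ℝ φ x (planeBasis k) = - ∫ x, h x * φ x := by
  have := H.2.2 φ hφ hc hs
  rwa [setIntegral_mul_cutoff hs,
    setIntegral_mul_cutoff (χ := fun x => fderiv ℝ φ x (planeBasis k))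
      ((tsupport_fderiv_apply_subset ℝ _).trans hs)] at this

theorem of_integral_eq {Ω : Set Plane} {k : Fin 2} {g h : Plane → ℝ}
    (hg : LocallyIntegrableOn g Ω volume) (hh : LocallyIntegrableOn h Ω volume)
    (H : ∀ φ : Plane → ℝ, ContDiff ℝ ∞ φ → HasCompactSupport φ → tsupport φ ⊆ Ω →
      ∫ x, g x * fderiv ℝ φ x (planeBasis k) = - ∫ x, h x * φ x) : HasWeakPartial Ω k g h := by
  refine ⟨hg, hh, fun φ hφ hc hs => ?_⟩
  rw [setIntegral_mul_cutoff hs,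
    setIntegral_mul_cutoff (χ := fun x => fderiv ℝ φ x (planeBasis k))
      ((tsupport_fderiv_apply_subset ℝ _).trans hs)]
  exact H φ hφ hc hs

theorem mono {Ω Ω' : Set Plane} {k : Fin 2} {g h : Plane → ℝ}
    (H : HasWeakPartial Ω k g h) (hs : Ω' ⊆ Ω) : HasWeakPartial Ω' k g h :=
  of_integral_eq (H.1.mono_set hs) (H.2.1.mono_set hs) fun _ hφ hc hφs =>
    H.integral_eq hφ hc (hφs.trans hs)

theorem add {Ω : Set Plane} {k : Fin 2} {g h g' h' : Plane → ℝ}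
    (H : HasWeakPartial Ω k g h) (H' : HasWeakPartial Ω k g' h') :
    HasWeakPartial Ω k (fun x => g x + g' x) (fun x => h x + h' x) := by
  refine of_integral_eq (H.1.add H'.1) (H.2.1.add H'.2.1) fun φ hφ hc hs => ?_
  have hφ' := contDiff_partial hφ (planeBasis k)
  have hc' := hc.fderiv_apply ℝ (planeBasis k)
  have hs' := (tsupport_fderiv_apply_subset ℝ (f := φ) (planeBasis k)).trans hs
  simp only [add_mul]
  rw [integral_add (integrable_mul_cutoff H.1 hφ'.continuous hc' hs')
      (integrable_mul_cutoff H'.1 hφ'.continuous hc' hs'),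
    integral_add (integrable_mul_cutoff H.2.1 hφ.continuous hc hs)
      (integrable_mul_cutoff H'.2.1 hφ.continuous hc hs),
    H.integral_eq hφ hc hs, H'.integral_eq hφ hc hs]
  ring

theorem const_mul {Ω : Set Plane} {k : Fin 2} {g h : Plane → ℝ}
    (H : HasWeakPartial Ω k g h) (c : ℝ) :
    HasWeakPartial Ω k (fun x => c * g x) (fun x => c * h x) := by
  refine of_integral_eq (H.1.smul c) (H.2.1.smul c) fun φ hφ hc hs => ?_
  simp only [mul_assoc, integral_const_mul]
  rw [H.integral_eq hφ hc hs]
  ring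

theorem zero (Ω : Set Plane) (k : Fin 2) :
    HasWeakPartial Ω k (fun _ => 0) (fun _ => 0) :=
  of_integral_eq (locallyIntegrable_zero.locallyIntegrableOn _)
    (locallyIntegrable_zero.locallyIntegrableOn _) fun φ _ _ _ => by simp

theorem sum {ι : Type*} {Ω : Set Plane} {k : Fin 2} {g h : ι → Plane → ℝ} (s : Finset ι)
    (H : ∀ i ∈ s, HasWeakPartial Ω k (g i) (h i)) :
    HasWeakPartial Ω k (fun x => ∑ i ∈ s, g i x) (fun x => ∑ i ∈ s, h i x) := by
  classical
  induction s using Finset.induction_on with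
  | empty => simpa using zero Ω k
  | insert a s ha ih =>
    simp only [Finset.sum_insert ha]
    exact (H a (by simp)).add (ih fun i hi => H i (by simp [hi]))

theorem of_contDiff {g : Plane → ℝ} (hg : ContDiff ℝ ∞ g) (k : Fin 2) :
    HasWeakPartial univ k g (fun x => fderiv ℝ g x (planeBasis k)) := by
  have hg' := contDiff_partial hg (planeBasis k)
  have h1 : LocallyIntegrableOn g univ volume :=
    hg.continuous.locallyIntegrable.locallyIntegrableOn _
  have h2 : LocallyIntegrableOn (fun x => fderiv ℝ g x (planeBasis k)) univ volume :=
    hg'.continuous.locallyIntegrable.locallyIntegrableOn _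
  refine of_integral_eq h1 h2 fun φ hφ hc hs => ?_
  have hφ' := contDiff_partial hφ (planeBasis k)
  have hc' := hc.fderiv_apply ℝ (planeBasis k)
  exact integral_mul_fderiv_eq_neg_fderiv_mul_of_integrable
    (integrable_mul_cutoff h2 hφ.continuous hc hs)
    (integrable_mul_cutoff h1 hφ'.continuous hc' (subset_univ _))
    (integrable_mul_cutoff h1 hφ.continuous hc hs)
    (fun x _ => (hg.differentiable (by simp)) x) (fun x _ => (hφ.differentiable (by simp)) x)

/-- Leibniz rule for the product with a cutoff, which is weakly differentiable on the whole
plane. -/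
theorem cutoff_mul {Ω : Set Plane} {k : Fin 2} {g h χ : Plane → ℝ}
    (H : HasWeakPartial Ω k g h) (hχ : ContDiff ℝ ∞ χ) (hc : HasCompactSupport χ)
    (hs : tsupport χ ⊆ Ω) :
    HasWeakPartial univ k (fun x => χ x * g x)
      (fun x => fderiv ℝ χ x (planeBasis k) * g x + χ x * h x) := by
  have hχ' := contDiff_partial hχ (planeBasis k)
  have hc' := hc.fderiv_apply ℝ (planeBasis k)
  have hs' := (tsupport_fderiv_apply_subset ℝ (f := χ) (planeBasis k)).trans hs
  have i1 := integrable_mul_cutoff H.1 hχ.continuous hc hs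
  have i2 := integrable_mul_cutoff H.1 hχ'.continuous hc' hs'
  have i3 := integrable_mul_cutoff H.2.1 hχ.continuous hc hs
  refine of_integral_eq ?_ ?_ fun φ hφ hφc _ => ?_
  · simp only [mul_comm (χ _)]
    exact i1.locallyIntegrable.locallyIntegrableOn _
  · simp only [mul_comm (χ _), mul_comm (fderiv ℝ χ _ _)]
    exact (i2.add i3).locallyIntegrable.locallyIntegrableOn _
  · have e := H.integral_eq (φ := fun x => χ x * φ x) (hχ.mul hφ) hc.mul_right
      ((tsupport_mul_subset_left).trans hs)
    have hd : ∀ x, fderiv ℝ (fun x => χ x * φ x) x (planeBasis k) =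
        χ x * fderiv ℝ φ x (planeBasis k) + φ x * fderiv ℝ χ x (planeBasis k) := fun x => by
      rw [fderiv_fun_mul (hχ.differentiable (by simp) x) (hφ.differentiable (by simp) x)]
      simp
    simp only [hd] at e
    have hφ' := contDiff_partial hφ (planeBasis k)
    have j1 : Integrable (fun x => g x * (χ x * fderiv ℝ φ x (planeBasis k))) volume :=
      integrable_mul_cutoff H.1 (hχ.continuous.mul hφ'.continuous) hc.mul_right
        (tsupport_mul_subset_left.trans hs)
    have j2 : Integrable (fun x => g x * (φ x * fderiv ℝ χ x (planeBasis k))) volume :=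
      integrable_mul_cutoff H.1 (hφ.continuous.mul hχ'.continuous) hc'.mul_left
        (tsupport_mul_subset_right.trans hs')
    have j3 : Integrable (fun x => h x * (χ x * φ x)) volume :=
      integrable_mul_cutoff H.2.1 (hχ.continuous.mul hφ.continuous) hc.mul_right
        (tsupport_mul_subset_left.trans hs)
    have e1 : ∫ x, g x * (χ x * fderiv ℝ φ x (planeBasis k) +
        φ x * fderiv ℝ χ x (planeBasis k)) =
        (∫ x, g x * (χ x * fderiv ℝ φ x (planeBasis k))) +
        ∫ x, g x * (φ x * fderiv ℝ χ x (planeBasis k)) := by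
      rw [← integral_add j1 j2]; simp only [mul_add]
    have e2 : ∫ x, (fderiv ℝ χ x (planeBasis k) * g x + χ x * h x) * φ x =
        (∫ x, g x * (φ x * fderiv ℝ χ x (planeBasis k))) + ∫ x, h x * (χ x * φ x) := by
      rw [← integral_add j2 j3]; congr 1; ext x; ring
    have e3 : ∫ x, χ x * g x * fderiv ℝ φ x (planeBasis k) =
        ∫ x, g x * (χ x * fderiv ℝ φ x (planeBasis k)) := by congr 1; ext x; ring
    rw [e2, e3]
    linarith

/-- The test function is pulled back along `y ↦ a + r • y`; the chain rule gives the factor `r`, and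
the Jacobian `r ^ 2` is common to both sides. -/
theorem comp_rescale {k : Fin 2} {g h : Plane → ℝ} (H : HasWeakPartial univ k g h)
    (hg : Integrable g volume) (hh : Integrable h volume) (a : Plane) {r : ℝ} (hr : 0 < r) :
    HasWeakPartial univ k (fun x => g (r⁻¹ • (x - a))) (fun x => r⁻¹ * h (r⁻¹ • (x - a))) := by
  let e : Plane ≃ₜ Plane :=
    (Homeomorph.subRight a).trans (Homeomorph.smulOfNeZero r⁻¹ (by positivity))
  have hli : ∀ G : Plane → ℝ, Integrable G volume →
      Integrable (fun x => G (r⁻¹ • (x - a))) volume := fun G hG =>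
    (hG.comp_smul (inv_ne_zero hr.ne')).comp_sub_right a
  refine of_integral_eq ((hli g hg).locallyIntegrable.locallyIntegrableOn _)
    (((hli h hh).const_mul r⁻¹).locallyIntegrable.locallyIntegrableOn _) fun φ hφ hc _ => ?_
  · have hcv : ∀ G : Plane → ℝ, ∫ x, G (r⁻¹ • (x - a)) = r ^ 2 * ∫ y, G y := by
      intro G
      rw [integral_sub_right_eq_self (fun x => G (r⁻¹ • x)) a, Measure.integral_comp_inv_smul]
      simp
    let φ' : Plane → ℝ := fun y => φ (a + r • y)
    have hφ' : ContDiff ℝ ∞ φ' := hφ.comp (by fun_prop)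
    have hcomp : ∀ x, φ' (r⁻¹ • (x - a)) = φ x := fun x => by
      simp [φ', smul_smul, hr.ne']
    have hd : ∀ y, fderiv ℝ φ' y (planeBasis k) = r * fderiv ℝ φ (a + r • y) (planeBasis k) := by
      intro y
      have h1 : HasFDerivAt (fun y : Plane => a + r • y)
          (r • ContinuousLinearMap.id ℝ Plane) y :=
        ((hasFDerivAt_id y).const_smul r).const_add a
      have h2 := (hφ.differentiable (by simp) (a + r • y)).hasFDerivAt.comp y h1
      have h3 : fderiv ℝ φ' y = _ := h2.fderiv
      rw [h3]; simp
    have hc' : HasCompactSupport φ' := by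
      have := hc.comp_homeomorph e.symm
      convert this using 1
      ext y; simp [φ', e, add_comm]
    have h0 := H.integral_eq hφ' hc' (subset_univ _)
    have e1 := hcv (fun y => g y * fderiv ℝ φ' y (planeBasis k))
    have e2 := hcv (fun y => h y * φ' y)
    simp only [hcomp, hd] at e1 e2 h0
    have e3 : ∀ x, a + r • r⁻¹ • (x - a) = x := fun x => by simp [smul_smul, hr.ne']
    simp only [e3] at e1
    have e4 : ∫ x, g (r⁻¹ • (x - a)) * fderiv ℝ φ x (planeBasis k) =
        r⁻¹ * ∫ x, g (r⁻¹ • (x - a)) * (r * fderiv ℝ φ x (planeBasis k)) := by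
      rw [← integral_const_mul]; congr 1; ext x; field_simp
    have e5 : ∫ x, r⁻¹ * h (r⁻¹ • (x - a)) * φ x = r⁻¹ * ∫ x, h (r⁻¹ • (x - a)) * φ x := by
      rw [← integral_const_mul]; congr 1; ext x; ring
    rw [e4, e5, e1, e2, h0]; ring

/-- A limit in `L¹` of smooth functions whose partial derivatives converge in `L¹`. -/
theorem of_approx {k : Fin 2} {g h : Plane → ℝ} (hg : Integrable g volume)
    (hh : Integrable h volume)
    (H : ∀ ε : ℝ, 0 < ε → ∃ ψ : Plane → ℝ, ContDiff ℝ ∞ ψ ∧ HasCompactSupport ψ ∧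
      ∫ x, ‖g x - ψ x‖ ≤ ε ∧ ∫ x, ‖h x - fderiv ℝ ψ x (planeBasis k)‖ ≤ ε) :
    HasWeakPartial univ k g h := by
  refine of_integral_eq (hg.locallyIntegrable.locallyIntegrableOn _)
    (hh.locallyIntegrable.locallyIntegrableOn _) fun φ hφ hc _ => ?_
  have hφ' := contDiff_partial hφ (planeBasis k)
  have hc' := hc.fderiv_apply ℝ (planeBasis k)
  obtain ⟨B, hB⟩ := hφ.continuous.bounded_above_of_compact_support hc
  obtain ⟨B', hB'⟩ := hφ'.continuous.bounded_above_of_compact_support hc'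
  have hB0 : 0 ≤ B := (norm_nonneg _).trans (hB 0)
  have hB0' : 0 ≤ B' := (norm_nonneg _).trans (hB' 0)
  -- The identity is exact for `ψ`, so the error is at most the `L¹` distances times the sup norms
  -- `B'` and `B` of the test function's derivative and of the test function.
  have key : ∀ ε : ℝ, 0 < ε →
      ‖(∫ x, g x * fderiv ℝ φ x (planeBasis k)) + ∫ x, h x * φ x‖ ≤ 0 + ε * (B' + B) := by
    intro ε hε
    obtain ⟨ψ, hψ, hψc, h1, h2⟩ := H ε hε
    have hψ' := contDiff_partial hψ (planeBasis k)
    have hψc' := hψc.fderiv_apply ℝ (planeBasis k)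
    have w := (of_contDiff hψ k).integral_eq hφ hc (subset_univ _)
    have iψ : Integrable ψ volume := hψ.continuous.integrable_of_hasCompactSupport hψc
    have iψ' : Integrable (fun x => fderiv ℝ ψ x (planeBasis k)) volume :=
      hψ'.continuous.integrable_of_hasCompactSupport hψc'
    have bm : ∀ G : Plane → ℝ, Integrable G volume → Integrable (fun x => G x * φ x) volume :=
      fun G hG => hG.mul_bdd hφ.continuous.aestronglyMeasurable (ae_of_all _ hB)
    have bm' : ∀ G : Plane → ℝ, Integrable G volume →
        Integrable (fun x => G x * fderiv ℝ φ x (planeBasis k)) volume :=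
      fun G hG => hG.mul_bdd hφ'.continuous.aestronglyMeasurable (ae_of_all _ hB')
    have e1 : (∫ x, g x * fderiv ℝ φ x (planeBasis k)) =
        (∫ x, (g x - ψ x) * fderiv ℝ φ x (planeBasis k)) +
          ∫ x, ψ x * fderiv ℝ φ x (planeBasis k) := by
      rw [← integral_add (bm' (fun x => g x - ψ x) (hg.sub iψ)) (bm' _ iψ)]; congr 1; ext x; ring
    have e2 : (∫ x, h x * φ x) =
        (∫ x, (h x - fderiv ℝ ψ x (planeBasis k)) * φ x) +
          ∫ x, fderiv ℝ ψ x (planeBasis k) * φ x := by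
      rw [← integral_add
        (bm (fun x => h x - fderiv ℝ ψ x (planeBasis k)) (hh.sub iψ')) (bm _ iψ')]; congr 1; ext x; ring
    have e3 : (∫ x, g x * fderiv ℝ φ x (planeBasis k)) + ∫ x, h x * φ x =
        (∫ x, (g x - ψ x) * fderiv ℝ φ x (planeBasis k)) +
          ∫ x, (h x - fderiv ℝ ψ x (planeBasis k)) * φ x := by
      rw [e1, e2]; linarith
    rw [e3]
    have b1 : ‖∫ x, (g x - ψ x) * fderiv ℝ φ x (planeBasis k)‖ ≤ ε * B' := by
      refine (norm_integral_le_integral_norm _).trans ?_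
      refine le_trans ?_ (mul_le_mul_of_nonneg_right h1 hB0')
      rw [← integral_mul_const]
      refine integral_mono (bm' _ (hg.sub iψ)).norm ((hg.sub iψ).norm.mul_const _) fun x => ?_
      simp only [norm_mul]
      exact mul_le_mul_of_nonneg_left (hB' x) (norm_nonneg _)
    have b2 : ‖∫ x, (h x - fderiv ℝ ψ x (planeBasis k)) * φ x‖ ≤ ε * B := by
      refine (norm_integral_le_integral_norm _).trans ?_
      refine le_trans ?_ (mul_le_mul_of_nonneg_right h2 hB0)
      rw [← integral_mul_const]
      refine integral_mono (bm _ (hh.sub iψ')).norm ((hh.sub iψ').norm.mul_const _) fun x => ?_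
      simp only [norm_mul]
      exact mul_le_mul_of_nonneg_left (hB x) (norm_nonneg _)
    refine (norm_add_le _ _).trans ?_
    linarith
  have h0 : ‖(∫ x, g x * fderiv ℝ φ x (planeBasis k)) + ∫ x, h x * φ x‖ ≤ 0 := by
    refine le_of_forall_pos_le_add fun ε hε => ?_
    refine (key (ε / (B' + B + 1)) (by positivity)).trans ?_
    have : ε / (B' + B + 1) * (B' + B) ≤ ε := by
      rw [div_mul_eq_mul_div, div_le_iff₀ (by positivity)]
      nlinarith
    linarith
  have := norm_le_zero_iff.mp h0
  linarith

end HasWeakPartial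

/-- The weak gradient and the weak Hessian of `u` on `Ω` are `Du` and `D2u`. -/
structure HasWeakDerivs {m : ℕ} (Ω : Set Plane) (u : Plane → Vec m)
    (Du : Plane → GradSpace m) (D2u : Plane → HessSpace m) : Prop where
  weak_grad : ∀ i j, HasWeakPartial Ω j (fun x => u x i) (fun x => Du x (i, j))
  weak_hess : ∀ i j k, HasWeakPartial Ω k (fun x => Du x (i, j)) (fun x => D2u x (i, j, k))

/-! ### Mollification. -/

section Mollify

variable {E : Type*} [NormedAddCommGroup E] [NormedSpace ℝ E]

/-- Convolution with the normalized bump function `ρ`. -/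
noncomputable def mollify (ρ : ContDiffBump (0 : Plane)) (g : Plane → E) : Plane → E :=
  convolution (ρ.normed volume) g (ContinuousLinearMap.lsmul ℝ ℝ) volume

theorem mollify_apply (ρ : ContDiffBump (0 : Plane)) (g : Plane → E) (x : Plane) :
    mollify ρ g x = ∫ t, ρ.normed volume t • g (x - t) := rfl

theorem convolutionExists_mollify (ρ : ContDiffBump (0 : Plane)) {g : Plane → E}
    (hg : LocallyIntegrable g volume) :
    ConvolutionExists (ρ.normed volume) g (ContinuousLinearMap.lsmul ℝ ℝ) volume :=
  ρ.hasCompactSupport_normed.convolutionExists_left _ ρ.continuous_normed hg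

theorem contDiff_mollify (ρ : ContDiffBump (0 : Plane)) {g : Plane → E}
    (hg : LocallyIntegrable g volume) : ContDiff ℝ ∞ (mollify ρ g) :=
  ρ.hasCompactSupport_normed.contDiff_convolution_left _ (n := ⊤) ρ.contDiff_normed hg

/-- The kernel is the density of a probability measure `ν`. Jensen's inequality, in the form of
monotonicity of `L^p` norms in the exponent, bounds each value; Tonelli and translation invariance
finish. -/
theorem eLpNorm_mollify_le (ρ : ContDiffBump (0 : Plane)) {g : Plane → E} {p : ℝ≥0∞}
    (hp : 1 ≤ p) (hp' : p ≠ ⊤) (hg : AEStronglyMeasurable g volume) :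
    eLpNorm (mollify ρ g) p volume ≤ eLpNorm g p volume := by
  set d : Plane → ℝ≥0∞ := fun t => ENNReal.ofReal (ρ.normed volume t) with hd
  have hdm : Measurable d := ρ.continuous_normed.measurable.ennreal_ofReal
  set ν : Measure Plane := volume.withDensity d with hν
  have hac : ν ≪ volume := withDensity_absolutelyContinuous _ _
  have hν1 : IsProbabilityMeasure ν := ⟨by
    rw [hν, withDensity_apply _ MeasurableSet.univ, Measure.restrict_univ,
      ← ofReal_integral_eq_lintegral_ofReal ρ.integrable_normed
        (ae_of_all _ fun x => ρ.nonneg_normed x), ρ.integral_normed, ENNReal.ofReal_one]⟩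
  have hp0 : p ≠ 0 := (zero_lt_one.trans_le hp).ne'
  have hpr : 0 < p.toReal := ENNReal.toReal_pos hp0 hp'
  have hgx : ∀ x, AEStronglyMeasurable (fun t => g (x - t)) volume := fun x =>
    hg.comp_quasiMeasurePreserving (quasiMeasurePreserving_sub_left_of_right_invariant volume x)
  have h1 : ∀ x, ‖mollify ρ g x‖ₑ ^ p.toReal ≤ ∫⁻ t, ‖g (x - t)‖ₑ ^ p.toReal ∂ν := by
    intro x
    have e1 : ‖mollify ρ g x‖ₑ ≤ eLpNorm (fun t => g (x - t)) 1 ν := by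
      rw [mollify_apply, eLpNorm_one_eq_lintegral_enorm, hν,
        lintegral_withDensity_eq_lintegral_mul₀ hdm.aemeasurable (hgx x).enorm]
      refine (enorm_integral_le_lintegral_enorm _).trans (le_of_eq ?_)
      refine lintegral_congr fun t => ?_
      rw [enorm_smul, Pi.mul_apply, hd, Real.enorm_eq_ofReal (ρ.nonneg_normed t)]
    have e2 := e1.trans (eLpNorm_le_eLpNorm_of_exponent_le hp ((hgx x).mono_ac hac))
    rw [eLpNorm_eq_lintegral_rpow_enorm_toReal hp0 hp'] at e2
    calc _ ≤ ((∫⁻ t, ‖g (x - t)‖ₑ ^ p.toReal ∂ν) ^ (1 / p.toReal)) ^ p.toReal := by gcongr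
      _ = _ := by rw [← ENNReal.rpow_mul, one_div_mul_cancel hpr.ne', ENNReal.rpow_one]
  rw [eLpNorm_eq_lintegral_rpow_enorm_toReal hp0 hp',
    eLpNorm_eq_lintegral_rpow_enorm_toReal hp0 hp']
  gcongr ?_ ^ _
  calc ∫⁻ x, ‖mollify ρ g x‖ₑ ^ p.toReal
      ≤ ∫⁻ x, (∫⁻ t, ‖g (x - t)‖ₑ ^ p.toReal ∂ν) := lintegral_mono h1
    _ = ∫⁻ t, (∫⁻ x, ‖g (x - t)‖ₑ ^ p.toReal) ∂ν := by
        refine lintegral_lintegral_swap ?_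
        have := hg.comp_quasiMeasurePreserving
          (quasiMeasurePreserving_sub_of_right_invariant volume ν)
        exact this.enorm.pow_const _
    _ = ∫⁻ _t, (∫⁻ x, ‖g x‖ₑ ^ p.toReal) ∂ν := by
        refine lintegral_congr fun t => ?_
        exact lintegral_sub_right_eq_self (fun x => ‖g x‖ₑ ^ p.toReal) t
    _ = _ := by simp

theorem mollify_eq_zero (ρ : ContDiffBump (0 : Plane)) {g : Plane → E} {K : Set Plane}
    (hK : ∀ x ∉ K, g x = 0) {x : Plane} (hx : x ∉ Metric.thickening ρ.rOut K) :
    mollify ρ g x = 0 := by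
  rw [mollify_apply]
  refine integral_eq_zero_of_ae (ae_of_all _ fun t => ?_)
  by_cases ht : t ∈ Metric.ball (0 : Plane) ρ.rOut
  · have : x - t ∉ K := fun h => hx (Metric.mem_thickening_iff.mpr ⟨_, h, by
      simpa [dist_eq_norm] using ht⟩)
    simp [hK _ this]
  · have : ρ.normed volume t = 0 := by
      rw [← Function.notMem_support, ρ.support_normed_eq]; exact ht
    simp [this]

/-- Approximation by a compactly supported continuous `G`, with uniform continuity for `G` and the
contraction bound for `g - G`. A threshold on the radius is produced, not one bump, so that a map
and its derivatives can share a kernel. -/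
theorem exists_forall_eLpNorm_mollify_sub_le [CompleteSpace E] {g : Plane → E} {p : ℝ≥0∞}
    (hp : 1 ≤ p) (hp' : p ≠ ⊤) (hg : MemLp g p volume) {ε : ℝ≥0∞} (hε : ε ≠ 0) :
    ∃ δ > 0, ∀ ρ : ContDiffBump (0 : Plane), ρ.rOut < δ →
      eLpNorm (fun x => g x - mollify ρ g x) p volume ≤ ε := by
  have hε3 : ε / 3 ≠ 0 := by simp [hε]
  obtain ⟨G, hGc, hgG, hG, hGp⟩ := hg.exists_hasCompactSupport_eLpNorm_sub_le hp' hε3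
  set V : ℝ≥0∞ := volume (Metric.cthickening 1 (tsupport G)) with hV
  have hVf : V < ⊤ := (hGc.isCompact.cthickening).measure_lt_top
  -- For radii below one `G - mollify ρ G` lives on a set of measure `V`, so a uniform error `η`
  -- costs `V ^ (1 / p) * η`.
  obtain ⟨η, hη, hηV⟩ : ∃ η : ℝ, 0 < η ∧ V ^ p.toReal⁻¹ * ENNReal.ofReal η ≤ ε / 3 := by
    have hVp : V ^ p.toReal⁻¹ ≠ ⊤ := ENNReal.rpow_ne_top_of_nonneg (by positivity) hVf.ne
    obtain ⟨η, hη, h⟩ := ENNReal.exists_nnreal_pos_mul_lt hVp hε3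
    refine ⟨η, hη, ?_⟩
    rw [mul_comm, ENNReal.ofReal_coe_nnreal]; exact h.le
  obtain ⟨δ, hδ, hδG⟩ := Metric.uniformContinuous_iff.mp
    (hGc.uniformContinuous_of_continuous hG) η hη
  refine ⟨min δ 1, by positivity, fun ρ hρ => ?_⟩
  have hgl := hg.locallyIntegrable hp
  have hGl := hG.locallyIntegrable (μ := (volume : Measure Plane))
  have hsub : ∀ x, mollify ρ (g - G) x = mollify ρ g x - mollify ρ G x := by
    intro x
    have i1 := convolutionExists_mollify ρ hgl x
    have i2 := convolutionExists_mollify ρ hGl x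
    simp only [mollify_apply, Pi.sub_apply, smul_sub]
    exact integral_sub i1 i2
  have hsm : AEStronglyMeasurable (g - G) volume := (hg.sub hGp).aestronglyMeasurable
  have hGb : eLpNorm (fun x => G x - mollify ρ G x) p volume ≤ ε / 3 := by
    have hsupp : Function.support (fun x => G x - mollify ρ G x) ⊆
        Metric.cthickening 1 (tsupport G) := by
      intro x hx
      by_contra hx'
      refine hx ?_
      have h1 : x ∉ tsupport G := fun h => hx' (Metric.self_subset_cthickening _ h)
      have h2 : mollify ρ G x = 0 := by
        refine mollify_eq_zero ρ (K := tsupport G)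
          (fun y hy => image_eq_zero_of_notMem_tsupport hy) fun h => hx' ?_
        exact Metric.thickening_subset_cthickening_of_le (hρ.le.trans (min_le_right _ _)) _ h
      simp [h2, image_eq_zero_of_notMem_tsupport h1]
    rw [← eLpNorm_restrict_eq_of_support_subset hsupp]
    refine le_trans (eLpNorm_le_of_ae_bound (C := η) (ae_of_all _ fun x => ?_)) ?_
    · rw [← dist_eq_norm, dist_comm]
      refine ContDiffBump.dist_normed_convolution_le hG.aestronglyMeasurable fun y hy => ?_
      exact (hδG ((Metric.mem_ball.mp hy).trans (hρ.trans_le (min_le_left _ _)))).le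
    · simpa using hηV
  have e : (fun x => g x - mollify ρ g x) =
      (g - G) + ((fun x => G x - mollify ρ G x) + - mollify ρ (g - G)) := by
    ext x; simp [hsub x]
  have m1 : AEStronglyMeasurable (fun x => G x - mollify ρ G x) volume :=
    (hG.sub (contDiff_mollify ρ hGl).continuous).aestronglyMeasurable
  have m2 : AEStronglyMeasurable (- mollify ρ (g - G)) volume :=
    (contDiff_mollify ρ (hgl.sub hGl)).continuous.aestronglyMeasurable.neg
  rw [e]
  refine (eLpNorm_add_le hsm (m1.add m2) hp).trans ?_
  refine (add_le_add_right (eLpNorm_add_le m1 m2 hp) _).trans ?_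
  rw [eLpNorm_neg]
  refine (add_le_add hgG (add_le_add hGb ((eLpNorm_mollify_le ρ hp hp' hsm).trans hgG))).trans ?_
  rw [← add_assoc, ENNReal.add_thirds]

end Mollify

/-- The derivative falls on the kernel, and `t ↦ ρ (x - t)` is an admissible test function; its
reflection supplies the sign that cancels the one from integration by parts. -/
theorem HasWeakPartial.fderiv_mollify {k : Fin 2} {g h : Plane → ℝ}
    (H : HasWeakPartial univ k g h) (ρ : ContDiffBump (0 : Plane)) (x : Plane) :
    fderiv ℝ (mollify ρ g) x (planeBasis k) = mollify ρ h x := by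
  have hg := locallyIntegrableOn_univ.mp H.1
  have hh := locallyIntegrableOn_univ.mp H.2.1
  have hρ : ContDiff ℝ ∞ (ρ.normed volume) := ρ.contDiff_normed (n := ⊤)
  have h1 := ρ.hasCompactSupport_normed.hasFDerivAt_convolution_left (μ := volume)
    (ContinuousLinearMap.lsmul ℝ ℝ) (hρ.of_le (by simp)) hg x
  have h2 : Integrable (fun t => (ContinuousLinearMap.precompL Plane
      (ContinuousLinearMap.lsmul ℝ ℝ)) (fderiv ℝ (ρ.normed volume) t) (g (x - t))) volume :=
    (ρ.hasCompactSupport_normed.fderiv ℝ).convolutionExists_left _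
      (hρ.continuous_fderiv (by simp)) hg x
  have h3 : fderiv ℝ (mollify ρ g) x = _ := h1.fderiv
  rw [h3, convolution_def, ContinuousLinearMap.integral_apply h2, mollify_apply]
  have e1 : ∫ t, ((ContinuousLinearMap.precompL Plane (ContinuousLinearMap.lsmul ℝ ℝ))
      (fderiv ℝ (ρ.normed volume) t) (g (x - t))) (planeBasis k) =
      ∫ t, g t * fderiv ℝ (ρ.normed volume) (x - t) (planeBasis k) := by
    rw [← integral_sub_left_eq_self (fun t => g t *
      fderiv ℝ (ρ.normed volume) (x - t) (planeBasis k)) volume x]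
    congr 1; ext t; simp [mul_comm]
  have e2 : ∫ t, ρ.normed volume t • h (x - t) = ∫ t, h t * ρ.normed volume (x - t) := by
    rw [← integral_sub_left_eq_self (fun t => h t * ρ.normed volume (x - t)) volume x]
    congr 1; ext t; simp [mul_comm]
  have hd : ∀ t, fderiv ℝ (fun t => ρ.normed volume (x - t)) t (planeBasis k) =
      - fderiv ℝ (ρ.normed volume) (x - t) (planeBasis k) := by
    intro t
    have d1 : HasFDerivAt (fun t : Plane => x - t) (-(ContinuousLinearMap.id ℝ Plane)) t :=
      (hasFDerivAt_id t).const_sub x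
    have d2 := (hρ.differentiable (by simp) (x - t)).hasFDerivAt.comp t d1
    have d3 : fderiv ℝ (fun t => ρ.normed volume (x - t)) t = _ := d2.fderiv
    rw [d3]; simp
  have hcs : HasCompactSupport (fun t => ρ.normed volume (x - t)) :=
    ρ.hasCompactSupport_normed.comp_homeomorph (Homeomorph.subLeft x)
  have := H.integral_eq (φ := fun t => ρ.normed volume (x - t))
    (hρ.comp (contDiff_const.sub contDiff_id)) hcs (subset_univ _)
  simp only [hd, mul_neg, integral_neg, neg_inj] at this
  rw [e1, e2, this]

theorem mollify_euclidean_apply {ι : Type*} [Fintype ι] {g : Plane → EuclideanSpace ℝ ι}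
    (hg : LocallyIntegrable g volume) (ρ : ContDiffBump (0 : Plane)) (x : Plane) (i : ι) :
    mollify ρ g x i = mollify ρ (fun y => g y i) x := by
  have h := convolutionExists_mollify ρ hg x
  have := (EuclideanSpace.proj (𝕜 := ℝ) i : EuclideanSpace ℝ ι →L[ℝ] ℝ).integral_comp_comm h
  simp only [mollify_apply]
  simpa using this.symm

/-- Compactly supported `W^{2,p}` maps on the plane are limits of smooth maps with support near
theirs. -/
theorem HasWeakDerivs.exists_smooth_approx {m : ℕ} {U : Plane → Vec m}
    {DU : Plane → GradSpace m} {D2U : Plane → HessSpace m} (H : HasWeakDerivs univ U DU D2U)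
    {p : ℝ≥0∞} (hp : 1 ≤ p) (hp' : p ≠ ⊤) (h0 : MemLp U p volume) (h1 : MemLp DU p volume)
    (h2 : MemLp D2U p volume) {K : Set Plane} (hK : ∀ x ∉ K, U x = 0)
    {r : ℝ} (hr : 0 < r) {ε : ℝ≥0∞} (hε : ε ≠ 0) :
    ∃ ψ : Plane → Vec m, ContDiff ℝ ∞ ψ ∧ tsupport ψ ⊆ Metric.cthickening r K ∧
      eLpNorm (fun x => U x - ψ x) p volume ≤ ε ∧
      eLpNorm (fun x => DU x - classicalGrad ψ x) p volume ≤ ε ∧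
      eLpNorm (fun x => D2U x - classicalHess ψ x) p volume ≤ ε := by
  obtain ⟨δ0, hδ0, H0⟩ := exists_forall_eLpNorm_mollify_sub_le hp hp' h0 hε
  obtain ⟨δ1, hδ1, H1⟩ := exists_forall_eLpNorm_mollify_sub_le hp hp' h1 hε
  obtain ⟨δ2, hδ2, H2⟩ := exists_forall_eLpNorm_mollify_sub_le hp hp' h2 hε
  set δ := min (min δ0 δ1) (min δ2 r) with hδ
  have hδp : 0 < δ := by positivity
  -- One kernel for the map and both derivatives: its radius `δ / 2` is below all three thresholds
  -- and below `r`.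
  let ρ : ContDiffBump (0 : Plane) := ⟨δ / 4, δ / 2, by positivity, by linarith⟩
  have hρ : ρ.rOut < δ := by show δ / 2 < δ; linarith
  have l0 := h0.locallyIntegrable hp
  have l1 := h1.locallyIntegrable hp
  have l2 := h2.locallyIntegrable hp
  have hG : classicalGrad (mollify ρ U) = mollify ρ DU := by
    ext x ⟨i, j⟩
    rw [mollify_euclidean_apply l1]
    simp only [classicalGrad]
    rw [← (H.weak_grad i j).fderiv_mollify ρ x]
    simp only [mollify_euclidean_apply l0]
  have hH : classicalHess (mollify ρ U) = mollify ρ D2U := by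
    ext x ⟨i, j, k⟩
    rw [mollify_euclidean_apply l2]
    simp only [classicalHess, hG]
    rw [← (H.weak_hess i j k).fderiv_mollify ρ x]
    simp only [mollify_euclidean_apply l1]
  have hl0 : δ ≤ δ0 := (min_le_left _ _).trans (min_le_left _ _)
  have hl1 : δ ≤ δ1 := (min_le_left _ _).trans (min_le_right _ _)
  have hl2 : δ ≤ δ2 := (min_le_right _ _).trans (min_le_left _ _)
  have hlr : δ ≤ r := (min_le_right _ _).trans (min_le_right _ _)
  refine ⟨mollify ρ U, contDiff_mollify ρ l0, ?_, H0 ρ (hρ.trans_le hl0), ?_, ?_⟩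
  · refine closure_minimal (fun x hx => ?_) Metric.isClosed_cthickening
    by_contra hx'
    exact hx (mollify_eq_zero ρ hK fun h => hx'
      (Metric.thickening_subset_cthickening_of_le (hρ.le.trans hlr) _ h))
  · rw [hG]; exact H1 ρ (hρ.trans_le hl1)
  · rw [hH]; exact H2 ρ (hρ.trans_le hl2)

/-! ### Classical derivatives and symmetry of Hessians. -/

theorem euclidean_norm_le_of_forall_abs_le {ι : Type*} [Fintype ι] {x : EuclideanSpace ℝ ι}
    {c : ℝ} (h : ∀ i, |x i| ≤ c) : ‖x‖ ≤ Fintype.card ι * c := by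
  rw [EuclideanSpace.norm_eq]
  have h1 : ∑ i, ‖x i‖ ≤ Fintype.card ι * c := by
    calc ∑ i, ‖x i‖ ≤ ∑ _i : ι, c := Finset.sum_le_sum fun i _ => h i
      _ = _ := by simp
  have h0 : 0 ≤ ∑ i, ‖x i‖ := Finset.sum_nonneg fun i _ => norm_nonneg _
  refine Real.sqrt_le_iff.mpr ⟨h0.trans h1, ?_⟩
  refine le_trans ?_ (pow_le_pow_left₀ h0 h1 2)
  exact Finset.sum_sq_le_sq_sum_of_nonneg fun i _ => norm_nonneg _

theorem euclidean_abs_apply_le {ι : Type*} [Fintype ι] (x : EuclideanSpace ℝ ι) (i : ι) :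
    |x i| ≤ ‖x‖ := PiLp.norm_apply_le x i

section Classical

variable {m : ℕ} {ψ : Plane → Vec m}

theorem contDiff_classicalGrad (hψ : ContDiff ℝ ∞ ψ) : ContDiff ℝ ∞ (classicalGrad ψ) :=
  contDiff_euclidean.mpr fun a => contDiff_partial (contDiff_euclidean.mp hψ a.1) _

theorem contDiff_classicalHess (hψ : ContDiff ℝ ∞ ψ) : ContDiff ℝ ∞ (classicalHess ψ) :=
  contDiff_euclidean.mpr fun _ =>
    contDiff_partial (contDiff_euclidean.mp (contDiff_classicalGrad hψ) _) _

theorem tsupport_apply_subset {ι : Type*} [Fintype ι] (ψ : Plane → EuclideanSpace ℝ ι) (i : ι) :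
    tsupport (fun x => ψ x i) ⊆ tsupport ψ :=
  tsupport_comp_subset (g := fun v : EuclideanSpace ℝ ι => v i) rfl ψ

theorem tsupport_classicalGrad_subset (ψ : Plane → Vec m) :
    tsupport (classicalGrad ψ) ⊆ tsupport ψ := by
  refine closure_minimal (fun x hx => ?_) (isClosed_tsupport ψ)
  by_contra hx'
  refine hx ?_
  ext a
  simp only [classicalGrad]
  rw [fderiv_of_notMem_tsupport ℝ fun h => hx' (tsupport_apply_subset ψ a.1 h)]
  simp

theorem tsupport_classicalHess_subset (ψ : Plane → Vec m) :
    tsupport (classicalHess ψ) ⊆ tsupport ψ := by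
  refine closure_minimal (fun x hx => ?_) (isClosed_tsupport ψ)
  by_contra hx'
  refine hx ?_
  ext a
  simp only [classicalHess]
  rw [fderiv_of_notMem_tsupport ℝ fun h =>
    hx' (tsupport_classicalGrad_subset ψ (tsupport_apply_subset _ _ h))]
  simp

end Classical

/-- The entries `(i, j, k)` and `(i, k, j)` agree. -/
def IsSymmHess {m : ℕ} (ξ : HessSpace m) : Prop := ∀ i j k, ξ (i, j, k) = ξ (i, k, j)

theorem fderiv_partial_comm {g : Plane → ℝ} (hg : ContDiff ℝ ∞ g) (x v w : Plane) :
    fderiv ℝ (fun y => fderiv ℝ g y v) x w = fderiv ℝ (fun y => fderiv ℝ g y w) x v := by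
  have h1 : DifferentiableAt ℝ (fderiv ℝ g) x :=
    (hg.fderiv_right (m := ∞) (by simp)).differentiable (by simp) x
  have h2 : IsSymmSndFDerivAt ℝ g x := hg.contDiffAt.isSymmSndFDerivAt (by
    simpa using (WithTop.coe_le_coe.mpr (le_top : (2 : ℕ∞) ≤ ⊤)))
  rw [fderiv_clm_apply h1 (differentiableAt_const _), fderiv_clm_apply h1 (differentiableAt_const _)]
  simpa using h2 w v

theorem isSymmHess_classicalHess {m : ℕ} {ψ : Plane → Vec m} (hψ : ContDiff ℝ ∞ ψ) (x : Plane) :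
    IsSymmHess (classicalHess ψ x) := fun i _ _ =>
  fderiv_partial_comm (contDiff_euclidean.mp hψ i) x _ _

namespace HasWeakDerivs

variable {m : ℕ} {Ω : Set Plane} {u : Plane → Vec m} {Du : Plane → GradSpace m}
  {D2u : Plane → HessSpace m}

theorem mono (H : HasWeakDerivs Ω u Du D2u) {Ω' : Set Plane} (hs : Ω' ⊆ Ω) :
    HasWeakDerivs Ω' u Du D2u :=
  ⟨fun i j => (H.weak_grad i j).mono hs, fun i j k => (H.weak_hess i j k).mono hs⟩

theorem add {v : Plane → Vec m} {Dv : Plane → GradSpace m} {D2v : Plane → HessSpace m}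
    (H : HasWeakDerivs Ω u Du D2u) (H' : HasWeakDerivs Ω v Dv D2v) :
    HasWeakDerivs Ω (fun x => u x + v x) (fun x => Du x + Dv x) (fun x => D2u x + D2v x) :=
  ⟨fun i j => (H.weak_grad i j).add (H'.weak_grad i j),
    fun i j k => (H.weak_hess i j k).add (H'.weak_hess i j k)⟩

theorem const_smul (H : HasWeakDerivs Ω u Du D2u) (c : ℝ) :
    HasWeakDerivs Ω (fun x => c • u x) (fun x => c • Du x) (fun x => c • D2u x) :=
  ⟨fun i j => (H.weak_grad i j).const_mul c, fun i j k => (H.weak_hess i j k).const_mul c⟩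

theorem sub {v : Plane → Vec m} {Dv : Plane → GradSpace m} {D2v : Plane → HessSpace m}
    (H : HasWeakDerivs Ω u Du D2u) (H' : HasWeakDerivs Ω v Dv D2v) :
    HasWeakDerivs Ω (fun x => u x - v x) (fun x => Du x - Dv x) (fun x => D2u x - D2v x) := by
  simpa [sub_eq_add_neg] using H.add (H'.const_smul (-1))

theorem zero (Ω : Set Plane) : HasWeakDerivs Ω (fun _ => (0 : Vec m)) (fun _ => 0) (fun _ => 0) :=
  ⟨fun _ j => HasWeakPartial.zero Ω j, fun _ _ k => HasWeakPartial.zero Ω k⟩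

theorem sum {ι : Type*} {u : ι → Plane → Vec m} {Du : ι → Plane → GradSpace m}
    {D2u : ι → Plane → HessSpace m} (s : Finset ι)
    (H : ∀ i ∈ s, HasWeakDerivs Ω (u i) (Du i) (D2u i)) :
    HasWeakDerivs Ω (fun x => ∑ i ∈ s, u i x) (fun x => ∑ i ∈ s, Du i x)
      (fun x => ∑ i ∈ s, D2u i x) := by
  classical
  induction s using Finset.induction_on with
  | empty => simpa using zero Ω
  | insert a s ha ih =>
    simp only [Finset.sum_insert ha]
    exact (H a (by simp)).add (ih fun i hi => H i (by simp [hi]))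

theorem of_contDiff {ψ : Plane → Vec m} (hψ : ContDiff ℝ ∞ ψ) :
    HasWeakDerivs univ ψ (classicalGrad ψ) (classicalHess ψ) :=
  ⟨fun i j => HasWeakPartial.of_contDiff (contDiff_euclidean.mp hψ i) j,
    fun i j k => HasWeakPartial.of_contDiff
      (contDiff_euclidean.mp (contDiff_classicalGrad hψ) (i, j)) k⟩

/-- Weak Hessians are symmetric. -/
theorem isSymmHess_ae (H : HasWeakDerivs Ω u Du D2u) (hΩ : IsOpen Ω) :
    ∀ᵐ x ∂(volume.restrict Ω), IsSymmHess (D2u x) := by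
  have h1 : ∀ i j k, ∀ᵐ x ∂(volume : Measure Plane), x ∈ Ω →
      D2u x (i, j, k) - D2u x (i, k, j) = 0 := by
    intro i j k
    refine hΩ.ae_eq_zero_of_integral_contDiff_smul_eq_zero
      ((H.weak_hess i j k).2.1.sub (H.weak_hess i k j).2.1) fun φ hφ hc hs => ?_
    -- Both derivatives are moved onto the test function, where they commute.
    have aux : ∀ j k, ∫ x, D2u x (i, j, k) * φ x = ∫ x, u x i *
        fderiv ℝ (fun y => fderiv ℝ φ y (planeBasis k)) x (planeBasis j) := by
      intro j k
      have e1 := (H.weak_hess i j k).integral_eq hφ hc hs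
      have e2 := (H.weak_grad i j).integral_eq (contDiff_partial hφ (planeBasis k))
        (hc.fderiv_apply ℝ _) ((tsupport_fderiv_apply_subset ℝ _).trans hs)
      rw [e2, e1, neg_neg]
    have i1 := integrable_mul_cutoff (H.weak_hess i j k).2.1 hφ.continuous hc hs
    have i2 := integrable_mul_cutoff (H.weak_hess i k j).2.1 hφ.continuous hc hs
    have : ∫ x, φ x • (D2u x (i, j, k) - D2u x (i, k, j)) =
        (∫ x, D2u x (i, j, k) * φ x) - ∫ x, D2u x (i, k, j) * φ x := by
      rw [← integral_sub i1 i2]; congr 1; ext x; rw [smul_eq_mul]; ring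
    refine this.trans ?_
    rw [aux, aux, sub_eq_zero]
    congr 1; ext x; rw [fderiv_partial_comm hφ]
  rw [ae_restrict_iff' hΩ.measurableSet]
  have h2 : ∀ᵐ x ∂(volume : Measure Plane), ∀ i j k, x ∈ Ω →
      D2u x (i, j, k) - D2u x (i, k, j) = 0 := by
    simp only [ae_all_iff]; exact h1
  filter_upwards [h2] with x hx hxΩ i j k
  exact sub_eq_zero.mp (hx i j k hxΩ)

end HasWeakDerivs

/-! ### Cutoffs and the Leibniz rule. -/

section Cutoff

variable {m : ℕ}

/-- The gradient of `χ u` according to the Leibniz rule. -/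
noncomputable def cutoffGrad (χ : Plane → ℝ) (u : Plane → Vec m) (Du : Plane → GradSpace m)
    (x : Plane) : GradSpace m :=
  WithLp.toLp 2 fun a => fderiv ℝ χ x (planeBasis a.2) * u x a.1 + χ x * Du x a

/-- The Hessian of `χ u` according to the Leibniz rule. -/
noncomputable def cutoffHess (χ : Plane → ℝ) (u : Plane → Vec m) (Du : Plane → GradSpace m)
    (D2u : Plane → HessSpace m) (x : Plane) : HessSpace m :=
  WithLp.toLp 2 fun a =>
    (fderiv ℝ (fun y => fderiv ℝ χ y (planeBasis a.2.1)) x (planeBasis a.2.2) * u x a.1 +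
      fderiv ℝ χ x (planeBasis a.2.1) * Du x (a.1, a.2.2)) +
    (fderiv ℝ χ x (planeBasis a.2.2) * Du x (a.1, a.2.1) + χ x * D2u x a)

theorem HasWeakDerivs.cutoff {Ω : Set Plane} {u : Plane → Vec m} {Du : Plane → GradSpace m}
    {D2u : Plane → HessSpace m} (H : HasWeakDerivs Ω u Du D2u) {χ : Plane → ℝ}
    (hχ : ContDiff ℝ ∞ χ) (hc : HasCompactSupport χ) (hs : tsupport χ ⊆ Ω) :
    HasWeakDerivs univ (fun x => χ x • u x) (cutoffGrad χ u Du) (cutoffHess χ u Du D2u) := by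
  refine ⟨fun i j => (H.weak_grad i j).cutoff_mul hχ hc hs, fun i j k => ?_⟩
  exact ((H.weak_grad i k).cutoff_mul (contDiff_partial hχ (planeBasis j)) (hc.fderiv_apply ℝ _)
    ((tsupport_fderiv_apply_subset ℝ _).trans hs)).add ((H.weak_hess i j k).cutoff_mul hχ hc hs)

theorem memLp_cutoff_mul {Ω : Set Plane} (hΩ : MeasurableSet Ω) {q : ℝ≥0∞} {g χ : Plane → ℝ}
    (hg : MemLp g q (volume.restrict Ω)) (hχ : Continuous χ) (hc : HasCompactSupport χ)
    (hs : tsupport χ ⊆ Ω) : MemLp (fun x => χ x * g x) q volume := by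
  obtain ⟨B, hB⟩ := hχ.bounded_above_of_compact_support hc
  have h1 : MemLp (Ω.indicator g) q volume := (memLp_indicator_iff_restrict hΩ).mpr hg
  have h2 : (fun x => χ x * g x) = fun x => χ x * Ω.indicator g x := by
    ext x
    by_cases hx : x ∈ Ω
    · simp [hx]
    · simp [image_eq_zero_of_notMem_tsupport (fun h => hx (hs h))]
  rw [h2]
  refine MemLp.of_le_mul (c := B) h1 (hχ.aestronglyMeasurable.mul h1.1) (ae_of_all _ fun x => ?_)
  rw [norm_mul]
  exact mul_le_mul_of_nonneg_right (hB x) (norm_nonneg _)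

theorem IsSobolev2.hasWeakDerivs {Ω : Set Plane} {q : ℝ≥0∞} {u : Plane → Vec m}
    {Du : Plane → GradSpace m} {D2u : Plane → HessSpace m} (H : IsSobolev2 Ω q u Du D2u) :
    HasWeakDerivs Ω u Du D2u := ⟨H.weak_grad, H.weak_hess⟩

theorem IsSobolev2.memLp_cutoff {Ω : Set Plane} (hΩ : MeasurableSet Ω) {q : ℝ≥0∞}
    {u : Plane → Vec m} {Du : Plane → GradSpace m} {D2u : Plane → HessSpace m}
    (H : IsSobolev2 Ω q u Du D2u) {χ : Plane → ℝ} (hχ : ContDiff ℝ ∞ χ)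
    (hc : HasCompactSupport χ) (hs : tsupport χ ⊆ Ω) :
    MemLp (fun x => χ x • u x) q volume ∧ MemLp (cutoffGrad χ u Du) q volume ∧
      MemLp (cutoffHess χ u Du D2u) q volume := by
  have hu := memLp_piLp_iff.mp H.memLp
  have hDu := memLp_piLp_iff.mp H.memLp_grad
  have hD2u := memLp_piLp_iff.mp H.memLp_hess
  have hχ' := fun k => contDiff_partial hχ (planeBasis k)
  have hc' := fun k => hc.fderiv_apply ℝ (planeBasis k)
  have hs' := fun k => (tsupport_fderiv_apply_subset ℝ (f := χ) (planeBasis k)).trans hs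
  refine ⟨memLp_piLp_iff.mpr fun i => ?_, memLp_piLp_iff.mpr fun a => ?_,
    memLp_piLp_iff.mpr fun a => ?_⟩
  · exact memLp_cutoff_mul hΩ (hu i) hχ.continuous hc hs
  · exact (memLp_cutoff_mul hΩ (hu a.1) (hχ' _).continuous (hc' _) (hs' _)).add
      (memLp_cutoff_mul hΩ (hDu a) hχ.continuous hc hs)
  · refine ((memLp_cutoff_mul hΩ (hu a.1) (contDiff_partial (hχ' a.2.1) _).continuous
      ((hc' _).fderiv_apply ℝ _) ((tsupport_fderiv_apply_subset ℝ _).trans (hs' _))).add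
      (memLp_cutoff_mul hΩ (hDu _) (hχ' _).continuous (hc' _) (hs' _))).add
      ((memLp_cutoff_mul hΩ (hDu _) (hχ' _).continuous (hc' _) (hs' _)).add
      (memLp_cutoff_mul hΩ (hD2u a) hχ.continuous hc hs))

/-- The constant depends on `χ` and `m` only, so one cutoff can serve a whole family of maps in
`exists_insertion`. -/
theorem exists_cutoff_bound (m : ℕ) {χ : Plane → ℝ} (hχ : ContDiff ℝ ∞ χ)
    (hc : HasCompactSupport χ) :
    ∃ A : ℝ, 0 ≤ A ∧ ∀ (u : Plane → Vec m) (Du : Plane → GradSpace m)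
      (D2u : Plane → HessSpace m) (x : Plane),
      ‖χ x • u x‖ ≤ A * (‖u x‖ + ‖Du x‖ + ‖D2u x‖) ∧
      ‖cutoffGrad χ u Du x‖ ≤ A * (‖u x‖ + ‖Du x‖ + ‖D2u x‖) ∧
      ‖cutoffHess χ u Du D2u x‖ ≤ A * (‖u x‖ + ‖Du x‖ + ‖D2u x‖) := by
  have hχ' := fun k => contDiff_partial hχ (planeBasis k)
  have hc' := fun k => hc.fderiv_apply ℝ (planeBasis k)
  obtain ⟨B, hB⟩ := hχ.continuous.bounded_above_of_compact_support hc
  choose B1 hB1 using fun k => (hχ' k).continuous.bounded_above_of_compact_support (hc' k)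
  choose B2 hB2 using fun j k => (contDiff_partial (hχ' j) (planeBasis k)).continuous
    |>.bounded_above_of_compact_support ((hc' j).fderiv_apply ℝ _)
  have hB0 : 0 ≤ B := (norm_nonneg _).trans (hB 0)
  have hB10 : ∀ k, 0 ≤ B1 k := fun k => (norm_nonneg _).trans (hB1 k 0)
  have hB20 : ∀ j k, 0 ≤ B2 j k := fun j k => (norm_nonneg _).trans (hB2 j k 0)
  set M : ℝ := B + ∑ k, B1 k + ∑ j, ∑ k, B2 j k with hM
  have hS1 : 0 ≤ ∑ k, B1 k := Finset.sum_nonneg fun k _ => hB10 k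
  have hS2 : 0 ≤ ∑ j, ∑ k, B2 j k :=
    Finset.sum_nonneg fun j _ => Finset.sum_nonneg fun k _ => hB20 j k
  have hM0 : 0 ≤ M := by positivity
  have b0 : ∀ x, |χ x| ≤ M := fun x => (hB x).trans (by linarith)
  have b1 : ∀ k x, |fderiv ℝ χ x (planeBasis k)| ≤ M := fun k x => (hB1 k x).trans (by
    have := Finset.single_le_sum (f := B1) (fun k _ => hB10 k) (Finset.mem_univ k); linarith)
  have b2 : ∀ j k x, |fderiv ℝ (fun y => fderiv ℝ χ y (planeBasis j)) x (planeBasis k)| ≤ M :=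
    fun j k x => (hB2 j k x).trans (by
      have h1 := Finset.single_le_sum (f := B2 j) (fun k _ => hB20 j k) (Finset.mem_univ k)
      have h2 := Finset.single_le_sum (f := fun j => ∑ k, B2 j k)
        (fun j _ => Finset.sum_nonneg fun k _ => hB20 j k) (Finset.mem_univ j)
      linarith)
  have hmul : ∀ {a b c d : ℝ}, |a| ≤ c → |b| ≤ d → |a * b| ≤ c * d := fun h1 h2 => by
    rw [abs_mul]
    exact mul_le_mul h1 h2 (abs_nonneg _) ((abs_nonneg _).trans h1)
  -- The factor `2` is due to the two terms with `Du` in each entry of the Hessian of the product.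
  refine ⟨M + Fintype.card (Fin m × Fin 2) * (2 * M) + Fintype.card (Fin m × Fin 2 × Fin 2) *
    (2 * M), by positivity, fun u Du D2u x => ?_⟩
  set N := ‖u x‖ + ‖Du x‖ + ‖D2u x‖ with hN
  have n0 := norm_nonneg (u x)
  have n1 := norm_nonneg (Du x)
  have n2 := norm_nonneg (D2u x)
  have hN0 : 0 ≤ N := by positivity
  have c1 : 0 ≤ Fintype.card (Fin m × Fin 2) * (2 * M) * N := by positivity
  have c2 : 0 ≤ Fintype.card (Fin m × Fin 2 × Fin 2) * (2 * M) * N := by positivity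
  have c0 : 0 ≤ M * N := by positivity
  refine ⟨?_, ?_, ?_⟩
  · rw [norm_smul]
    have : ‖χ x‖ * ‖u x‖ ≤ M * N :=
      mul_le_mul (b0 x) (by linarith) (norm_nonneg _) hM0
    linarith
  · have := euclidean_norm_le_of_forall_abs_le (x := cutoffGrad χ u Du x) (c := 2 * M * N)
      fun a => by
        have h1 := hmul (b1 a.2 x) (euclidean_abs_apply_le (u x) a.1)
        have h2 := hmul (b0 x) (euclidean_abs_apply_le (Du x) a)
        refine (abs_add_le _ _).trans ?_
        nlinarith
    linarith
  · have := euclidean_norm_le_of_forall_abs_le (x := cutoffHess χ u Du D2u x) (c := 2 * M * N)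
      fun a => by
        have h1 := hmul (b2 a.2.1 a.2.2 x) (euclidean_abs_apply_le (u x) a.1)
        have h2 := hmul (b1 a.2.1 x) (euclidean_abs_apply_le (Du x) (a.1, a.2.2))
        have h3 := hmul (b1 a.2.2 x) (euclidean_abs_apply_le (Du x) (a.1, a.2.1))
        have h4 := hmul (b0 x) (euclidean_abs_apply_le (D2u x) a)
        refine (abs_add_le _ _).trans ((add_le_add (abs_add_le _ _) (abs_add_le _ _)).trans ?_)
        nlinarith
    linarith

end Cutoff

/-! ### Squares and rescaling. -/

/-- The open square with centre `a` and side `r`. -/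
def square (a : Plane) (r : ℝ) : Set Plane := {x | ∀ i, |x i - a i| < r / 2}

/-- The closed square with centre `a` and side `r`. -/
def closedSquare (a : Plane) (r : ℝ) : Set Plane := {x | ∀ i, |x i - a i| ≤ r / 2}

theorem square_zero_one : square 0 1 = unitSquare := by
  ext x; simp [square, unitSquare]

theorem isOpen_square (a : Plane) (r : ℝ) : IsOpen (square a r) := by
  simp only [square, ofPred_forall]
  exact isOpen_iInter_of_finite fun i => isOpen_lt (by fun_prop) continuous_const

theorem isClosed_closedSquare (a : Plane) (r : ℝ) : IsClosed (closedSquare a r) := by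
  simp only [closedSquare, ofPred_forall]
  exact isClosed_iInter fun i => isClosed_le (by fun_prop) continuous_const

theorem isOpen_unitSquare : IsOpen unitSquare := square_zero_one ▸ isOpen_square 0 1

theorem square_subset_closedSquare (a : Plane) (r : ℝ) : square a r ⊆ closedSquare a r :=
  fun _ hx i => (hx i).le

theorem closedSquare_subset_square (a : Plane) {r s : ℝ} (h : r < s) :
    closedSquare a r ⊆ square a s := fun _ hx i => (hx i).trans_lt (by linarith)

theorem closedSquare_subset_closedBall (a : Plane) (r : ℝ) :
    closedSquare a r ⊆ Metric.closedBall a r := by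
  intro x hx
  have h0 := hx 0
  have h1 := hx 1
  have hr : 0 ≤ r := by have := abs_nonneg (x 0 - a 0); linarith
  rw [Metric.mem_closedBall, EuclideanSpace.dist_eq]
  refine Real.sqrt_le_iff.mpr ⟨hr, ?_⟩
  rw [Fin.sum_univ_two, Real.dist_eq, Real.dist_eq]
  nlinarith [abs_nonneg (x 0 - a 0), abs_nonneg (x 1 - a 1)]

theorem closedBall_subset_closedSquare (a : Plane) (r : ℝ) :
    Metric.closedBall a r ⊆ closedSquare a (2 * r) := by
  intro x hx i
  have := euclidean_abs_apply_le (x - a) i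
  rw [Metric.mem_closedBall, dist_eq_norm] at hx
  simp only [PiLp.sub_apply] at this
  linarith

theorem isCompact_closedSquare (a : Plane) (r : ℝ) : IsCompact (closedSquare a r) :=
  (isCompact_closedBall a r).of_isClosed_subset (isClosed_closedSquare a r)
    (closedSquare_subset_closedBall a r)

theorem mem_square_iff {a : Plane} {r : ℝ} (hr : 0 < r) {x : Plane} :
    x ∈ square a r ↔ r⁻¹ • (x - a) ∈ unitSquare := by
  simp only [square, unitSquare, mem_ofPred_eq, PiLp.smul_apply, PiLp.sub_apply, smul_eq_mul,
    abs_mul, abs_inv, abs_of_pos hr]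
  refine forall_congr' fun i => ?_
  rw [inv_mul_lt_iff₀ hr]
  ring_nf

theorem volume_square (a : Plane) {r : ℝ} (hr : 0 ≤ r) :
    volume (square a r) = ENNReal.ofReal (r ^ 2) := by
  have h : square a r = (@WithLp.ofLp 2 (Fin 2 → ℝ)) ⁻¹'
      (Set.pi univ fun i => Ioo (a i - r / 2) (a i + r / 2)) := by
    ext x
    simp only [square, mem_ofPred_eq, mem_preimage, mem_univ_pi, mem_Ioo, abs_lt]
    exact forall_congr' fun i => ⟨fun h => ⟨by linarith [h.1], by linarith [h.2]⟩,
      fun h => ⟨by linarith [h.1], by linarith [h.2]⟩⟩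
  rw [h, (PiLp.volume_preserving_ofLp (Fin 2)).measure_preimage
    (MeasurableSet.univ_pi fun i => measurableSet_Ioo).nullMeasurableSet, Real.volume_pi_Ioo,
    Fin.prod_univ_two, ← ENNReal.ofReal_mul (by linarith)]
  congr 1; ring

theorem volume_closedSquare (a : Plane) {r : ℝ} (hr : 0 ≤ r) :
    volume (closedSquare a r) = ENNReal.ofReal (r ^ 2) := by
  have h : closedSquare a r = (@WithLp.ofLp 2 (Fin 2 → ℝ)) ⁻¹'
      (Icc (fun i => a i - r / 2) (fun i => a i + r / 2)) := by
    ext x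
    simp only [closedSquare, mem_ofPred_eq, mem_preimage, mem_Icc, abs_le, Pi.le_def]
    rw [← forall_and]
    exact forall_congr' fun i => ⟨fun h => ⟨by linarith [h.1], by linarith [h.2]⟩,
      fun h => ⟨by linarith [h.1], by linarith [h.2]⟩⟩
  rw [h, (PiLp.volume_preserving_ofLp (Fin 2)).measure_preimage
    measurableSet_Icc.nullMeasurableSet, Real.volume_Icc_pi,
    Fin.prod_univ_two, ← ENNReal.ofReal_mul (by linarith)]
  congr 1; ring

theorem volume_unitSquare : volume unitSquare = 1 := by
  rw [← square_zero_one, volume_square 0 zero_le_one]; simp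

theorem integral_comp_rescale (G : Plane → ℝ) (a : Plane) {r : ℝ} :
    ∫ x, G (r⁻¹ • (x - a)) = r ^ 2 * ∫ y, G y := by
  rw [integral_sub_right_eq_self (fun x => G (r⁻¹ • x)) a, Measure.integral_comp_inv_smul]
  simp

theorem integrable_comp_rescale {G : Plane → ℝ} (hG : Integrable G volume) (a : Plane) {r : ℝ}
    (hr : 0 < r) : Integrable (fun x => G (r⁻¹ • (x - a))) volume :=
  (hG.comp_smul (inv_ne_zero hr.ne')).comp_sub_right a

theorem indicator_square_rescale (G : Plane → ℝ) (a : Plane) {r : ℝ} (hr : 0 < r) (x : Plane) :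
    (square a r).indicator (fun x => G (r⁻¹ • (x - a))) x =
      unitSquare.indicator G (r⁻¹ • (x - a)) := by
  by_cases hx : x ∈ square a r
  · rw [indicator_of_mem hx, indicator_of_mem ((mem_square_iff hr).mp hx)]
  · rw [indicator_of_notMem hx, indicator_of_notMem fun h => hx ((mem_square_iff hr).mpr h)]

theorem setIntegral_square_rescale (G : Plane → ℝ) (a : Plane) {r : ℝ} (hr : 0 < r) :
    ∫ x in square a r, G (r⁻¹ • (x - a)) = r ^ 2 * ∫ y in unitSquare, G y := by
  rw [← integral_indicator (isOpen_square a r).measurableSet,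
    ← integral_indicator isOpen_unitSquare.measurableSet, ← integral_comp_rescale _ a]
  simp only [indicator_square_rescale G a hr]

theorem integrableOn_square_rescale {G : Plane → ℝ} (hG : IntegrableOn G unitSquare volume)
    (a : Plane) {r : ℝ} (hr : 0 < r) :
    IntegrableOn (fun x => G (r⁻¹ • (x - a))) (square a r) volume := by
  rw [← integrable_indicator_iff (isOpen_square a r).measurableSet]
  rw [← integrable_indicator_iff isOpen_unitSquare.measurableSet] at hG
  refine (integrable_comp_rescale hG a hr).congr (ae_of_all _ fun x => ?_)
  exact (indicator_square_rescale G a hr x).symm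

/-! ### Bounded maps vanishing outside a set, and their relation to `W^{2,∞}_0`. -/

/-- `θ` is a bounded map on the plane with bounded weak gradient `Dθ` and bounded weak Hessian
`D2θ`, all of which vanish outside `S`. -/
structure IsBddSobolev2 {m : ℕ} (S : Set Plane) (θ : Plane → Vec m)
    (Dθ : Plane → GradSpace m) (D2θ : Plane → HessSpace m) : Prop where
  meas : Measurable θ
  meas_grad : Measurable Dθ
  meas_hess : Measurable D2θ
  bdd : ∃ B : ℝ, ∀ x, ‖θ x‖ ≤ B ∧ ‖Dθ x‖ ≤ B ∧ ‖D2θ x‖ ≤ B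
  eq_zero : ∀ x ∉ S, θ x = 0 ∧ Dθ x = 0 ∧ D2θ x = 0
  weak : HasWeakDerivs univ θ Dθ D2θ

theorem memLp_of_bdd_of_eq_zero {ι : Type*} [Fintype ι] {S : Set Plane} (hS : volume S ≠ ⊤)
    {F : Plane → EuclideanSpace ℝ ι} (hF : AEStronglyMeasurable F volume) {B : ℝ}
    (hB : ∀ x, ‖F x‖ ≤ B) (h0 : ∀ x ∉ S, F x = 0) (q : ℝ≥0∞) : MemLp F q volume := by
  refine ⟨hF, ?_⟩
  rw [← eLpNorm_restrict_eq_of_support_subset (s := S)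
    fun x hx => by_contra fun h => hx (h0 x h)]
  refine (eLpNorm_le_of_ae_bound (ae_of_all _ hB)).trans_lt ?_
  refine ENNReal.mul_lt_top (ENNReal.rpow_lt_top_of_nonneg (by positivity) ?_)
    ENNReal.ofReal_lt_top
  simpa using hS

namespace IsBddSobolev2

variable {m : ℕ} {S : Set Plane} {θ : Plane → Vec m} {Dθ : Plane → GradSpace m}
  {D2θ : Plane → HessSpace m}

theorem memLp (H : IsBddSobolev2 S θ Dθ D2θ) (hS : volume S ≠ ⊤) (q : ℝ≥0∞) :
    MemLp θ q volume ∧ MemLp Dθ q volume ∧ MemLp D2θ q volume := by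
  obtain ⟨B, hB⟩ := H.bdd
  exact ⟨memLp_of_bdd_of_eq_zero hS H.meas.aestronglyMeasurable (fun x => (hB x).1)
      (fun x hx => (H.eq_zero x hx).1) q,
    memLp_of_bdd_of_eq_zero hS H.meas_grad.aestronglyMeasurable (fun x => (hB x).2.1)
      (fun x hx => (H.eq_zero x hx).2.1) q,
    memLp_of_bdd_of_eq_zero hS H.meas_hess.aestronglyMeasurable (fun x => (hB x).2.2)
      (fun x hx => (H.eq_zero x hx).2.2) q⟩

theorem mono (H : IsBddSobolev2 S θ Dθ D2θ) {T : Set Plane} (h : S ⊆ T) :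
    IsBddSobolev2 T θ Dθ D2θ :=
  { H with eq_zero := fun x hx => H.eq_zero x fun hs => hx (h hs) }

theorem add {θ' : Plane → Vec m} {Dθ' : Plane → GradSpace m} {D2θ' : Plane → HessSpace m}
    (H : IsBddSobolev2 S θ Dθ D2θ) (H' : IsBddSobolev2 S θ' Dθ' D2θ') :
    IsBddSobolev2 S (fun x => θ x + θ' x) (fun x => Dθ x + Dθ' x) (fun x => D2θ x + D2θ' x) := by
  obtain ⟨B, hB⟩ := H.bdd
  obtain ⟨B', hB'⟩ := H'.bdd
  refine ⟨H.meas.add H'.meas, H.meas_grad.add H'.meas_grad, H.meas_hess.add H'.meas_hess,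
    ⟨B + B', fun x => ⟨?_, ?_, ?_⟩⟩, fun x hx => ?_, H.weak.add H'.weak⟩
  · exact norm_add_le_of_le (hB x).1 (hB' x).1
  · exact norm_add_le_of_le (hB x).2.1 (hB' x).2.1
  · exact norm_add_le_of_le (hB x).2.2 (hB' x).2.2
  · have h1 := H.eq_zero x hx
    have h2 := H'.eq_zero x hx
    simp [h1, h2]

theorem zero (S : Set Plane) :
    IsBddSobolev2 S (fun _ => (0 : Vec m)) (fun _ => 0) (fun _ => 0) :=
  ⟨measurable_const, measurable_const, measurable_const, ⟨0, by simp⟩, by simp,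
    HasWeakDerivs.zero _⟩

theorem sum {ι : Type*} {θ : ι → Plane → Vec m} {Dθ : ι → Plane → GradSpace m}
    {D2θ : ι → Plane → HessSpace m} (s : Finset ι)
    (H : ∀ i ∈ s, IsBddSobolev2 S (θ i) (Dθ i) (D2θ i)) :
    IsBddSobolev2 S (fun x => ∑ i ∈ s, θ i x) (fun x => ∑ i ∈ s, Dθ i x)
      (fun x => ∑ i ∈ s, D2θ i x) := by
  classical
  induction s using Finset.induction_on with
  | empty => simpa using zero S
  | insert a s ha ih =>
    simp only [Finset.sum_insert ha]
    exact (H a (by simp)).add (ih fun i hi => H i (by simp [hi]))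

/-- The amplitude `r ^ 2` is the one that leaves the Hessian unscaled; the map and its gradient
become small with `r`. -/
theorem rescale (H : IsBddSobolev2 S θ Dθ D2θ) (hS : volume S ≠ ⊤) (a : Plane) {r : ℝ}
    (hr : 0 < r) {T : Set Plane} (hT : ∀ x, r⁻¹ • (x - a) ∈ S → x ∈ T) :
    IsBddSobolev2 T (fun x => r ^ 2 • θ (r⁻¹ • (x - a))) (fun x => r • Dθ (r⁻¹ • (x - a)))
      (fun x => D2θ (r⁻¹ • (x - a))) := by
  obtain ⟨B, hB⟩ := H.bdd
  obtain ⟨i0, i1, i2⟩ := H.memLp hS 1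
  rw [memLp_piLp_iff] at i0 i1 i2
  simp only [memLp_one_iff_integrable] at i0 i1 i2
  have hm : Measurable fun x : Plane => r⁻¹ • (x - a) := by fun_prop
  have hB0 : 0 ≤ B := (norm_nonneg _).trans (hB 0).1
  refine ⟨(H.meas.comp hm).const_smul (r ^ 2), (H.meas_grad.comp hm).const_smul r,
    H.meas_hess.comp hm, ⟨(r ^ 2 + r + 1) * B, fun x => ⟨?_, ?_, ?_⟩⟩, fun x hx => ?_, ?_, ?_⟩
  · rw [norm_smul, Real.norm_of_nonneg (by positivity)]
    have := (hB (r⁻¹ • (x - a))).1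
    have := mul_le_mul_of_nonneg_left this (sq_nonneg r)
    nlinarith [mul_nonneg hr.le hB0]
  · rw [norm_smul, Real.norm_of_nonneg (by positivity)]
    have := (hB (r⁻¹ • (x - a))).2.1
    have := mul_le_mul_of_nonneg_left this hr.le
    nlinarith [mul_nonneg (sq_nonneg r) hB0]
  · have := (hB (r⁻¹ • (x - a))).2.2
    nlinarith [mul_nonneg (sq_nonneg r) hB0, mul_nonneg hr.le hB0]
  · have := H.eq_zero _ fun h => hx (hT x h)
    simp [this]
  · intro i j
    have := ((H.weak.weak_grad i j).comp_rescale (i0 i) (i1 (i, j)) a hr).const_mul (r ^ 2)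
    convert this using 2 with x
    · rfl
    · rw [PiLp.smul_apply, smul_eq_mul, ← mul_assoc]
      congr 1
      field_simp
  · intro i j k
    have := ((H.weak.weak_hess i j k).comp_rescale (i1 (i, j)) (i2 (i, j, k)) a hr).const_mul r
    convert this using 2 with x
    · rfl
    · rw [mul_inv_cancel_left₀ hr.ne']

end IsBddSobolev2

/-- Truncation at the essential supremum turns the almost everywhere bound into an everywhere bound,
which survives rescaling and summation without exceptional sets. -/
theorem MeasureTheory.MemLp.exists_bdd_representative {ι : Type*} [Fintype ι] {Q : Set Plane}
    (hQ : MeasurableSet Q) {F : Plane → EuclideanSpace ℝ ι} (hF : MemLp F ⊤ (volume.restrict Q)) :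
    ∃ G : Plane → EuclideanSpace ℝ ι, Measurable G ∧ (∃ B : ℝ, ∀ x, ‖G x‖ ≤ B) ∧
      (∀ x ∉ Q, G x = 0) ∧ G =ᵐ[volume.restrict Q] F := by
  obtain ⟨F', hF', hFF'⟩ := hF.1
  set B := (eLpNormEssSup F (volume.restrict Q)).toReal with hB
  have hF'm : Measurable F' := hF'.measurable
  have hs : MeasurableSet (Q ∩ {x | ‖F' x‖ ≤ B}) :=
    hQ.inter (measurableSet_le hF'm.norm measurable_const)
  refine ⟨(Q ∩ {x | ‖F' x‖ ≤ B}).indicator F', hF'm.indicator hs, ⟨B, fun x => ?_⟩,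
    fun x hx => by simp [hx], ?_⟩
  · by_cases hx : x ∈ Q ∩ {x | ‖F' x‖ ≤ B}
    · rw [indicator_of_mem hx]; exact hx.2
    · rw [indicator_of_notMem hx, norm_zero]; exact ENNReal.toReal_nonneg
  · have hess : ∀ᵐ x ∂(volume.restrict Q), ‖F x‖ₑ ≤ eLpNormEssSup F (volume.restrict Q) :=
      ae_le_eLpNormEssSup
    have hfin : eLpNormEssSup F (volume.restrict Q) ≠ ⊤ := by
      have := hF.2; rw [eLpNorm_exponent_top] at this; exact this.ne
    filter_upwards [hFF', hess, ae_restrict_mem hQ] with x h1 h2 h3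
    have : ‖F' x‖ ≤ B := by
      rw [← h1, ← toReal_enorm]
      exact ENNReal.toReal_mono hfin h2
    have hx : x ∈ Q ∩ {x | ‖F' x‖ ≤ B} := ⟨h3, this⟩
    rw [indicator_of_mem hx, h1]

/-- Carries the `L¹` approximation on `Q` over to the components of zero extensions on the plane. -/
theorem integral_norm_apply_sub_le {ι : Type*} [Fintype ι] {Q : Set Plane}
    {F G Ψ : Plane → EuclideanSpace ℝ ι} {ε : ℝ} (hε : 0 ≤ ε)
    (hG : AEStronglyMeasurable G volume)
    (hΨ : Continuous Ψ) (hG0 : ∀ x ∉ Q, G x = 0) (hΨ0 : ∀ x ∉ Q, Ψ x = 0)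
    (hGF : G =ᵐ[volume.restrict Q] F)
    (h : ∫⁻ x in Q, ‖F x - Ψ x‖ₑ ≤ ENNReal.ofReal ε) (i : ι) :
    ∫ x, ‖G x i - Ψ x i‖ ≤ ε := by
  have hc : Continuous fun v : EuclideanSpace ℝ ι => v i := by fun_prop
  have m1 : AEStronglyMeasurable (fun x => G x i - Ψ x i) volume :=
    (hc.comp_aestronglyMeasurable hG).sub (hc.comp hΨ).aestronglyMeasurable
  rw [integral_norm_eq_lintegral_enorm m1]
  refine ENNReal.toReal_le_of_le_ofReal hε (le_trans ?_ h)
  have h1 : ∫⁻ x, ‖G x i - Ψ x i‖ₑ ≤ ∫⁻ x, ‖G x - Ψ x‖ₑ := by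
    refine lintegral_mono fun x => ?_
    rw [enorm_le_iff_norm_le]
    exact euclidean_abs_apply_le (G x - Ψ x) i
  refine h1.trans (le_of_eq ?_)
  have h2 : ∫⁻ x, ‖G x - Ψ x‖ₑ = ∫⁻ x in Q, ‖G x - Ψ x‖ₑ := by
    rw [setLIntegral_eq_of_support_subset]
    intro x hx
    by_contra hx'
    exact hx (by simp [hG0 x hx', hΨ0 x hx'])
  rw [h2]
  refine lintegral_congr_ae ?_
  filter_upwards [hGF] with x hx
  rw [hx]

/-- The extension by zero of a map in `W^{2,∞}_0`. -/
theorem IsSobolev2InfZero.exists_isBddSobolev2 {m : ℕ} {Q : Set Plane} (hQ : MeasurableSet Q)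
    (hQf : volume Q ≠ ⊤) {φ : Plane → Vec m} {Dφ : Plane → GradSpace m}
    {D2φ : Plane → HessSpace m} (H : IsSobolev2InfZero Q φ Dφ D2φ) :
    ∃ (θ : Plane → Vec m) (Dθ : Plane → GradSpace m) (D2θ : Plane → HessSpace m),
      IsBddSobolev2 Q θ Dθ D2θ ∧ D2θ =ᵐ[volume.restrict Q] D2φ := by
  obtain ⟨θ, m0, ⟨B0, hB0⟩, z0, e0⟩ := H.isSobolev.memLp.exists_bdd_representative hQ
  obtain ⟨Dθ, m1, ⟨B1, hB1⟩, z1, e1⟩ := H.isSobolev.memLp_grad.exists_bdd_representative hQ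
  obtain ⟨D2θ, m2, ⟨B2, hB2⟩, z2, e2⟩ := H.isSobolev.memLp_hess.exists_bdd_representative hQ
  refine ⟨θ, Dθ, D2θ, ⟨m0, m1, m2, ⟨max B0 (max B1 B2), fun x => ⟨?_, ?_, ?_⟩⟩,
    fun x hx => ⟨z0 x hx, z1 x hx, z2 x hx⟩, ?_, ?_⟩, e2⟩
  · exact (hB0 x).trans (le_max_left _ _)
  · exact (hB1 x).trans ((le_max_left _ _).trans (le_max_right _ _))
  · exact (hB2 x).trans ((le_max_right _ _).trans (le_max_right _ _))
  all_goals
    have i0 := memLp_piLp_iff.mp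
      (memLp_of_bdd_of_eq_zero hQf m0.aestronglyMeasurable hB0 z0 1)
    have i1 := memLp_piLp_iff.mp
      (memLp_of_bdd_of_eq_zero hQf m1.aestronglyMeasurable hB1 z1 1)
    have i2 := memLp_piLp_iff.mp
      (memLp_of_bdd_of_eq_zero hQf m2.aestronglyMeasurable hB2 z2 1)
    simp only [memLp_one_iff_integrable] at i0 i1 i2
    -- The approximating maps have compact support in `Q`, hence no boundary terms; in the limit the
    -- zero extension is weakly differentiable across the boundary of `Q`.
    have key : ∀ ε : ℝ, 0 < ε → ∃ ψ : Plane → Vec m, ContDiff ℝ ∞ ψ ∧ HasCompactSupport ψ ∧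
        (∀ i, ∫ x, ‖θ x i - ψ x i‖ ≤ ε) ∧ (∀ a, ∫ x, ‖Dθ x a - classicalGrad ψ x a‖ ≤ ε) ∧
        ∀ a, ∫ x, ‖D2θ x a - classicalHess ψ x a‖ ≤ ε := by
      intro ε hε
      obtain ⟨ψ, hψ, hc, hs, hle⟩ := H.approx ε hε
      have s1 := tsupport_classicalGrad_subset ψ
      have s2 := tsupport_classicalHess_subset ψ
      refine ⟨ψ, hψ, hc, ?_, ?_, ?_⟩
      · exact integral_norm_apply_sub_le hε.le m0.aestronglyMeasurable hψ.continuous z0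
          (fun x hx => image_eq_zero_of_notMem_tsupport fun h => hx (hs h)) e0
          (le_trans (le_self_add.trans le_self_add) hle.le)
      · exact integral_norm_apply_sub_le hε.le m1.aestronglyMeasurable
          (contDiff_classicalGrad hψ).continuous z1
          (fun x hx => image_eq_zero_of_notMem_tsupport fun h => hx (hs (s1 h))) e1
          (le_trans (le_add_self.trans le_self_add) hle.le)
      · exact integral_norm_apply_sub_le hε.le m2.aestronglyMeasurable
          (contDiff_classicalHess hψ).continuous z2
          (fun x hx => image_eq_zero_of_notMem_tsupport fun h => hx (hs (s2 h))) e2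
          (le_trans le_add_self hle.le)
  · intro i j
    refine HasWeakPartial.of_approx (i0 i) (i1 (i, j)) fun ε hε => ?_
    obtain ⟨ψ, hψ, hc, k0, k1, k2⟩ := key ε hε
    exact ⟨fun x => ψ x i, contDiff_euclidean.mp hψ i,
      hc.of_isClosed_subset (isClosed_tsupport _) (tsupport_apply_subset ψ i), k0 i, k1 (i, j)⟩
  · intro i j k
    refine HasWeakPartial.of_approx (i1 (i, j)) (i2 (i, j, k)) fun ε hε => ?_
    obtain ⟨ψ, hψ, hc, k0, k1, k2⟩ := key ε hε
    exact ⟨fun x => classicalGrad ψ x (i, j),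
      contDiff_euclidean.mp (contDiff_classicalGrad hψ) (i, j),
      hc.of_isClosed_subset (isClosed_tsupport _)
        ((tsupport_apply_subset _ _).trans (tsupport_classicalGrad_subset ψ)),
      k1 (i, j), k2 (i, j, k)⟩

/-- Compactness of `K` leaves room to mollify inside `Q`. This is why `exists_insertion` delivers a
support in a compact subset of the square. -/
theorem IsBddSobolev2.isSobolev2InfZero {m : ℕ} {Q K : Set Plane} (hQ : IsOpen Q)
    (hK : IsCompact K) (hKQ : K ⊆ Q) {θ : Plane → Vec m} {Dθ : Plane → GradSpace m}
    {D2θ : Plane → HessSpace m} (H : IsBddSobolev2 K θ Dθ D2θ) :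
    IsSobolev2InfZero Q θ Dθ D2θ := by
  have hKf : volume K ≠ ⊤ := hK.measure_lt_top.ne
  obtain ⟨t0, t1, t2⟩ := H.memLp hKf ⊤
  obtain ⟨s0, s1, s2⟩ := H.memLp hKf 1
  have hw := H.weak.mono (subset_univ Q)
  refine ⟨⟨t0.restrict Q, t1.restrict Q, t2.restrict Q, hw.weak_grad, hw.weak_hess⟩,
    fun ε hε => ?_⟩
  obtain ⟨r, hr, hrQ⟩ := hK.exists_cthickening_subset_open hQ hKQ
  have hε4 : ENNReal.ofReal (ε / 4) ≠ 0 := by simp [hε]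
  obtain ⟨ψ, hψ, hs, e0, e1, e2⟩ := H.weak.exists_smooth_approx le_rfl ENNReal.one_ne_top
    s0 s1 s2 (fun x hx => (H.eq_zero x hx).1) hr hε4
  simp only [eLpNorm_one_eq_lintegral_enorm] at e0 e1 e2
  refine ⟨ψ, hψ, hK.cthickening.of_isClosed_subset (isClosed_tsupport _) hs, hs.trans hrQ, ?_⟩
  refine lt_of_le_of_lt (add_le_add (add_le_add ((setLIntegral_le_lintegral _ _).trans e0)
    ((setLIntegral_le_lintegral _ _).trans e1)) ((setLIntegral_le_lintegral _ _).trans e2)) ?_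
  rw [← ENNReal.ofReal_add (by positivity) (by positivity),
    ← ENNReal.ofReal_add (by positivity) (by positivity)]
  exact (ENNReal.ofReal_lt_ofReal_iff hε).mpr (by linarith)

/-! ### Taylor gap and insertion of a test map. -/

/-- The cutoff equals one on a neighbourhood of `K`, so its derivatives vanish there and
multiplication by it changes no derivative of a map. -/
theorem exists_smooth_cutoff {K U : Set Plane} (hK : IsCompact K) (hU : IsOpen U) (hKU : K ⊆ U) :
    ∃ χ : Plane → ℝ, ContDiff ℝ ∞ χ ∧ HasCompactSupport χ ∧ tsupport χ ⊆ U ∧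
      ∃ V : Set Plane, IsOpen V ∧ K ⊆ V ∧ ∀ x ∈ V, χ x = 1 := by
  obtain ⟨L, hL, hKL, hLU⟩ := exists_compact_between hK hU hKU
  obtain ⟨f, hf1, hf0, -⟩ := exists_contMDiffMap_one_nhds_of_subset_interior
    (n := ⊤) (modelWithCornersSelf ℝ Plane) hK.isClosed hKL
  obtain ⟨v, hv, hv1⟩ := Filter.eventually_iff_exists_mem.mp hf1
  have hs : tsupport f ⊆ L := closure_minimal
    (fun x hx => by_contra fun h => hx (hf0 x h)) hL.isClosed
  exact ⟨f, f.contMDiff.contDiff, hL.of_isClosed_subset (isClosed_tsupport _) hs, hs.trans hLU,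
    interior v, isOpen_interior, subset_interior_iff_mem_nhdsSet.mpr hv,
    fun x hx => hv1 x (interior_subset hx)⟩

section TaylorGap

variable {m : ℕ}

/-- The difference, rescaled to the unit scale, of the quadratic map with Hessian `ξ` that agrees
with `ψ` to first order at `x₀` and of `ψ` itself. -/
noncomputable def taylorGap (ξ : HessSpace m) (ψ : Plane → Vec m) (x₀ : Plane) (r : ℝ)
    (y : Plane) : Vec m :=
  WithLp.toLp 2 fun i => 1 / 2 * ∑ j, ∑ k, ξ (i, j, k) * (y j * y k)
    - r⁻¹ ^ 2 * (ψ (x₀ + r • y) i - ψ x₀ i) + r⁻¹ * ∑ j, classicalGrad ψ x₀ (i, j) * y j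

variable {ξ : HessSpace m} {ψ : Plane → Vec m} {x₀ : Plane} {r : ℝ}

theorem contDiff_taylorGap (hψ : ContDiff ℝ ∞ ψ) : ContDiff ℝ ∞ (taylorGap ξ ψ x₀ r) := by
  refine contDiff_euclidean.mpr fun i => ?_
  have h1 : ContDiff ℝ ∞ fun y : Plane => ψ (x₀ + r • y) i :=
    (contDiff_euclidean.mp hψ i).comp (by fun_prop)
  have h2 : ∀ j, ContDiff ℝ ∞ fun y : Plane => y j := fun j => by fun_prop
  refine ((contDiff_const.mul (ContDiff.sum fun j _ => ContDiff.sum fun k _ =>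
    contDiff_const.mul ((h2 j).mul (h2 k)))).sub (contDiff_const.mul
    (h1.sub contDiff_const))).add (contDiff_const.mul (ContDiff.sum fun j _ =>
    contDiff_const.mul (h2 j)))

theorem taylorGap_zero : taylorGap ξ ψ x₀ r 0 = 0 := by
  ext i; simp [taylorGap]

theorem planeBasis_apply (k j : Fin 2) : planeBasis k j = if j = k then 1 else 0 := by
  simp [planeBasis]

theorem fderiv_comp_affine {h : Plane → ℝ} (hh : ContDiff ℝ ∞ h) (x₀ : Plane) (r : ℝ)
    (y : Plane) : HasFDerivAt (fun y => h (x₀ + r • y)) (r • fderiv ℝ h (x₀ + r • y)) y := by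
  have h1 : HasFDerivAt (fun y : Plane => x₀ + r • y) (r • ContinuousLinearMap.id ℝ Plane) y :=
    ((hasFDerivAt_id y).const_smul r).const_add x₀
  have h2 := (hh.differentiable (by simp) (x₀ + r • y)).hasFDerivAt.comp y h1
  have h3 : r • fderiv ℝ h (x₀ + r • y) =
      (fderiv ℝ h (x₀ + r • y)).comp (r • ContinuousLinearMap.id ℝ Plane) := by ext v; simp
  rw [h3]
  exact h2

theorem hasFDerivAt_coord (j : Fin 2) (y : Plane) :
    HasFDerivAt (fun y : Plane => y j) (EuclideanSpace.proj j : Plane →L[ℝ] ℝ) y :=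
  (EuclideanSpace.proj j : Plane →L[ℝ] ℝ).hasFDerivAt

/-- Symmetry of `ξ` makes `ξ y` the gradient of the quadratic form `1/2 ξ(y, y)`. -/
theorem classicalGrad_taylorGap (hψ : ContDiff ℝ ∞ ψ) (hξ : IsSymmHess ξ) (hr : r ≠ 0)
    (y : Plane) (i : Fin m) (l : Fin 2) :
    classicalGrad (taylorGap ξ ψ x₀ r) y (i, l) = ∑ k, ξ (i, l, k) * y k
      - r⁻¹ * (classicalGrad ψ (x₀ + r • y) (i, l) - classicalGrad ψ x₀ (i, l)) := by
  have h1 := fderiv_comp_affine (contDiff_euclidean.mp hψ i) x₀ r y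
  have h2 := fun j => hasFDerivAt_coord j y
  have h3 := (((HasFDerivAt.fun_sum (u := Finset.univ) fun j _ =>
    HasFDerivAt.fun_sum (u := Finset.univ) fun k _ =>
      ((h2 j).mul (h2 k)).const_mul (ξ (i, j, k))).const_mul (1 / 2)).sub
    ((h1.sub_const (ψ x₀ i)).const_mul (r⁻¹ ^ 2))).add
    ((HasFDerivAt.fun_sum (u := Finset.univ) fun j _ =>
      (h2 j).const_mul (classicalGrad ψ x₀ (i, j))).const_mul r⁻¹)
  have h4 : fderiv ℝ (fun y => taylorGap ξ ψ x₀ r y i) y = _ := h3.fderiv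
  have h5 : ∀ z, classicalGrad ψ z (i, l) = fderiv ℝ (fun y => ψ y i) z (planeBasis l) :=
    fun z => rfl
  have hs := hξ i 0 1
  have h6 : classicalGrad (taylorGap ξ ψ x₀ r) y (i, l) =
    fderiv ℝ (fun y => taylorGap ξ ψ x₀ r y i) y (planeBasis l) := rfl
  rw [h6, h4, h5 (x₀ + r • y)]
  fin_cases l <;> simp [Fin.sum_univ_two, planeBasis_apply, hs] <;> field_simp <;> ring

theorem classicalGrad_taylorGap_zero (hψ : ContDiff ℝ ∞ ψ) (hξ : IsSymmHess ξ) (hr : r ≠ 0) :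
    classicalGrad (taylorGap ξ ψ x₀ r) 0 = 0 := by
  ext ⟨i, l⟩
  rw [classicalGrad_taylorGap hψ hξ hr]
  simp

/-- Adding `r ^ 2 • taylorGap ξ ψ x₀ r (r⁻¹ • (x - x₀))` to `ψ` thus gives Hessian exactly `ξ`; for
`ξ = ∇²ψ(x₀)` the added Hessian is only the oscillation of `∇²ψ`. -/
theorem classicalHess_taylorGap (hψ : ContDiff ℝ ∞ ψ) (hξ : IsSymmHess ξ) (hr : r ≠ 0)
    (y : Plane) :
    classicalHess (taylorGap ξ ψ x₀ r) y = ξ - classicalHess ψ (x₀ + r • y) := by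
  ext ⟨i, l, n⟩
  have h1 := fderiv_comp_affine
    (contDiff_euclidean.mp (contDiff_classicalGrad hψ) (i, l)) x₀ r y
  have h2 := fun j => hasFDerivAt_coord j y
  have h3 := (HasFDerivAt.fun_sum (u := Finset.univ) fun k _ =>
      (h2 k).const_mul (ξ (i, l, k))).sub
    ((h1.sub_const (classicalGrad ψ x₀ (i, l))).const_mul r⁻¹)
  have h4 : (fun y => classicalGrad (taylorGap ξ ψ x₀ r) y (i, l)) = _ :=
    funext fun y => classicalGrad_taylorGap hψ hξ hr y i l
  have h6 : classicalHess (taylorGap ξ ψ x₀ r) y (i, l, n) =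
    fderiv ℝ (fun y => classicalGrad (taylorGap ξ ψ x₀ r) y (i, l)) y (planeBasis n) := rfl
  have h7 : ∀ z, classicalHess ψ z (i, l, n) =
    fderiv ℝ (fun y => classicalGrad ψ y (i, l)) z (planeBasis n) := fun z => rfl
  rw [h6, h4, PiLp.sub_apply, h7]
  have h8 := h3.fderiv
  simp only [Pi.sub_def] at h8
  rw [h8]
  fin_cases n <;> simp [Fin.sum_univ_two, planeBasis_apply] <;> field_simp

end TaylorGap

theorem norm_le_one_of_mem_unitSquare {y : Plane} (hy : y ∈ unitSquare) : ‖y‖ ≤ 1 := by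
  rw [← square_zero_one] at hy
  simpa using closedSquare_subset_closedBall 0 1 (square_subset_closedSquare 0 1 hy)

theorem convex_unitSquare : Convex ℝ unitSquare := by
  intro x hx y hy a b ha hb hab i
  have h1 := hx i
  have h2 := hy i
  rw [abs_lt] at h1 h2 ⊢
  simp only [PiLp.add_apply, PiLp.smul_apply, smul_eq_mul]
  obtain rfl : b = 1 - a := by linarith
  rcases eq_or_lt_of_le ha with rfl | ha'
  · constructor <;> linarith
  · constructor <;> nlinarith

theorem zero_mem_unitSquare : (0 : Plane) ∈ unitSquare := fun i => by simp

/-- Mean value inequality on the convex unit square, whose points have norm at most one; the `2`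
counts the partial derivatives. -/
theorem abs_le_of_forall_partial_le {h : Plane → ℝ} (hd : Differentiable ℝ h) (h0 : h 0 = 0)
    {t : ℝ} (ht : ∀ y ∈ unitSquare, ∀ k, |fderiv ℝ h y (planeBasis k)| ≤ t) {y : Plane}
    (hy : y ∈ unitSquare) : |h y| ≤ 2 * t := by
  have ht0 : 0 ≤ t := (abs_nonneg _).trans (ht y hy 0)
  have hb : ∀ z ∈ unitSquare, ‖fderiv ℝ h z‖ ≤ 2 * t := by
    intro z hz
    refine ContinuousLinearMap.opNorm_le_bound _ (by positivity) fun v => ?_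
    have hv : v = v 0 • planeBasis 0 + v 1 • planeBasis 1 := by
      ext j; fin_cases j <;> simp [planeBasis_apply]
    have e : fderiv ℝ h z v = v 0 * fderiv ℝ h z (planeBasis 0) +
        v 1 * fderiv ℝ h z (planeBasis 1) := by
      conv_lhs => rw [hv]
      simp
    have a0 := euclidean_abs_apply_le v 0
    have a1 := euclidean_abs_apply_le v 1
    have t0 := ht z hz 0
    have t1 := ht z hz 1
    rw [e, Real.norm_eq_abs]
    refine (abs_add_le _ _).trans ?_
    rw [abs_mul, abs_mul]
    nlinarith [mul_le_mul a0 t0 (abs_nonneg _) (norm_nonneg v),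
      mul_le_mul a1 t1 (abs_nonneg _) (norm_nonneg v)]
  have := convex_unitSquare.norm_image_sub_le_of_norm_fderiv_le
    (fun z _ => hd z) hb zero_mem_unitSquare hy
  rw [h0, sub_zero, sub_zero] at this
  refine this.trans ?_
  have := norm_le_one_of_mem_unitSquare hy
  nlinarith

/-- Two integrations from the origin, where `g` and its gradient vanish. -/
theorem exists_bound_of_classicalHess_le (m : ℕ) :
    ∃ A : ℝ, 0 ≤ A ∧ ∀ (g : Plane → Vec m) (t : ℝ), ContDiff ℝ ∞ g → g 0 = 0 →
      classicalGrad g 0 = 0 → (∀ y ∈ unitSquare, ‖classicalHess g y‖ ≤ t) →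
      ∀ y ∈ unitSquare, ‖g y‖ + ‖classicalGrad g y‖ + ‖classicalHess g y‖ ≤ A * t := by
  set c1 : ℝ := Fintype.card (Fin m × Fin 2) * 2 with hc1
  refine ⟨Fintype.card (Fin m) * (2 * c1) + c1 + 1, by positivity,
    fun g t hg h0 h1 ht y hy => ?_⟩
  have b1 : ∀ y ∈ unitSquare, ‖classicalGrad g y‖ ≤ c1 * t := by
    intro y hy
    rw [hc1, mul_assoc]
    refine euclidean_norm_le_of_forall_abs_le fun a => ?_
    refine abs_le_of_forall_partial_le (h := fun y => classicalGrad g y a)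
      ((contDiff_euclidean.mp (contDiff_classicalGrad hg) a).differentiable (by simp))
      (by simp [h1]) (fun z hz k => ?_) hy
    exact (euclidean_abs_apply_le (classicalHess g z) (a.1, a.2, k)).trans (ht z hz)
  have b0 : ‖g y‖ ≤ Fintype.card (Fin m) * (2 * (c1 * t)) := by
    refine euclidean_norm_le_of_forall_abs_le fun i => ?_
    refine abs_le_of_forall_partial_le (h := fun y => g y i)
      ((contDiff_euclidean.mp hg i).differentiable (by simp))
      (by simp [h0]) (fun z hz k => ?_) hy
    exact (euclidean_abs_apply_le (classicalGrad g z) (i, k)).trans (b1 z hz)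
  have := b1 y hy
  have := ht y hy
  nlinarith

theorem cutoff_eq_of_eq_one {m : ℕ} {V : Set Plane} (hV : IsOpen V) {χ : Plane → ℝ}
    (h1 : ∀ x ∈ V, χ x = 1) (u : Plane → Vec m) (Du : Plane → GradSpace m)
    (D2u : Plane → HessSpace m) {x : Plane} (hx : x ∈ V) :
    χ x • u x = u x ∧ cutoffGrad χ u Du x = Du x ∧ cutoffHess χ u Du D2u x = D2u x := by
  have hd : ∀ z ∈ V, fderiv ℝ χ z = 0 := fun z hz => by
    have : χ =ᶠ[nhds z] fun _ => (1 : ℝ) :=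
      Filter.eventuallyEq_of_mem (hV.mem_nhds hz) h1
    rw [this.fderiv_eq]; simp
  have hd2 : ∀ e w, fderiv ℝ (fun y => fderiv ℝ χ y e) x w = 0 := fun e w => by
    have : (fun y => fderiv ℝ χ y e) =ᶠ[nhds x] fun _ => (0 : ℝ) :=
      Filter.eventuallyEq_of_mem (hV.mem_nhds hx) fun z hz => by simp [hd z hz]
    rw [this.fderiv_eq]; simp
  refine ⟨by simp [h1 x hx], ?_, ?_⟩
  · ext a; simp [cutoffGrad, hd x hx, h1 x hx]
  · ext a; simp [cutoffHess, hd x hx, h1 x hx, hd2]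

theorem cutoff_eq_zero {m : ℕ} {χ : Plane → ℝ} (u : Plane → Vec m) (Du : Plane → GradSpace m)
    (D2u : Plane → HessSpace m) {x : Plane} (hx : x ∉ tsupport χ) :
    χ x • u x = 0 ∧ cutoffGrad χ u Du x = 0 ∧ cutoffHess χ u Du D2u x = 0 := by
  have h0 := image_eq_zero_of_notMem_tsupport hx
  have h1 := fderiv_of_notMem_tsupport ℝ hx
  have h2 : ∀ e w, fderiv ℝ (fun y => fderiv ℝ χ y e) x w = 0 := fun e w => by
    rw [fderiv_of_notMem_tsupport ℝ fun h => hx (tsupport_fderiv_apply_subset ℝ e h)]; simp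
  refine ⟨by simp [h0], ?_, ?_⟩
  · ext a; simp [cutoffGrad, h0, h1]
  · ext a; simp [cutoffHess, h0, h1, h2]

/-- A small smooth map `g` is cut off near the boundary of the unit square, and a rescaled test
map `φ` is added on the concentric square of side `1 - η`. -/
theorem exists_insertion (m : ℕ) {η : ℝ} (hη0 : 0 < η) (hη1 : η < 1) :
    ∃ A : ℝ, 0 ≤ A ∧ ∃ K : Set Plane, IsCompact K ∧ K ⊆ unitSquare ∧
      ∀ (g : Plane → Vec m) (t : ℝ), ContDiff ℝ ∞ g → g 0 = 0 → classicalGrad g 0 = 0 →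
      (∀ y ∈ unitSquare, ‖classicalHess g y‖ ≤ t) →
      ∀ (φ : Plane → Vec m) (Dφ : Plane → GradSpace m) (D2φ : Plane → HessSpace m) (B : ℝ),
      IsBddSobolev2 unitSquare φ Dφ D2φ → (∀ x, ‖φ x‖ ≤ B ∧ ‖Dφ x‖ ≤ B) →
      ∃ (Θ : Plane → Vec m) (DΘ : Plane → GradSpace m) (D2Θ : Plane → HessSpace m),
        IsBddSobolev2 K Θ DΘ D2Θ ∧ (∀ y, ‖Θ y‖ ≤ A * t + B ∧ ‖DΘ y‖ ≤ A * t + B) ∧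
        (∀ y ∈ square 0 (1 - η), D2Θ y = classicalHess g y + D2φ ((1 - η)⁻¹ • y)) ∧
        ∀ y ∉ square 0 (1 - η), ‖D2Θ y‖ ≤ A * t := by
  have hη : 0 < 1 - η := by linarith
  have hsub : closedSquare 0 (1 - η) ⊆ unitSquare :=
    square_zero_one ▸ closedSquare_subset_square 0 (by linarith : 1 - η < 1)
  obtain ⟨χ, hχ, hc, hs, V, hV, hKV, hχ1⟩ :=
    exists_smooth_cutoff (isCompact_closedSquare 0 (1 - η)) isOpen_unitSquare hsub
  obtain ⟨A0, hA0, hA⟩ := exists_cutoff_bound m hχ hc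
  obtain ⟨A1, hA1, hA'⟩ := exists_bound_of_classicalHess_le m
  -- `A0` comes from the cutoff, hence from `η`, and `A1` from integrating the Hessian; neither sees
  -- `g`, `t` or `φ`. The compact set must also hold the rescaled `φ`.
  refine ⟨A0 * A1, by positivity, tsupport χ ∪ closedSquare 0 (1 - η),
    hc.isCompact.union (isCompact_closedSquare _ _), union_subset hs hsub,
    fun g t hg h0 h1 ht φ Dφ D2φ B hφ hB => ?_⟩
  have ht0 : 0 ≤ t := (norm_nonneg _).trans (ht 0 zero_mem_unitSquare)
  have hcut : ∀ y, ‖χ y • g y‖ ≤ A0 * A1 * t ∧ ‖cutoffGrad χ g (classicalGrad g) y‖ ≤ A0 * A1 * t ∧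
      ‖cutoffHess χ g (classicalGrad g) (classicalHess g) y‖ ≤ A0 * A1 * t := by
    intro y
    by_cases hy : y ∈ unitSquare
    · have h2 := mul_le_mul_of_nonneg_left (hA' g t hg h0 h1 ht y hy) hA0
      rw [← mul_assoc] at h2
      obtain ⟨a, b, c⟩ := hA g (classicalGrad g) (classicalHess g) y
      exact ⟨a.trans h2, b.trans h2, c.trans h2⟩
    · obtain ⟨a, b, c⟩ := cutoff_eq_zero g (classicalGrad g) (classicalHess g)
        (fun h => hy (hs h))
      rw [a, b, c]
      simp only [norm_zero]
      have : 0 ≤ A0 * A1 * t := by positivity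
      exact ⟨this, this, this⟩
  have hcont1 : Continuous (cutoffGrad χ g (classicalGrad g)) := by
    unfold cutoffGrad
    have e1 := fun a => (contDiff_partial hχ (planeBasis a)).continuous
    have e2 := hχ.continuous
    have e3 := hg.continuous
    have e4 := (contDiff_classicalGrad hg).continuous
    fun_prop
  have hcont2 : Continuous (cutoffHess χ g (classicalGrad g) (classicalHess g)) := by
    unfold cutoffHess
    have e1 := fun a => (contDiff_partial hχ (planeBasis a)).continuous
    have e5 := fun a b => (contDiff_partial (contDiff_partial hχ (planeBasis a))
      (planeBasis b)).continuous
    have e2 := hχ.continuous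
    have e3 := fun i => (contDiff_euclidean.mp hg i).continuous
    have e4 := fun i => (contDiff_euclidean.mp (contDiff_classicalGrad hg) i).continuous
    have e6 := fun i => (contDiff_euclidean.mp (contDiff_classicalHess hg) i).continuous
    refine (PiLp.continuous_toLp 2 _).comp (continuous_pi fun a => ?_)
    exact (((e5 a.2.1 a.2.2).mul (e3 _)).add ((e1 _).mul (e4 _))).add
      (((e1 _).mul (e4 _)).add (e2.mul (e6 _)))
  have H1 : IsBddSobolev2 (tsupport χ ∪ closedSquare 0 (1 - η)) (fun x => χ x • g x)
      (cutoffGrad χ g (classicalGrad g)) (cutoffHess χ g (classicalGrad g) (classicalHess g)) :=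
    ⟨(hχ.continuous.smul hg.continuous).measurable, hcont1.measurable, hcont2.measurable,
      ⟨_, hcut⟩, fun x hx => cutoff_eq_zero g _ _ fun h => hx (Or.inl h),
      (HasWeakDerivs.of_contDiff hg).cutoff hχ hc (subset_univ _)⟩
  -- Shrunk to the core, `φ` keeps its Hessian values, and its other bounds do not grow because `1 -
  -- η ≤ 1`.
  have H2 := hφ.rescale (by simp [volume_unitSquare]) 0 hη
    (T := tsupport χ ∪ closedSquare 0 (1 - η)) fun x hx =>
      Or.inr (square_subset_closedSquare _ _ ((mem_square_iff hη).mpr hx))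
  simp only [sub_zero] at H2
  refine ⟨_, _, _, H1.add H2, fun y => ⟨?_, ?_⟩, fun y hy => ?_, fun y hy => ?_⟩
  · refine norm_add_le_of_le (hcut y).1 ?_
    rw [norm_smul, Real.norm_of_nonneg (by positivity)]
    have := (hB ((1 - η)⁻¹ • y)).1
    have h3 := norm_nonneg (φ ((1 - η)⁻¹ • y))
    have : (1 - η) ^ 2 ≤ 1 := by nlinarith
    nlinarith
  · refine norm_add_le_of_le (hcut y).2.1 ?_
    rw [norm_smul, Real.norm_of_nonneg (by positivity)]
    have := (hB ((1 - η)⁻¹ • y)).2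
    have h3 := norm_nonneg (Dφ ((1 - η)⁻¹ • y))
    nlinarith
  · rw [(cutoff_eq_of_eq_one hV hχ1 g (classicalGrad g) (classicalHess g)
      (hKV (square_subset_closedSquare _ _ hy))).2.2]
  · have : (1 - η)⁻¹ • y ∉ unitSquare := fun h => hy ((mem_square_iff hη).mpr (by simpa using h))
    rw [(hφ.eq_zero _ this).2.2, add_zero]
    exact (hcut y).2.2

/-! ### Growth integrands and their quasiconvexification. -/

theorem add_rpow_le_two_rpow_mul {p a b : ℝ} (hp : 0 ≤ p) (ha : 0 ≤ a) (hb : 0 ≤ b) :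
    (a + b) ^ p ≤ 2 ^ p * (a ^ p + b ^ p) := by
  have h1 : a + b ≤ 2 * max a b := by linarith [le_max_left a b, le_max_right a b]
  have hm : 0 ≤ max a b := ha.trans (le_max_left a b)
  refine (Real.rpow_le_rpow (by positivity) h1 hp).trans ?_
  rw [Real.mul_rpow (by norm_num) hm]
  refine mul_le_mul_of_nonneg_left ?_ (by positivity)
  have ha' := Real.rpow_nonneg ha p
  have hb' := Real.rpow_nonneg hb p
  rcases max_choice a b with h | h <;> rw [h] <;> linarith

/-- A measurable nonnegative integrand of growth `p` in the Hessian, which depends on the gradient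
in a relatively Lipschitz way. -/
structure IsGrowthIntegrand {m : ℕ} (p C : ℝ) (f : GradSpace m → HessSpace m → ℝ) : Prop where
  one_le : 1 ≤ p
  measurable : Measurable (Function.uncurry f)
  nonneg : ∀ v ξ, 0 ≤ f v ξ
  le : ∀ v ξ, f v ξ ≤ C * (1 + ‖ξ‖ ^ p)
  lip : ∀ v v' ξ, |f v ξ - f v' ξ| ≤ C * ‖v - v'‖ * max (f v ξ) (f v' ξ)
  lip_quasiconvexification2 : ∀ v v' ξ,
    |quasiconvexification2 (f v) ξ - quasiconvexification2 (f v') ξ| ≤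
      C * ‖v - v'‖ * max (quasiconvexification2 (f v) ξ) (quasiconvexification2 (f v') ξ)

/-- Splitting of the unit square into a concentric square of side `1 - η` and a thin layer. -/
theorem setIntegral_unitSquare_le {G h : Plane → ℝ} {η κ M : ℝ} (hη0 : 0 < η) (hη1 : η < 1)
    (hκ : 0 ≤ κ) (hM : 0 ≤ M) (hG : IntegrableOn G unitSquare volume)
    (hh : IntegrableOn h unitSquare volume) (hh0 : ∀ y, 0 ≤ h y)
    (hcore : ∀ y ∈ square 0 (1 - η), G y ≤ κ * h ((1 - η)⁻¹ • y))
    (hlayer : ∀ y ∈ unitSquare, y ∉ square 0 (1 - η) → G y ≤ M) :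
    ∫ y in unitSquare, G y ≤ κ * (∫ y in unitSquare, h y) + 2 * η * M := by
  have hη : 0 < 1 - η := by linarith
  set S := square 0 (1 - η) with hS
  have hSm : MeasurableSet S := (isOpen_square _ _).measurableSet
  have hsub : S ⊆ unitSquare := fun y hy => square_zero_one ▸
    closedSquare_subset_square 0 (by linarith : 1 - η < 1) (square_subset_closedSquare _ _ hy)
  have h1 : ∫ y in S, G y ≤ κ * ∫ y in unitSquare, h y := by
    have e := setIntegral_square_rescale h 0 hη
    have i := integrableOn_square_rescale hh 0 hη
    simp only [sub_zero] at e i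
    calc ∫ y in S, G y ≤ ∫ y in S, κ * h ((1 - η)⁻¹ • y) :=
          setIntegral_mono_on (hG.mono_set hsub) (i.const_mul κ) hSm hcore
      _ = κ * ((1 - η) ^ 2 * ∫ y in unitSquare, h y) := by rw [integral_const_mul, e]
      _ ≤ κ * ∫ y in unitSquare, h y := by
          refine mul_le_mul_of_nonneg_left ?_ hκ
          have : 0 ≤ ∫ y in unitSquare, h y := integral_nonneg hh0
          have : (1 - η) ^ 2 ≤ 1 := by nlinarith
          nlinarith
  have hv : volume.real (unitSquare \ S) = 1 - (1 - η) ^ 2 := by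
    have hSr : volume.real S = (1 - η) ^ 2 := by
      rw [measureReal_def, volume_square 0 hη.le, ENNReal.toReal_ofReal (sq_nonneg _)]
    rw [measureReal_sdiff hsub hSm (by simp [volume_unitSquare]), hSr, measureReal_def,
      volume_unitSquare, ENNReal.toReal_one]
  have hDm : MeasurableSet (unitSquare \ S) := isOpen_unitSquare.measurableSet.diff hSm
  have hDf : volume (unitSquare \ S) ≠ ⊤ :=
    ((measure_mono sdiff_subset).trans_lt (by simp [volume_unitSquare])).ne
  have h2 : ∫ y in unitSquare \ S, G y ≤ 2 * η * M := by
    calc ∫ y in unitSquare \ S, G y ≤ ∫ _y in unitSquare \ S, M :=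
          setIntegral_mono_on (hG.mono_set sdiff_subset) (integrableOn_const hDf) hDm
            fun y hy => hlayer y hy.1 hy.2
      _ = (1 - (1 - η) ^ 2) * M := by rw [setIntegral_const, hv, smul_eq_mul]
      -- The layer has area `2 * η - η ^ 2`.
      _ ≤ _ := by nlinarith [mul_nonneg (sq_nonneg η) hM]
  have h3 : (∫ y in S, G y) + ∫ y in unitSquare \ S, G y = ∫ y in unitSquare, G y := by
    rw [← setIntegral_union disjoint_sdiff_right hDm (hG.mono_set hsub)
      (hG.mono_set sdiff_subset), union_sdiff_cancel hsub]
  linarith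

namespace IsGrowthIntegrand

variable {m : ℕ} {p C : ℝ} {f : GradSpace m → HessSpace m → ℝ}

theorem const_nonneg (H : IsGrowthIntegrand p C f) : 0 ≤ C := by
  have h1 := (H.nonneg 0 0).trans (H.le 0 0)
  rw [norm_zero, Real.zero_rpow (by linarith [H.one_le])] at h1
  linarith

theorem integrable (H : IsGrowthIntegrand p C f) {μ : Measure Plane} [IsFiniteMeasure μ]
    {V : Plane → GradSpace m} {F : Plane → HessSpace m} (hV : AEStronglyMeasurable V μ)
    (hF : MemLp F (ENNReal.ofReal p) μ) : Integrable (fun x => f (V x) (F x)) μ := by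
  have hp := H.one_le
  have h1 : Integrable (fun x => ‖F x‖ ^ p) μ := by
    have := hF.integrable_norm_rpow (by simp; linarith) ENNReal.ofReal_ne_top
    rwa [ENNReal.toReal_ofReal (by linarith)] at this
  refine Integrable.mono' (((integrable_const 1).add h1).const_mul C) ?_
    (ae_of_all _ fun x => ?_)
  · exact (H.measurable.comp_aemeasurable
      (hV.aemeasurable.prodMk hF.1.aemeasurable)).aestronglyMeasurable
  · rw [Real.norm_of_nonneg (H.nonneg _ _)]
    exact H.le _ _

theorem integrableOn_unitSquare (H : IsGrowthIntegrand p C f) {V : Plane → GradSpace m}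
    {F : Plane → HessSpace m} (hV : Measurable V) (hF : Measurable F) {B : ℝ}
    (hB : ∀ y ∈ unitSquare, ‖F y‖ ≤ B) :
    IntegrableOn (fun y => f (V y) (F y)) unitSquare volume := by
  have : IsFiniteMeasure (volume.restrict unitSquare) := ⟨by simp [volume_unitSquare]⟩
  refine H.integrable hV.aestronglyMeasurable (MemLp.of_bound hF.aestronglyMeasurable B ?_)
  filter_upwards [ae_restrict_mem isOpen_unitSquare.measurableSet] with y hy using hB y hy

theorem integrableOn_unitSquare_of_bdd (H : IsGrowthIntegrand p C f) (v : GradSpace m)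
    (ξ : HessSpace m) {S : Set Plane} {θ : Plane → Vec m} {Dθ : Plane → GradSpace m}
    {D2θ : Plane → HessSpace m} (hθ : IsBddSobolev2 S θ Dθ D2θ) :
    IntegrableOn (fun y => f v (ξ + D2θ y)) unitSquare volume := by
  obtain ⟨B, hB⟩ := hθ.bdd
  exact H.integrableOn_unitSquare measurable_const (measurable_const.add hθ.meas_hess)
    (B := ‖ξ‖ + B) fun y _ => norm_add_le_of_le le_rfl (hB y).2.2

theorem quasiconvexification2_nonneg (H : IsGrowthIntegrand p C f) (v : GradSpace m)
    (ξ : HessSpace m) : 0 ≤ quasiconvexification2 (f v) ξ := by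
  refine Real.sInf_nonneg ?_
  rintro I ⟨φ, Dφ, D2φ, -, rfl⟩
  exact integral_nonneg fun x => H.nonneg _ _

theorem quasiconvexification2_le_integral (H : IsGrowthIntegrand p C f) (v : GradSpace m)
    (ξ : HessSpace m) {K : Set Plane} (hK : IsCompact K) (hKQ : K ⊆ unitSquare)
    {θ : Plane → Vec m} {Dθ : Plane → GradSpace m} {D2θ : Plane → HessSpace m}
    (hθ : IsBddSobolev2 K θ Dθ D2θ) :
    quasiconvexification2 (f v) ξ ≤ ∫ y in unitSquare, f v (ξ + D2θ y) := by
  refine csInf_le ⟨0, ?_⟩ ⟨θ, Dθ, D2θ, hθ.isSobolev2InfZero isOpen_unitSquare hK hKQ, rfl⟩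
  rintro I ⟨φ, Dφ, D2φ, -, rfl⟩
  exact integral_nonneg fun x => H.nonneg _ _

theorem quasiconvexification2_le (H : IsGrowthIntegrand p C f) (v : GradSpace m)
    (ξ : HessSpace m) : quasiconvexification2 (f v) ξ ≤ C * (1 + ‖ξ‖ ^ p) := by
  refine (H.quasiconvexification2_le_integral v ξ isCompact_empty (empty_subset _)
    (IsBddSobolev2.zero ∅)).trans ?_
  simp only [add_zero, setIntegral_const, measureReal_def, volume_unitSquare, ENNReal.toReal_one,
    one_smul]
  exact H.le v ξ

/-- A nearly optimal competitor, replaced by its bounded zero extension, which is the form that can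
be rescaled and summed. -/
theorem exists_lt_quasiconvexification2_add (v : GradSpace m)
    (ξ : HessSpace m) {ε : ℝ} (hε : 0 < ε) :
    ∃ (θ : Plane → Vec m) (Dθ : Plane → GradSpace m) (D2θ : Plane → HessSpace m),
      IsBddSobolev2 unitSquare θ Dθ D2θ ∧
      ∫ y in unitSquare, f v (ξ + D2θ y) < quasiconvexification2 (f v) ξ + ε := by
  have hne : {I : ℝ | ∃ (φ : Plane → Vec m) (Dφ : Plane → GradSpace m) (D2φ : Plane → HessSpace m),
      IsSobolev2InfZero unitSquare φ Dφ D2φ ∧ I = ∫ x in unitSquare, f v (ξ + D2φ x)}.Nonempty :=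
    ⟨_, fun _ => (0 : Vec m), fun _ => 0, fun _ => 0, (IsBddSobolev2.zero ∅).isSobolev2InfZero
      isOpen_unitSquare isCompact_empty (empty_subset _), rfl⟩
  obtain ⟨I, ⟨φ, Dφ, D2φ, hφ, rfl⟩, hI⟩ := exists_lt_of_csInf_lt hne
    (lt_add_of_pos_right (quasiconvexification2 (f v) ξ) hε)
  obtain ⟨θ, Dθ, D2θ, hθ, hae⟩ := hφ.exists_isBddSobolev2 isOpen_unitSquare.measurableSet
    (by simp [volume_unitSquare])
  refine ⟨θ, Dθ, D2θ, hθ, lt_of_eq_of_lt (integral_congr_ae ?_) hI⟩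
  filter_upwards [hae] with y hy
  rw [hy]

/-- Quantitative continuity of the quasiconvexification along symmetric directions. -/
theorem exists_quasiconvexification2_le_add (H : IsGrowthIntegrand p C f) {η : ℝ} (hη0 : 0 < η)
    (hη1 : η < 1) : ∃ A : ℝ, 0 ≤ A ∧ ∀ v ξ ξ', IsSymmHess (ξ - ξ') →
      quasiconvexification2 (f v) ξ' ≤ quasiconvexification2 (f v) ξ
        + 2 * η * (C * (1 + 2 ^ p * ‖ξ'‖ ^ p)) + A * ‖ξ - ξ'‖ ^ p := by
  have hp := H.one_le
  have hC := H.const_nonneg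
  obtain ⟨A, hA, K, hK, hKQ, hins⟩ := exists_insertion m hη0 hη1
  -- Layer area times the share of the growth bound due to the added Hessian, of size at most `A *
  -- t`.
  refine ⟨2 * η * (C * (2 ^ p * A ^ p)), by positivity, fun v ξ ξ' hsymm => ?_⟩
  set t := ‖ξ - ξ'‖ with ht
  have ht0 : 0 ≤ t := norm_nonneg _
  refine le_of_forall_pos_le_add fun ε hε => ?_
  obtain ⟨θ, Dθ, D2θ, hθ, hlt⟩ := exists_lt_quasiconvexification2_add (f := f) v ξ hε
  obtain ⟨B, hB⟩ := hθ.bdd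
  have hψ : ContDiff ℝ ∞ fun _ : Plane => (0 : Vec m) := contDiff_const
  have hz : ∀ x, classicalHess (fun _ : Plane => (0 : Vec m)) x = 0 := fun x => by
    ext a; simp [classicalHess, classicalGrad]
  -- With `ψ = 0` and `r = 1` the gap is the quadratic map with Hessian `ξ - ξ'`; on the core it
  -- turns `ξ'` into `ξ`, so the test map for `ξ` can be used at `ξ'`.
  have hess : ∀ y, classicalHess (taylorGap (ξ - ξ') (fun _ => 0) 0 1) y = ξ - ξ' := fun y => by
    rw [classicalHess_taylorGap hψ hsymm one_ne_zero, hz, sub_zero]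
  obtain ⟨Θ, DΘ, D2Θ, hΘ, -, hcore, hlayer⟩ := hins (taylorGap (ξ - ξ') (fun _ => 0) 0 1) t
    (contDiff_taylorGap hψ) taylorGap_zero (classicalGrad_taylorGap_zero hψ hsymm one_ne_zero)
    (fun y _ => by rw [hess]) θ Dθ D2θ B hθ (fun x => ⟨(hB x).1, (hB x).2.1⟩)
  have h1 := H.quasiconvexification2_le_integral v ξ' hK hKQ hΘ
  have h2 := setIntegral_unitSquare_le (κ := 1) (M := C * (1 + 2 ^ p * (‖ξ'‖ ^ p + (A * t) ^ p)))
    hη0 hη1 zero_le_one (by positivity)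
    (H.integrableOn_unitSquare_of_bdd v ξ' hΘ) (H.integrableOn_unitSquare_of_bdd v ξ hθ)
    (fun y => H.nonneg _ _) (fun y hy => by
      rw [hcore y hy, hess, one_mul]
      exact le_of_eq (by congr 1; abel)) (fun y _ hy => by
      refine (H.le _ _).trans (mul_le_mul_of_nonneg_left ?_ hC)
      have h3 : ‖ξ' + D2Θ y‖ ≤ ‖ξ'‖ + A * t := norm_add_le_of_le le_rfl (hlayer y hy)
      have h4 := Real.rpow_le_rpow (norm_nonneg _) h3 (by linarith : 0 ≤ p)
      have h5 := add_rpow_le_two_rpow_mul (by linarith : 0 ≤ p) (norm_nonneg ξ')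
        (mul_nonneg hA ht0)
      linarith)
  rw [Real.mul_rpow hA ht0] at h2
  linarith

theorem abs_quasiconvexification2_sub_le (H : IsGrowthIntegrand p C f) (v v' : GradSpace m)
    (ξ : HessSpace m) : |quasiconvexification2 (f v) ξ - quasiconvexification2 (f v') ξ| ≤
      C * ‖v - v'‖ * (C * (1 + ‖ξ‖ ^ p)) := by
  refine (H.lip_quasiconvexification2 v v' ξ).trans ?_
  have := H.const_nonneg
  refine mul_le_mul_of_nonneg_left ?_ (by positivity)
  exact max_le (H.quasiconvexification2_le v ξ) (H.quasiconvexification2_le v' ξ)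

/-- Continuity in the Hessian comes from the freedom in the test map, not from `f`. The layer width
`η` is fixed first, and the increment is then made small relative to the resulting `A`. Only
symmetric increments are reached, since only these are Hessians. -/
theorem continuous_quasiconvexification2 (H : IsGrowthIntegrand p C f) {T : Type*}
    [TopologicalSpace T] {V : T → GradSpace m} {X : T → HessSpace m} (hV : Continuous V)
    (hX : Continuous X) (hs : ∀ x, IsSymmHess (X x)) :
    Continuous fun x => quasiconvexification2 (f (V x)) (X x) := by
  have hp := H.one_le
  have hC := H.const_nonneg
  refine continuous_iff_continuousAt.mpr fun x₀ => Metric.continuousAt_iff'.mpr fun ε hε => ?_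
  set R := ‖X x₀‖ + 1 with hR
  have hR0 : 0 ≤ R := by positivity
  set M := C * (1 + 2 ^ p * R ^ p) with hM
  have hM0 : 0 ≤ M := by positivity
  set η := min (1 / 2) (ε / (8 * (M + 1))) with hη
  have hη0 : 0 < η := by positivity
  have hη1 : η < 1 := (min_le_left _ _).trans_lt (by norm_num)
  have hηM : 2 * η * M ≤ ε / 4 := by
    have h1 : η ≤ ε / (8 * (M + 1)) := min_le_right _ _
    have h2 : η * (8 * (M + 1)) ≤ ε := (le_div_iff₀ (by positivity)).mp h1
    nlinarith
  obtain ⟨A, hA, hQ⟩ := H.exists_quasiconvexification2_le_add hη0 hη1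
  have hd : ∀ a b, IsSymmHess (X a - X b) := fun a b i j k => by
    simp only [PiLp.sub_apply, hs a i j k, hs b i j k]
  have e1 : ∀ᶠ x in nhds x₀, A * ‖X x - X x₀‖ ^ p < ε / 4 := by
    have hc : Continuous fun x => A * ‖X x - X x₀‖ ^ p :=
      continuous_const.mul ((hX.sub continuous_const).norm.rpow_const
        fun _ => Or.inr (by linarith))
    refine hc.continuousAt.eventually_lt_const ?_
    simp only [sub_self, norm_zero]
    rw [Real.zero_rpow (by linarith), mul_zero]; positivity
  have e2 : ∀ᶠ x in nhds x₀, C * ‖V x - V x₀‖ * (C * (1 + ‖X x₀‖ ^ p)) < ε / 4 := by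
    have hc : Continuous fun x => C * ‖V x - V x₀‖ * (C * (1 + ‖X x₀‖ ^ p)) := by fun_prop
    refine hc.continuousAt.eventually_lt_const ?_
    simp only [sub_self, norm_zero, mul_zero, zero_mul]; positivity
  have e3 : ∀ᶠ x in nhds x₀, ‖X x‖ < R :=
    hX.norm.continuousAt.eventually_lt_const (by simp [hR])
  filter_upwards [e1, e2, e3] with x h1 h2 h3
  have h4 := H.abs_quasiconvexification2_sub_le (V x) (V x₀) (X x₀)
  -- The Hessian changes in both directions at the fixed gradient `V x`; the change of gradient is
  -- left to `h4`.
  have h5 := hQ (V x) (X x) (X x₀) (hd _ _)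
  have h6 := hQ (V x) (X x₀) (X x) (hd _ _)
  have hmono : ∀ z : HessSpace m, ‖z‖ ≤ R → 2 * η * (C * (1 + 2 ^ p * ‖z‖ ^ p)) ≤ ε / 4 := by
    intro z hz
    refine le_trans ?_ hηM
    rw [hM]
    have := Real.rpow_le_rpow (norm_nonneg z) hz (by linarith : 0 ≤ p)
    gcongr
  have h7 := hmono (X x₀) (by simp [hR])
  have h8 := hmono (X x) h3.le
  rw [norm_sub_rev] at h6
  rw [Real.dist_eq, abs_lt]
  rw [abs_le] at h4
  constructor <;> linarith

/-- If `f v' ξ` is the larger value, the maximum is absorbed on the left, and `1 / (1 - a) ≤ 1 + 2 *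
a` for `0 ≤ a ≤ 1 / 2`. -/
theorem le_of_norm_sub_le (H : IsGrowthIntegrand p C f) {v v' : GradSpace m} (ξ : HessSpace m)
    {s : ℝ} (hs : ‖v' - v‖ ≤ s) (hCs : C * s ≤ 1 / 2) : f v' ξ ≤ (1 + 2 * (C * s)) * f v ξ := by
  have hC := H.const_nonneg
  have hs0 : 0 ≤ C * s := mul_nonneg hC ((norm_nonneg _).trans hs)
  have h0 := H.nonneg v ξ
  have h0' := H.nonneg v' ξ
  rcases le_total (f v' ξ) (f v ξ) with h | h
  · nlinarith
  · have h1 := H.lip v' v ξ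
    rw [max_eq_left h, abs_of_nonneg (by linarith)] at h1
    have h2 : C * ‖v' - v‖ * f v' ξ ≤ C * s * f v' ξ := by gcongr
    have h3 : f v' ξ * (1 - C * s) ≤ f v ξ := by linarith
    have h4 : 1 ≤ (1 - C * s) * (1 + 2 * (C * s)) := by nlinarith
    calc f v' ξ ≤ f v' ξ * ((1 - C * s) * (1 + 2 * (C * s))) := le_mul_of_one_le_right h0' h4
      _ = (1 + 2 * (C * s)) * (f v' ξ * (1 - C * s)) := by ring
      _ ≤ _ := by gcongr

/-- On a small square a smooth map can be perturbed so that its energy is almost the relaxed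
one. -/
theorem exists_local_perturbation (H : IsGrowthIntegrand p C f) {ψ : Plane → Vec m}
    (hψ : ContDiff ℝ ∞ ψ) (x₀ : Plane) {ε : ℝ} (hε : 0 < ε) :
    ∃ r₀ > 0, ∀ r : ℝ, 0 < r → r < r₀ →
      ∃ (θ : Plane → Vec m) (Dθ : Plane → GradSpace m) (D2θ : Plane → HessSpace m),
        IsBddSobolev2 (square x₀ r) θ Dθ D2θ ∧ (∀ x, ‖θ x‖ ≤ ε ∧ ‖Dθ x‖ ≤ ε) ∧
        ∫ x in square x₀ r, f (classicalGrad ψ x + Dθ x) (classicalHess ψ x + D2θ x) ≤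
          (∫ x in square x₀ r, quasiconvexification2 (f (classicalGrad ψ x)) (classicalHess ψ x))
            + ε * r ^ 2 := by
  have hp := H.one_le
  have hC := H.const_nonneg
  set v₀ := classicalGrad ψ x₀ with hv₀
  set ξ₀ := classicalHess ψ x₀ with hξ₀
  set q := quasiconvexification2 (f v₀) ξ₀ with hq
  have hq0 : 0 ≤ q := H.quasiconvexification2_nonneg _ _
  set M := C * (1 + (‖ξ₀‖ + 1) ^ p) with hM
  have hM0 : 0 ≤ M := by positivity
  set η := min (1 / 2) (ε / (8 * (M + 1))) with hη
  have hη0 : 0 < η := by positivity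
  have hη1 : η < 1 := (min_le_left _ _).trans_lt (by norm_num)
  have hηM : 2 * η * M ≤ ε / 4 := by
    have h1 : η ≤ ε / (8 * (M + 1)) := min_le_right _ _
    have h2 : η * (8 * (M + 1)) ≤ ε := (le_div_iff₀ (by positivity)).mp h1
    nlinarith
  obtain ⟨φ, Dφ, D2φ, hφ, hφlt⟩ := exists_lt_quasiconvexification2_add (f := f) v₀ ξ₀
    (by positivity : 0 < ε / 4)
  obtain ⟨B, hB⟩ := hφ.bdd
  have hB0 : 0 ≤ B := (norm_nonneg _).trans (hB 0).1
  obtain ⟨A, hA, K, hK, hKQ, hins⟩ := exists_insertion m hη0 hη1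
  -- Tolerance for the gradient: the first entry gives `C * s ≤ 1 / 2`, the second makes the factor
  -- `1 + 2 * (C * s)` cost at most `ε / 4` on an energy below `q + ε / 4`.
  set s := min (1 / (2 * (C + 1))) (ε / (8 * (C + 1) * (q + ε))) with hs
  have hs0 : 0 < s := by positivity
  have hCs : C * s ≤ 1 / 2 := by
    have h1 : s ≤ 1 / (2 * (C + 1)) := min_le_left _ _
    have h2 : s * (2 * (C + 1)) ≤ 1 := (le_div_iff₀ (by positivity)).mp h1
    nlinarith
  have hCs' : 2 * (C * s) * (q + ε / 4) ≤ ε / 4 := by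
    have h1 : s ≤ ε / (8 * (C + 1) * (q + ε)) := min_le_right _ _
    have h2 : s * (8 * (C + 1) * (q + ε)) ≤ ε := (le_div_iff₀ (by positivity)).mp h1
    have h3 : C * s * (q + ε / 4) ≤ (C + 1) * s * (q + ε) := by
      gcongr <;> linarith
    nlinarith
  -- Tolerance for the Hessian: in the layer the total Hessian stays within `A * t + t ≤ 1` of `ξ₀`,
  -- whatever `φ` is.
  set t := 1 / (2 * (A + 1)) with ht
  have ht0 : 0 < t := by positivity
  have hAt : A * t + t = 1 / 2 := by rw [ht]; field_simp
  have hAt0 : 0 ≤ A * t := by positivity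
  have c1 := (contDiff_classicalGrad hψ).continuous
  have c2 := (contDiff_classicalHess hψ).continuous
  have c3 := H.continuous_quasiconvexification2 c1 c2 (isSymmHess_classicalHess hψ)
  obtain ⟨ρ1, hρ1, h1⟩ := Metric.continuous_iff.mp c1 x₀ (s / 2) (by positivity)
  obtain ⟨ρ2, hρ2, h2⟩ := Metric.continuous_iff.mp c2 x₀ t ht0
  obtain ⟨ρ3, hρ3, h3⟩ := Metric.continuous_iff.mp c3 x₀ (ε / 4) (by positivity)
  -- The `ρ`'s control gradient, Hessian and relaxed density on the square, `r < 1` gives `r ^ 2 ≤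
  -- r`, and the last entry bounds the size `r * (1 + B)` of the perturbation and its gradient.
  refine ⟨min (min ρ1 ρ2) (min ρ3 (min 1 (min (s / 2) ε / (1 + B)))), by positivity,
    fun r hr hrlt => ?_⟩
  simp only [lt_min_iff] at hrlt
  obtain ⟨⟨hr1, hr2⟩, hr3, hr4, hr5⟩ := hrlt
  have hr5' : r * (1 + B) ≤ min (s / 2) ε := ((lt_div_iff₀ (by positivity)).mp hr5).le
  have hrs : r * (1 + B) ≤ s / 2 := hr5'.trans (min_le_left _ _)
  have hrε : r * (1 + B) ≤ ε := hr5'.trans (min_le_right _ _)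
  have hdist : ∀ y ∈ unitSquare, dist (x₀ + r • y) x₀ ≤ r := fun y hy => by
    rw [dist_eq_norm, add_sub_cancel_left, norm_smul, Real.norm_of_nonneg hr.le]
    have := norm_le_one_of_mem_unitSquare hy
    nlinarith
  have hsymm := isSymmHess_classicalHess hψ x₀
  have hgap : ∀ y, classicalHess (taylorGap ξ₀ ψ x₀ r) y = ξ₀ - classicalHess ψ (x₀ + r • y) :=
    fun y => classicalHess_taylorGap hψ hsymm hr.ne' y
  have hh2 : ∀ y ∈ unitSquare, ‖classicalHess ψ (x₀ + r • y) - ξ₀‖ ≤ t := fun y hy => by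
    rw [← dist_eq_norm]; exact (h2 _ ((hdist y hy).trans_lt hr2)).le
  obtain ⟨Θ, DΘ, D2Θ, hΘ, hΘb, hcore, hlayer⟩ := hins (taylorGap ξ₀ ψ x₀ r) t
    (contDiff_taylorGap hψ) taylorGap_zero (classicalGrad_taylorGap_zero hψ hsymm hr.ne')
    (fun y hy => by rw [hgap, norm_sub_rev]; exact hh2 y hy) φ Dφ D2φ B hφ
    (fun x => ⟨(hB x).1, (hB x).2.1⟩)
  have hΘ1 : ∀ y, ‖Θ y‖ ≤ 1 + B ∧ ‖DΘ y‖ ≤ 1 + B := fun y =>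
    ⟨(hΘb y).1.trans (by linarith), (hΘb y).2.trans (by linarith)⟩
  refine ⟨fun x => r ^ 2 • Θ (r⁻¹ • (x - x₀)), fun x => r • DΘ (r⁻¹ • (x - x₀)),
    fun x => D2Θ (r⁻¹ • (x - x₀)), ?_, fun x => ⟨?_, ?_⟩, ?_⟩
  · exact (hΘ.mono hKQ).rescale (by simp [volume_unitSquare]) x₀ hr
      fun x hx => (mem_square_iff hr).mpr hx
  · rw [norm_smul, Real.norm_of_nonneg (by positivity)]
    have := (hΘ1 (r⁻¹ • (x - x₀))).1
    have h5 : r ^ 2 ≤ r := by nlinarith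
    have := mul_le_mul h5 this (norm_nonneg _) hr.le
    linarith
  · rw [norm_smul, Real.norm_of_nonneg hr.le]
    have := mul_le_mul_of_nonneg_left (hΘ1 (r⁻¹ • (x - x₀))).2 hr.le
    linarith
  · set G : Plane → ℝ := fun y => f (classicalGrad ψ (x₀ + r • y) + r • DΘ y)
      (classicalHess ψ (x₀ + r • y) + D2Θ y) with hG
    have eG : ∀ x, f (classicalGrad ψ x + r • DΘ (r⁻¹ • (x - x₀)))
        (classicalHess ψ x + D2Θ (r⁻¹ • (x - x₀))) = G (r⁻¹ • (x - x₀)) := fun x => by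
      simp [hG, smul_smul, hr.ne']
    simp only [eG]
    rw [setIntegral_square_rescale G x₀ hr]
    obtain ⟨B', hB'⟩ := hΘ.bdd
    have hm : Measurable fun y : Plane => x₀ + r • y := by fun_prop
    have iG : IntegrableOn G unitSquare volume :=
      H.integrableOn_unitSquare ((c1.measurable.comp hm).add (hΘ.meas_grad.const_smul r))
        ((c2.measurable.comp hm).add hΘ.meas_hess) (B := (‖ξ₀‖ + t) + B') fun y hy => by
          refine norm_add_le_of_le ?_ (hB' y).2.2
          have := norm_add_le_of_le (le_refl ‖ξ₀‖) (hh2 y hy)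
          simpa using this
    have key := setIntegral_unitSquare_le (G := G) (h := fun y => f v₀ (ξ₀ + D2φ y))
      (κ := 1 + 2 * (C * s)) (M := M) hη0 hη1 (by positivity) hM0 iG
      (H.integrableOn_unitSquare_of_bdd v₀ ξ₀ hφ) (fun y => H.nonneg _ _)
      (fun y hy => by
        have hyQ : y ∈ unitSquare := square_zero_one ▸ closedSquare_subset_square 0
          (by linarith : 1 - η < 1) (square_subset_closedSquare _ _ hy)
        -- The Hessian of `ψ` cancels exactly, so only the gradient argument of `f` has to be
        -- compared with `v₀`.
        have e : classicalHess ψ (x₀ + r • y) + D2Θ y = ξ₀ + D2φ ((1 - η)⁻¹ • y) := by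
          rw [hcore y hy, hgap]; abel
        simp only [hG, e]
        refine H.le_of_norm_sub_le _ ?_ hCs
        have a1 : ‖classicalGrad ψ (x₀ + r • y) - v₀‖ ≤ s / 2 := by
          rw [← dist_eq_norm]; exact (h1 _ ((hdist y hyQ).trans_lt hr1)).le
        have a2 : ‖r • DΘ y‖ ≤ s / 2 := by
          rw [norm_smul, Real.norm_of_nonneg hr.le]
          exact (mul_le_mul_of_nonneg_left (hΘ1 y).2 hr.le).trans hrs
        have := norm_add_le_of_le a1 a2
        rw [show classicalGrad ψ (x₀ + r • y) + r • DΘ y - v₀ =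
          classicalGrad ψ (x₀ + r • y) - v₀ + r • DΘ y by abel]
        linarith)
      (fun y hyQ hy => by
        refine (H.le _ _).trans ?_
        have : ‖classicalHess ψ (x₀ + r • y) + D2Θ y‖ ≤ ‖ξ₀‖ + 1 := by
          have a1 := norm_add_le_of_le (norm_add_le_of_le (le_refl ‖ξ₀‖) (hh2 y hyQ)) (hlayer y hy)
          rw [add_sub_cancel] at a1
          linarith
        have := Real.rpow_le_rpow (norm_nonneg _) this (by linarith : 0 ≤ p)
        rw [hM]
        gcongr)
    have hQ : q * r ^ 2 ≤ (∫ x in square x₀ r, quasiconvexification2 (f (classicalGrad ψ x))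
        (classicalHess ψ x)) + ε / 4 * r ^ 2 := by
      have hvol : volume.real (square x₀ r) = r ^ 2 := by
        rw [measureReal_def, volume_square x₀ hr.le, ENNReal.toReal_ofReal (sq_nonneg _)]
      have hfin : volume (square x₀ r) ≠ ⊤ := by
        rw [volume_square x₀ hr.le]; exact ENNReal.ofReal_ne_top
      have a1 : ∫ _x in square x₀ r, (q - ε / 4) ≤ ∫ x in square x₀ r,
          quasiconvexification2 (f (classicalGrad ψ x)) (classicalHess ψ x) := by
        refine setIntegral_mono_on (integrableOn_const hfin) ?_
          (isOpen_square _ _).measurableSet fun x hx => ?_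
        · exact (c3.continuousOn.integrableOn_compact (isCompact_closedSquare x₀ r)).mono_set
            (square_subset_closedSquare _ _)
        · have hx' : dist x x₀ ≤ r :=
            closedSquare_subset_closedBall x₀ r (square_subset_closedSquare _ _ hx)
          have := h3 x (hx'.trans_lt hr3)
          rw [Real.dist_eq, abs_lt] at this
          linarith [this.1]
      rw [setIntegral_const, hvol, smul_eq_mul] at a1
      linarith
    have hr2 : 0 < r ^ 2 := by positivity
    have f1 : (1 + 2 * (C * s)) * (∫ y in unitSquare, f v₀ (ξ₀ + D2φ y)) ≤ q + ε / 2 := by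
      have : (1 + 2 * (C * s)) * (∫ y in unitSquare, f v₀ (ξ₀ + D2φ y)) ≤
          (1 + 2 * (C * s)) * (q + ε / 4) := by
        refine mul_le_mul_of_nonneg_left hφlt.le (by positivity)
      linarith
    -- The quarters of `ε` pay for near optimality, the gradient factor, the layer and, through
    -- `hQ`, the replacement of `q` by an average.
    have f2 : ∫ y in unitSquare, G y ≤ q + 3 / 4 * ε := by linarith
    have f3 := mul_le_mul_of_nonneg_left f2 hr2.le
    linarith

end IsGrowthIntegrand

/-! ### Covering by squares. -/

/-- Vitali's covering theorem for squares. -/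
theorem exists_finset_disjoint_squares {U : Set Plane} (hU : IsOpen U) (hUf : volume U ≠ ⊤)
    {r₀ : Plane → ℝ} (hr₀ : ∀ x, 0 < r₀ x) {ν : ℝ≥0∞} (hν : 0 < ν) :
    ∃ s : Finset (Plane × ℝ), (∀ a ∈ s, 0 < a.2 ∧ a.2 < r₀ a.1 ∧ square a.1 a.2 ⊆ U) ∧
      (s : Set (Plane × ℝ)).PairwiseDisjoint (fun a => square a.1 a.2) ∧
      volume (U \ ⋃ a ∈ s, square a.1 a.2) < ν := by
  classical
  set t : Set (Plane × ℝ) := {a | 0 < a.2 ∧ a.2 < r₀ a.1 ∧ closedSquare a.1 a.2 ⊆ U} with ht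
  -- The constant `36`: the ball of radius `3 * r` lies in the concentric square of side `6 * r`.
  obtain ⟨u, hut, huc, hud, hu0⟩ := Vitali.exists_disjoint_covering_ae volume U t 36
    (fun a => a.2) (fun a => a.1) (fun a => closedSquare a.1 a.2)
    (fun a _ => closedSquare_subset_closedBall _ _)
    (fun a ha => by
      refine (measure_mono (closedBall_subset_closedSquare _ _)).trans ?_
      rw [volume_closedSquare _ (by linarith [ha.1]), volume_closedSquare _ ha.1.le]
      rw [show ((36 : NNReal) : ℝ≥0∞) = ENNReal.ofReal 36 by simp,
        ← ENNReal.ofReal_mul (by norm_num)]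
      exact ENNReal.ofReal_le_ofReal (by ring_nf; rfl))
    (fun a ha => ⟨a.1, interior_maximal (square_subset_closedSquare a.1 a.2)
      (isOpen_square _ _) fun i => by simpa using ha.1⟩)
    (fun a _ => isClosed_closedSquare _ _)
    (fun x hx ε hε => by
      obtain ⟨ρ, hρ, hρU⟩ := Metric.isOpen_iff.mp hU x hx
      have h1 := hr₀ x
      refine ⟨(x, min (min ε (ρ / 2)) (r₀ x / 2)), ⟨by positivity, ?_, ?_⟩, ?_, rfl⟩
      · exact (min_le_right _ _).trans_lt (by simpa using h1)
      · refine (closedSquare_subset_closedBall _ _).trans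
          ((Metric.closedBall_subset_ball ?_).trans hρU)
        exact ((min_le_left _ _).trans (min_le_right _ _)).trans_lt (by linarith)
      · exact (min_le_left _ _).trans (min_le_left _ _))
  have : Countable u := huc
  have hsum : ∑' a : u, volume (closedSquare a.1.1 a.1.2) ≠ ⊤ := by
    rw [← measure_biUnion (f := fun a : Plane × ℝ => closedSquare a.1 a.2) huc hud
      fun a _ => (isClosed_closedSquare _ _).measurableSet]
    exact ((measure_mono (iUnion₂_subset fun a ha => (hut ha).2.2)).trans_lt hUf.lt_top).ne
  -- The total area is finite, so finitely many squares leave a tail of area below `ν`; passing to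
  -- open squares loses only null sets.
  obtain ⟨F, hF⟩ := ((ENNReal.tendsto_tsum_compl_atTop_zero hsum).eventually_lt_const hν).exists
  refine ⟨F.image Subtype.val, ?_, ?_, ?_⟩
  · intro a ha
    obtain ⟨b, -, rfl⟩ := Finset.mem_image.mp ha
    have := hut b.2
    exact ⟨this.1, this.2.1, (square_subset_closedSquare _ _).trans this.2.2⟩
  · intro a ha b hb hab
    simp only [Finset.coe_image, mem_image, Finset.mem_coe] at ha hb
    obtain ⟨a', -, rfl⟩ := ha
    obtain ⟨b', -, rfl⟩ := hb
    exact (hud a'.2 b'.2 hab).mono (square_subset_closedSquare _ _)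
      (square_subset_closedSquare _ _)
  · have hbd : ∀ a : u, volume (closedSquare a.1.1 a.1.2 \ square a.1.1 a.1.2) = 0 := by
      intro a
      have h0 := (hut a.2).1.le
      rw [measure_sdiff (square_subset_closedSquare _ _)
        (isOpen_square _ _).measurableSet.nullMeasurableSet
        (by rw [volume_square _ h0]; exact ENNReal.ofReal_ne_top), volume_square _ h0,
        volume_closedSquare _ h0, tsub_self]
    have hsub : U \ ⋃ a ∈ F.image Subtype.val, square a.1 a.2 ⊆
        (U \ ⋃ a ∈ u, closedSquare a.1 a.2) ∪
        ((⋃ a : u, closedSquare a.1.1 a.1.2 \ square a.1.1 a.1.2) ∪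
          ⋃ a : {a : u // a ∉ F}, closedSquare a.1.1.1 a.1.1.2) := by
      rintro x ⟨hxU, hx⟩
      by_cases h : x ∈ ⋃ a ∈ u, closedSquare a.1 a.2
      · right
        simp only [mem_iUnion] at h
        obtain ⟨a, hau, hxa⟩ := h
        by_cases haF : (⟨a, hau⟩ : u) ∈ F
        · left
          refine mem_iUnion.mpr ⟨⟨a, hau⟩, hxa, fun hxs => hx ?_⟩
          simp only [mem_iUnion]
          exact ⟨a, Finset.mem_image.mpr ⟨_, haF, rfl⟩, hxs⟩
        · right
          exact mem_iUnion.mpr ⟨⟨⟨a, hau⟩, haF⟩, hxa⟩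
      · exact Or.inl ⟨hxU, h⟩
    refine (measure_mono hsub).trans_lt (lt_of_le_of_lt ?_ hF)
    refine (measure_union_le _ _).trans ?_
    rw [hu0, zero_add]
    refine (measure_union_le _ _).trans ?_
    rw [measure_iUnion_null hbd, zero_add]
    exact measure_iUnion_le _

/-! ### Symmetrization and truncation. -/

section Symmetrization

variable {m : ℕ}

/-- Symmetrization in the last two indices. -/
noncomputable def symmHess (ξ : HessSpace m) : HessSpace m :=
  WithLp.toLp 2 fun a => (ξ a + ξ (a.1, a.2.2, a.2.1)) / 2

theorem isSymmHess_symmHess (ξ : HessSpace m) : IsSymmHess (symmHess ξ) := fun i j k => by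
  simp [symmHess, add_comm]

theorem symmHess_eq_self {ξ : HessSpace m} (h : IsSymmHess ξ) : symmHess ξ = ξ := by
  ext ⟨i, j, k⟩
  simp [symmHess, h i k j]

theorem continuous_symmHess : Continuous (symmHess : HessSpace m → HessSpace m) := by
  refine (PiLp.continuous_toLp 2 _).comp (continuous_pi fun a => ?_)
  fun_prop

end Symmetrization

/-- Trades a linear dependence on the perturbation for a small constant plus a multiple of the
`p`-th power. -/
theorem le_add_rpow_mul_rpow {x κ p : ℝ} (hx : 0 ≤ x) (hκ : 0 < κ) (hp : 1 ≤ p) :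
    x ≤ κ + κ ^ (1 - p) * x ^ p := by
  rcases le_total x κ with h | h
  · have : 0 ≤ κ ^ (1 - p) * x ^ p := by positivity
    linarith
  · have hx0 : 0 < x := hκ.trans_le h
    have h1 : x ^ (1 - p) ≤ κ ^ (1 - p) :=
      Real.rpow_le_rpow_of_nonpos hκ h (by linarith)
    have h2 : x ^ (1 - p) * x ^ p = x := by
      rw [← Real.rpow_add hx0]; simp
    have h3 := mul_le_mul_of_nonneg_right h1 (Real.rpow_nonneg hx p)
    linarith

/-- Dominated convergence. Splitting the weight at height `N` decouples it from the gradient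
perturbation in `exists_relaxed_density_le`. -/
theorem exists_integral_max_sub_le {μ : Measure Plane} {a : Plane → ℝ} (ha : Integrable a μ)
    (ha0 : ∀ x, 0 ≤ a x) {σ : ℝ} (hσ : 0 < σ) :
    ∃ N : ℕ, ∫ x, max (a x - N) 0 ∂μ ≤ σ := by
  have h := tendsto_integral_of_dominated_convergence (μ := μ)
    (F := fun (N : ℕ) x => max (a x - N) 0) (f := fun _ => 0) a
    (fun N => ((ha.1.sub aestronglyMeasurable_const).sup aestronglyMeasurable_const)) ha
    (fun N => ae_of_all _ fun x => by
      rw [Real.norm_of_nonneg (le_max_right _ _)]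
      exact max_le (by linarith [Nat.cast_nonneg (α := ℝ) N]) (ha0 x))
    (ae_of_all _ fun x => by
      refine tendsto_const_nhds.congr' ?_
      filter_upwards [Filter.eventually_ge_atTop ⌈a x⌉₊] with N hN
      have := Nat.ceil_le.mp hN
      rw [max_eq_right (by linarith)])
  rw [integral_zero] at h
  obtain ⟨N, hN⟩ := (h.eventually_lt_const hσ).exists
  exact ⟨N, hN.le⟩

/-! ### Global perturbation and stability of the relaxed energy. -/

namespace IsGrowthIntegrand

variable {m : ℕ} {p C : ℝ} {f : GradSpace m → HessSpace m → ℝ}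

/-- Each local perturbation vanishes outside its square, so the finite sum is weakly differentiable
on the plane and reduces to a single summand on every square. -/
theorem exists_global_perturbation (H : IsGrowthIntegrand p C f) {ψ : Plane → Vec m}
    (hψ : ContDiff ℝ ∞ ψ) (hc : HasCompactSupport ψ) {V : Set Plane} (hV : IsOpen V)
    (hVf : volume V ≠ ⊤) {ε : ℝ} (hε : 0 < ε) {ν : ℝ≥0∞} (hν : 0 < ν) :
    ∃ (S : Set Plane) (θ : Plane → Vec m) (Dθ : Plane → GradSpace m) (D2θ : Plane → HessSpace m),
      MeasurableSet S ∧ S ⊆ V ∧ volume (V \ S) < ν ∧ IsBddSobolev2 S θ Dθ D2θ ∧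
      (∀ x, ‖θ x‖ ≤ ε ∧ ‖Dθ x‖ ≤ ε) ∧
      ∫ x in S, f (classicalGrad ψ x + Dθ x) (classicalHess ψ x + D2θ x) ≤
        (∫ x in S, quasiconvexification2 (f (classicalGrad ψ x)) (classicalHess ψ x))
          + ε * volume.real V := by
  choose r₀ hr₀ hloc using fun x₀ => H.exists_local_perturbation hψ x₀ hε
  obtain ⟨s, hs, hsd, hsν⟩ := exists_finset_disjoint_squares hV hVf hr₀ hν
  choose! θ Dθ D2θ hθ hθε hE using fun (a : Plane × ℝ) (ha : a ∈ s) =>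
    hloc a.1 a.2 (hs a ha).1 (hs a ha).2.1
  set S := ⋃ a ∈ s, square a.1 a.2 with hS
  have hSm : ∀ a ∈ s, MeasurableSet (square a.1 a.2) := fun a _ =>
    (isOpen_square _ _).measurableSet
  have hSV : S ⊆ V := iUnion₂_subset fun a ha => (hs a ha).2.2
  have hsq : ∀ a ∈ s, square a.1 a.2 ⊆ S := fun a ha => subset_biUnion_of_mem (u := fun a :
    Plane × ℝ => square a.1 a.2) (show a ∈ (s : Set (Plane × ℝ)) from ha)
  have hother : ∀ a ∈ s, ∀ x ∈ square a.1 a.2, ∀ b ∈ s, b ≠ a → x ∉ square b.1 b.2 :=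
    fun a ha x hx b hb hba hxb => disjoint_left.mp (hsd hb ha hba) hxb hx
  have hin : ∀ a ∈ s, ∀ x ∈ square a.1 a.2, ∑ b ∈ s, θ b x = θ a x ∧
      ∑ b ∈ s, Dθ b x = Dθ a x ∧ ∑ b ∈ s, D2θ b x = D2θ a x := by
    intro a ha x hx
    have h0 := fun b hb hba => (hθ b hb).eq_zero x (hother a ha x hx b hb hba)
    exact ⟨Finset.sum_eq_single_of_mem a ha fun b hb hba => (h0 b hb hba).1,
      Finset.sum_eq_single_of_mem a ha fun b hb hba => (h0 b hb hba).2.1,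
      Finset.sum_eq_single_of_mem a ha fun b hb hba => (h0 b hb hba).2.2⟩
  have hsum : IsBddSobolev2 S (fun x => ∑ b ∈ s, θ b x) (fun x => ∑ b ∈ s, Dθ b x)
      (fun x => ∑ b ∈ s, D2θ b x) := IsBddSobolev2.sum s fun a ha => (hθ a ha).mono (hsq a ha)
  have c1 := (contDiff_classicalGrad hψ).continuous
  have c2 := (contDiff_classicalHess hψ).continuous
  have c3 := H.continuous_quasiconvexification2 c1 c2 (isSymmHess_classicalHess hψ)
  have hSf : volume S ≠ ⊤ := ((measure_mono hSV).trans_lt hVf.lt_top).ne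
  have : IsFiniteMeasure (volume.restrict S) := ⟨by simpa using hSf.lt_top⟩
  have i1 : IntegrableOn (fun x => f (classicalGrad ψ x + ∑ b ∈ s, Dθ b x)
      (classicalHess ψ x + ∑ b ∈ s, D2θ b x)) S volume := by
    obtain ⟨B, hB⟩ := hsum.bdd
    obtain ⟨B', hB'⟩ := c2.bounded_above_of_compact_support
      (hc.of_isClosed_subset (isClosed_tsupport _) (tsupport_classicalHess_subset ψ))
    refine H.integrable (c1.measurable.add hsum.meas_grad).aestronglyMeasurable
      (MemLp.of_bound (c2.measurable.add hsum.meas_hess).aestronglyMeasurable (B' + B)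
        (ae_of_all _ fun x => norm_add_le_of_le (hB' x) (hB x).2.2))
  have i2 : ∀ a ∈ s, IntegrableOn (fun x => quasiconvexification2 (f (classicalGrad ψ x))
      (classicalHess ψ x)) (square a.1 a.2) volume := fun a _ =>
    (c3.continuousOn.integrableOn_compact (isCompact_closedSquare a.1 a.2)).mono_set
      (square_subset_closedSquare _ _)
  refine ⟨S, _, _, _, s.measurableSet_biUnion hSm, hSV, hsν, hsum, fun x => ?_, ?_⟩
  · by_cases hx : x ∈ S
    · obtain ⟨a, ha, hxa⟩ := mem_iUnion₂.mp hx
      obtain ⟨e0, e1, -⟩ := hin a ha x hxa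
      rw [e0, e1]
      exact hθε a ha x
    · obtain ⟨e0, e1, -⟩ := hsum.eq_zero x hx
      rw [e0, e1]
      simp [hε.le]
  · rw [hS, integral_biUnion_finset s hSm hsd fun a ha => i1.mono_set (hsq a ha),
      integral_biUnion_finset s hSm hsd i2]
    have hvol : ∑ a ∈ s, a.2 ^ 2 ≤ volume.real V := by
      have e : ∀ a ∈ s, a.2 ^ 2 = volume.real (square a.1 a.2) := fun a ha => by
        rw [measureReal_def, volume_square _ (hs a ha).1.le, ENNReal.toReal_ofReal (sq_nonneg _)]
      rw [Finset.sum_congr rfl e, ← measureReal_biUnion_finset hsd hSm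
        fun a ha => ((measure_mono (hsq a ha)).trans_lt hSf.lt_top).ne]
      exact measureReal_mono hSV hVf
    calc _ ≤ ∑ a ∈ s, ((∫ x in square a.1 a.2, quasiconvexification2 (f (classicalGrad ψ x))
          (classicalHess ψ x)) + ε * a.2 ^ 2) := by
          refine Finset.sum_le_sum fun a ha => le_trans (le_of_eq ?_) (hE a ha)
          refine setIntegral_congr_fun (hSm a ha) fun x hx => ?_
          obtain ⟨-, e1, e2⟩ := hin a ha x hx
          simp only [e1, e2]
      _ ≤ _ := by
          rw [Finset.sum_add_distrib, ← Finset.mul_sum]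
          gcongr

theorem integrable_quasiconvexification2 (H : IsGrowthIntegrand p C f) {μ : Measure Plane}
    [IsFiniteMeasure μ] {V : Plane → GradSpace m} {F : Plane → HessSpace m}
    (hV : AEStronglyMeasurable V μ) (hF : MemLp F (ENNReal.ofReal p) μ)
    (hs : ∀ᵐ x ∂μ, IsSymmHess (F x)) :
    Integrable (fun x => quasiconvexification2 (f (V x)) (F x)) μ := by
  have hp := H.one_le
  have h1 : Integrable (fun x => ‖F x‖ ^ p) μ := by
    have := hF.integrable_norm_rpow (by simp; linarith) ENNReal.ofReal_ne_top
    rwa [ENNReal.toReal_ofReal (by linarith)] at this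
  -- Symmetrizing the argument gives a density continuous everywhere, hence measurability, and
  -- changes nothing at almost every point.
  have hc : Continuous fun z : GradSpace m × HessSpace m =>
      quasiconvexification2 (f z.1) (symmHess z.2) :=
    H.continuous_quasiconvexification2 continuous_fst (continuous_symmHess.comp continuous_snd)
      fun z => isSymmHess_symmHess _
  refine Integrable.mono' (((integrable_const 1).add h1).const_mul C) ?_
    (ae_of_all _ fun x => ?_)
  · refine (hc.comp_aestronglyMeasurable (hV.prodMk hF.1)).congr ?_
    filter_upwards [hs] with x hx
    simp [symmHess_eq_self hx]
  · rw [Real.norm_of_nonneg (H.quasiconvexification2_nonneg _ _)]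
    exact H.quasiconvexification2_le _ _

/-- Upper bound for the relaxed energy density under a perturbation of the gradient and the
Hessian. -/
theorem exists_relaxed_density_le (H : IsGrowthIntegrand p C f) {μ : Measure Plane}
    [IsFiniteMeasure μ] (Du : Plane → GradSpace m) {D2u : Plane → HessSpace m}
    (hD2u : MemLp D2u (ENNReal.ofReal p) μ) {σ : ℝ} (hσ : 0 < σ) :
    ∃ L : ℝ, 0 ≤ L ∧ ∃ b : Plane → ℝ, Integrable b μ ∧ ∫ x, b x ∂μ ≤ σ ∧
      ∀ x E₁ E₂, IsSymmHess E₂ →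
        quasiconvexification2 (f (Du x + E₁)) (D2u x + E₂) ≤
          quasiconvexification2 (f (Du x)) (D2u x) + b x + L * (‖E₁‖ ^ p + ‖E₂‖ ^ p) := by
  have hp := H.one_le
  have hC := H.const_nonneg
  have h1 : Integrable (fun x => ‖D2u x‖ ^ p) μ := by
    have := hD2u.integrable_norm_rpow (by simp; linarith) ENNReal.ofReal_ne_top
    rwa [ENNReal.toReal_ofReal (by linarith)] at this
  set a : Plane → ℝ := fun x => 1 + ‖D2u x‖ ^ p with ha
  have hai : Integrable a μ := (integrable_const 1).add h1
  have ha0 : ∀ x, 0 ≤ a x := fun x => by positivity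
  set I := ∫ x, a x ∂μ with hI
  have hI0 : 0 ≤ I := integral_nonneg ha0
  -- `N`, then `κ`, and `η` give each of the three terms of `b` an integral of at most `σ / 3`; `L`
  -- may become large.
  obtain ⟨N, hN⟩ := exists_integral_max_sub_le hai ha0 (σ := σ / (3 * (C + 1))) (by positivity)
  set Λ : ℝ := 2 ^ p with hΛ
  have hΛ1 : 1 ≤ Λ := Real.one_le_rpow (by norm_num) (by linarith)
  set κ := σ / (3 * (C * N * C + 1) * (μ.real univ + 1)) with hκ
  have hκ0 : 0 < κ := by positivity
  set η := min (1 / 2) (σ / (3 * (2 * C * Λ ^ 2 * I + 1))) with hη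
  have hη0 : 0 < η := by positivity
  have hη1 : η < 1 := (min_le_left _ _).trans_lt (by norm_num)
  clear_value Λ κ η I
  obtain ⟨A, hA, hQ⟩ := H.exists_quasiconvexification2_le_add hη0 hη1
  have hmi : Integrable (fun x => max (a x - N) 0) μ :=
    (hai.sub (integrable_const _)).sup (integrable_const 0)
  have hb1 : Integrable (fun x => C * max (a x - N) 0) μ := hmi.const_mul C
  have hb2 : Integrable (fun _ : Plane => C * N * C * κ) μ := integrable_const _
  have hb3 : Integrable (fun x => 2 * η * C * Λ ^ 2 * a x) μ := hai.const_mul _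
  refine ⟨C * N * C * κ ^ (1 - p) + A + 2 * η * C * Λ ^ 2, by positivity,
    fun x => C * max (a x - N) 0 + C * N * C * κ + 2 * η * C * Λ ^ 2 * a x,
    (hb1.add hb2).add hb3, ?_, fun x E₁ E₂ hE => ?_⟩
  · have e : ∫ x, (C * max (a x - N) 0 + C * N * C * κ + 2 * η * C * Λ ^ 2 * a x) ∂μ =
        C * (∫ x, max (a x - N) 0 ∂μ) + μ.real univ * (C * N * C * κ) +
          2 * η * C * Λ ^ 2 * I := by
      have hb12 : Integrable (fun x => C * max (a x - N) 0 + C * N * C * κ) μ := hb1.add hb2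
      rw [integral_add hb12 hb3, integral_add hb1 hb2, integral_const_mul C,
        integral_const_mul (2 * η * C * Λ ^ 2), integral_const, smul_eq_mul, ← hI]
    rw [e]
    have j1 : C * (∫ x, max (a x - N) 0 ∂μ) ≤ σ / 3 := by
      calc C * (∫ x, max (a x - N) 0 ∂μ) ≤ (C + 1) * (σ / (3 * (C + 1))) := by
            refine mul_le_mul (by linarith) hN (integral_nonneg fun x => le_max_right _ _)
              (by linarith)
        _ = σ / 3 := by field_simp
    have j2 : μ.real univ * (C * N * C * κ) ≤ σ / 3 := by
      calc μ.real univ * (C * N * C * κ) ≤ (μ.real univ + 1) * ((C * N * C + 1) * κ) := by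
            gcongr <;> linarith
        _ = σ / 3 := by rw [hκ]; field_simp
    have j3 : 2 * η * C * Λ ^ 2 * I ≤ σ / 3 := by
      have k1 : η ≤ σ / (3 * (2 * C * Λ ^ 2 * I + 1)) := hη.trans_le (min_le_right _ _)
      have k2 : η * (3 * (2 * C * Λ ^ 2 * I + 1)) ≤ σ := (le_div_iff₀ (by positivity)).mp k1
      nlinarith
    linarith
  · have hE' : IsSymmHess (D2u x - (D2u x + E₂)) := fun i j k => by
      have := hE i j k
      simp [this]
    have q1 := hQ (Du x + E₁) (D2u x) (D2u x + E₂) hE'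
    rw [sub_add_cancel_left, norm_neg, ← hΛ] at q1
    have q2 := (abs_le.mp (H.abs_quasiconvexification2_sub_le (Du x + E₁) (Du x) (D2u x))).2
    rw [add_sub_cancel_left] at q2
    have q3 := H.quasiconvexification2_le (Du x + E₁) (D2u x)
    have q4 := H.quasiconvexification2_nonneg (Du x) (D2u x)
    have hax : a x = 1 + ‖D2u x‖ ^ p := rfl
    rw [← hax] at q2 q3
    have n1 := norm_nonneg E₁
    -- If `C * ‖E₁‖ ≤ 1`, the Lipschitz bound is used and the excess over `N` has coefficient at
    -- most `C`. Otherwise the growth bound is enough, as `N ≤ N * (C * ‖E₁‖)`.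
    have r1 : quasiconvexification2 (f (Du x + E₁)) (D2u x) ≤
        quasiconvexification2 (f (Du x)) (D2u x) + C * max (a x - N) 0 +
          C * N * (C * ‖E₁‖) := by
      rcases le_total (C * ‖E₁‖) 1 with h | h
      · have s1 : a x ≤ N + max (a x - N) 0 := by linarith [le_max_left (a x - N) 0]
        have s2 : 0 ≤ max (a x - N) 0 := le_max_right _ _
        have s3 : C * ‖E₁‖ * (C * a x) ≤ C * ‖E₁‖ * (C * (N + max (a x - N) 0)) := by gcongr
        have s4 : C * ‖E₁‖ * (C * max (a x - N) 0) ≤ 1 * (C * max (a x - N) 0) := by gcongr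
        nlinarith
      · have s1 : a x ≤ N + max (a x - N) 0 := by linarith [le_max_left (a x - N) 0]
        have s2 : C * a x ≤ C * (N + max (a x - N) 0) := by gcongr
        have s3 : C * N * 1 ≤ C * N * (C * ‖E₁‖) := by gcongr
        linarith
    have r2 : C * N * (C * ‖E₁‖) ≤ C * N * C * κ + C * N * C * κ ^ (1 - p) * ‖E₁‖ ^ p := by
      have := mul_le_mul_of_nonneg_left (le_add_rpow_mul_rpow n1 hκ0 hp)
        (by positivity : 0 ≤ C * N * C)
      linarith
    have r3 : 2 * η * (C * (1 + Λ * ‖D2u x + E₂‖ ^ p)) ≤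
        2 * η * C * Λ ^ 2 * a x + 2 * η * C * Λ ^ 2 * ‖E₂‖ ^ p := by
      have s1 := Real.rpow_le_rpow (norm_nonneg _) (norm_add_le (D2u x) E₂)
        (by linarith : 0 ≤ p)
      have s2 := s1.trans (add_rpow_le_two_rpow_mul (by linarith : 0 ≤ p) (norm_nonneg (D2u x))
        (norm_nonneg E₂))
      rw [← hΛ] at s2
      have s3 : 1 + Λ * ‖D2u x + E₂‖ ^ p ≤ Λ ^ 2 * (a x + ‖E₂‖ ^ p) := by
        have w1 := mul_le_mul_of_nonneg_left s2 (by linarith : 0 ≤ Λ)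
        have w2 : 1 ≤ Λ ^ 2 := one_le_pow₀ hΛ1
        rw [hax]
        linarith
      have := mul_le_mul_of_nonneg_left s3 (by positivity : 0 ≤ 2 * η * C)
      linarith
    have t1 : 0 ≤ ‖E₁‖ ^ p := by positivity
    have t2 : 0 ≤ ‖E₂‖ ^ p := by positivity
    have u1 : 0 ≤ C * N * C * κ ^ (1 - p) := by positivity
    have u2 : 0 ≤ 2 * η * C * Λ ^ 2 := by positivity
    have m1 := mul_nonneg u1 t2
    have m2 := mul_nonneg u2 t1
    have m3 := mul_nonneg hA t1
    linarith

end IsGrowthIntegrand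

/-! ### Norm bounds and the final energy estimate. -/

theorem setIntegral_norm_rpow_le {E : Type*} [NormedAddCommGroup E] {Ω : Set Plane} {p τ : ℝ}
    (hp : 1 ≤ p) (hτ : 0 ≤ τ) {F : Plane → E} (hF : MemLp F (ENNReal.ofReal p) volume)
    (h : eLpNorm F (ENNReal.ofReal p) volume ≤ ENNReal.ofReal τ) :
    IntegrableOn (fun x => ‖F x‖ ^ p) Ω volume ∧ ∫ x in Ω, ‖F x‖ ^ p ≤ τ ^ p := by
  have hp0 : 0 < p := by linarith
  have h0 : ENNReal.ofReal p ≠ 0 := by simpa using hp0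
  have hi := hF.integrable_norm_rpow h0 ENNReal.ofReal_ne_top
  rw [hF.eLpNorm_eq_integral_rpow_norm h0 ENNReal.ofReal_ne_top,
    ENNReal.ofReal_le_ofReal_iff hτ] at h
  rw [ENNReal.toReal_ofReal hp0.le] at hi h
  refine ⟨hi.integrableOn, ?_⟩
  have hn : 0 ≤ ∫ x, ‖F x‖ ^ p := integral_nonneg fun x => by positivity
  calc ∫ x in Ω, ‖F x‖ ^ p ≤ ∫ x, ‖F x‖ ^ p :=
        setIntegral_le_integral hi (ae_of_all _ fun x => by positivity)
    _ = ((∫ x, ‖F x‖ ^ p) ^ p⁻¹) ^ p := by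
        rw [← Real.rpow_mul hn, inv_mul_cancel₀ hp0.ne', Real.rpow_one]
    _ ≤ τ ^ p := Real.rpow_le_rpow (by positivity) h hp0.le

theorem sobolev1Norm_le {m : ℕ} (Ω : Set Plane) {p : ℝ} (hp : 1 ≤ p) (u : Plane → Vec m)
    (Du : Plane → GradSpace m) :
    sobolev1Norm Ω p u Du ≤ eLpNorm u (ENNReal.ofReal p) (volume.restrict Ω)
      + eLpNorm Du (ENNReal.ofReal p) (volume.restrict Ω) := by
  have hp0 : 0 < p := by linarith
  have h0 : ENNReal.ofReal p ≠ 0 := by simpa using hp0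
  rw [eLpNorm_eq_lintegral_rpow_enorm_toReal h0 ENNReal.ofReal_ne_top,
    eLpNorm_eq_lintegral_rpow_enorm_toReal h0 ENNReal.ofReal_ne_top,
    ENNReal.toReal_ofReal hp0.le]
  refine le_trans (le_of_eq ?_) (ENNReal.rpow_add_rpow_le_add _ _ hp)
  rw [sobolev1Norm, ← ENNReal.rpow_mul, ← ENNReal.rpow_mul, one_div_mul_cancel hp0.ne',
    ENNReal.rpow_one, ENNReal.rpow_one]

/-- The form is that of `u - w = -(E₀ + θ)`, with `E₀` small in `L^p` and `θ` uniformly small. -/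
theorem eLpNorm_neg_add_le {E : Type*} [NormedAddCommGroup E] {Ω : Set Plane} {q : ℝ≥0∞}
    (hq : 1 ≤ q) {F G : Plane → E} (hF : AEStronglyMeasurable F volume)
    (hG : AEStronglyMeasurable G volume) {τ : ℝ≥0∞} {ε : ℝ} (hFτ : eLpNorm F q volume ≤ τ)
    (hGε : ∀ x, ‖G x‖ ≤ ε) :
    eLpNorm (fun x => -(F x + G x)) q (volume.restrict Ω) ≤
      τ + volume Ω ^ q.toReal⁻¹ * ENNReal.ofReal ε := by
  have e : (fun x => -(F x + G x)) = -(F + G) := rfl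
  rw [e, eLpNorm_neg]
  refine (eLpNorm_add_le hF.restrict hG.restrict hq).trans (add_le_add ?_ ?_)
  · exact (eLpNorm_mono_measure _ Measure.restrict_le_self).trans hFτ
  · simpa using eLpNorm_le_of_ae_bound (p := q) (μ := volume.restrict Ω) (ae_of_all _ hGε)

theorem exists_pos_mul_rpow_le {p L σ : ℝ} (hp : 1 ≤ p) (hL : 0 ≤ L) (hσ : 0 < σ) :
    ∃ τ₀ > 0, ∀ τ : ℝ, 0 ≤ τ → τ ≤ τ₀ → L * τ ^ p ≤ σ := by
  refine ⟨min 1 (σ / (L + 1)), by positivity, fun τ h0 hτ => ?_⟩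
  have h1 : τ ≤ 1 := hτ.trans (min_le_left _ _)
  have h2 : τ * (L + 1) ≤ σ := (le_div_iff₀ (by positivity)).mp (hτ.trans (min_le_right _ _))
  have h3 : τ ^ p ≤ τ := by
    simpa using Real.rpow_le_rpow_of_exponent_ge_of_imp h0 h1 hp (by intro _ h; linarith)
  nlinarith [Real.rpow_nonneg h0 p]

/-- Every sufficiently large part of `Ω` is contained in a compact subset on which a cutoff equals
one. -/
theorem exists_cutoff_of_measure_lt {Ω : Set Plane} (hΩ : IsOpen Ω) (hΩf : volume Ω ≠ ⊤)
    {ν : ℝ≥0∞} (hν : ν ≠ 0) :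
    ∃ χ : Plane → ℝ, ContDiff ℝ ∞ χ ∧ HasCompactSupport χ ∧ tsupport χ ⊆ Ω ∧
      ∃ V : Set Plane, IsOpen V ∧ V ⊆ Ω ∧ (∀ x ∈ V, χ x = 1) ∧ volume (Ω \ V) ≤ ν := by
  obtain ⟨K, hKΩ, hK, hKν⟩ : ∃ K ⊆ Ω, IsCompact K ∧ volume (Ω \ K) ≤ ν := by
    -- Inner regularity is applied at the level `volume Ω - ν`, which lies strictly below `volume Ω`
    -- only if the latter is nonzero.
    rcases eq_or_ne (volume Ω) 0 with h0 | h0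
    · exact ⟨∅, empty_subset _, isCompact_empty, by simp [h0]⟩
    · obtain ⟨K, hKΩ, hK, hlt⟩ := hΩ.exists_lt_isCompact (ENNReal.sub_lt_self hΩf h0 hν)
      refine ⟨K, hKΩ, hK, ?_⟩
      rw [measure_sdiff hKΩ hK.measurableSet.nullMeasurableSet hK.measure_lt_top.ne]
      exact tsub_le_iff_left.mpr (tsub_le_iff_right.mp hlt.le)
  obtain ⟨χ, hχ, hc, hs, V, hV, hKV, h1⟩ := exists_smooth_cutoff hK hΩ hKΩ
  refine ⟨χ, hχ, hc, hs, V, hV, fun x hx => hs (subset_tsupport _ ?_), h1,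
    (measure_mono (sdiff_subset_sdiff_right hKV)).trans hKν⟩
  simp [h1 x hx]

namespace IsGrowthIntegrand

variable {m : ℕ} {p C : ℝ} {f : GradSpace m → HessSpace m → ℝ}

/-- Absolute continuity of the integral. The weight is the growth bound at `D2u + E₂`, apart from
its share in `‖E₂‖ ^ p`. -/
theorem exists_measure_small (H : IsGrowthIntegrand p C f) {μ : Measure Plane}
    [IsFiniteMeasure μ] {D2u : Plane → HessSpace m} (hD2u : MemLp D2u (ENNReal.ofReal p) μ)
    {σ : ℝ} (hσ : 0 < σ) :
    ∃ ν > 0, ∀ s : Set Plane, μ s < ν →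
      ∫ x in s, C * (1 + 2 ^ p * ‖D2u x‖ ^ p) ∂μ ≤ σ := by
  have hp := H.one_le
  have hC := H.const_nonneg
  have h1 : Integrable (fun x => ‖D2u x‖ ^ p) μ := by
    have := hD2u.integrable_norm_rpow (by simp; linarith) ENNReal.ofReal_ne_top
    rwa [ENNReal.toReal_ofReal (by linarith)] at this
  have hi : Integrable (fun x => C * (1 + 2 ^ p * ‖D2u x‖ ^ p)) μ :=
    ((integrable_const 1).add (h1.const_mul _)).const_mul C
  obtain ⟨ν, hν, h⟩ := exists_pos_setLIntegral_lt_of_measure_lt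
    (f := fun x => ‖C * (1 + 2 ^ p * ‖D2u x‖ ^ p)‖ₑ) (μ := μ) hi.2.ne
    (ε := ENNReal.ofReal σ) (by simpa using hσ)
  refine ⟨ν, hν, fun s hs => ?_⟩
  refine (Real.le_norm_self _).trans ?_
  rw [← toReal_enorm]
  exact ENNReal.toReal_le_of_le_ofReal hσ.le
    ((enorm_integral_le_lintegral_enorm _).trans (h s hs).le)

/-- Energy estimate: the integrand is controlled by the relaxed one on `S`, and the complement
of `S` is small. -/
theorem setIntegral_le_of_split (H : IsGrowthIntegrand p C f) {Ω S : Set Plane}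
    (hΩ : MeasurableSet Ω) (hS : MeasurableSet S) (hSΩ : S ⊆ Ω)
    [IsFiniteMeasure (volume.restrict Ω)]
    {Du Dw E₁ : Plane → GradSpace m} {D2u D2w E₂ : Plane → HessSpace m} {b : Plane → ℝ}
    {L σ κ τ : ℝ} (hL : 0 ≤ L)
    (hD2u : MemLp D2u (ENNReal.ofReal p) (volume.restrict Ω))
    (hDw : AEStronglyMeasurable Dw (volume.restrict Ω))
    (hD2w : MemLp D2w (ENNReal.ofReal p) (volume.restrict Ω))
    (hQu : IntegrableOn (fun x => quasiconvexification2 (f (Du x)) (D2u x)) Ω volume)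
    (hQw : IntegrableOn (fun x => quasiconvexification2 (f (Du x + E₁ x)) (D2u x + E₂ x)) Ω volume)
    (hb : IntegrableOn b Ω volume) (hbσ : ∫ x in Ω, b x ≤ σ)
    (hdens : ∀ᵐ x ∂(volume.restrict Ω), quasiconvexification2 (f (Du x + E₁ x)) (D2u x + E₂ x) ≤
      quasiconvexification2 (f (Du x)) (D2u x) + b x + L * (‖E₁ x‖ ^ p + ‖E₂ x‖ ^ p))
    (hE₁ : IntegrableOn (fun x => ‖E₁ x‖ ^ p) Ω volume ∧ ∫ x in Ω, ‖E₁ x‖ ^ p ≤ τ)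
    (hE₂ : IntegrableOn (fun x => ‖E₂ x‖ ^ p) Ω volume ∧ ∫ x in Ω, ‖E₂ x‖ ^ p ≤ τ)
    (hsmall : ∫ x in Ω \ S, C * (1 + 2 ^ p * ‖D2u x‖ ^ p) ≤ σ)
    (hout : ∀ x ∈ Ω \ S, D2w x = D2u x + E₂ x)
    (hin : ∫ x in S, f (Dw x) (D2w x) ≤
      (∫ x in S, quasiconvexification2 (f (Du x + E₁ x)) (D2u x + E₂ x)) + κ) :
    ∫ x in Ω, f (Dw x) (D2w x) ≤ (∫ x in Ω, quasiconvexification2 (f (Du x)) (D2u x))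
      + (2 * σ + κ + 2 * L * τ + C * 2 ^ p * τ) := by
  have hp := H.one_le
  have hC := H.const_nonneg
  have iw : IntegrableOn (fun x => f (Dw x) (D2w x)) Ω volume := H.integrable hDw hD2w
  have hΩS : MeasurableSet (Ω \ S) := hΩ.diff hS
  have h1 : Integrable (fun x => ‖D2u x‖ ^ p) (volume.restrict Ω) := by
    have := hD2u.integrable_norm_rpow (by simp; linarith) ENNReal.ofReal_ne_top
    rwa [ENNReal.toReal_ofReal (by linarith)] at this
  have hsplit : (∫ x in S, f (Dw x) (D2w x)) + ∫ x in Ω \ S, f (Dw x) (D2w x) =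
      ∫ x in Ω, f (Dw x) (D2w x) := by
    have := integral_inter_add_sdiff hS iw
    rwa [inter_eq_right.mpr hSΩ] at this
  -- Nonnegativity of the relaxed density allows passing from `S` to `Ω` before comparing with `u`.
  have e1 : ∫ x in S, quasiconvexification2 (f (Du x + E₁ x)) (D2u x + E₂ x) ≤
      ∫ x in Ω, quasiconvexification2 (f (Du x + E₁ x)) (D2u x + E₂ x) :=
    setIntegral_mono_set hQw (ae_of_all _ fun x => H.quasiconvexification2_nonneg _ _)
      (Filter.Eventually.of_forall hSΩ)
  have e2 : ∫ x in Ω, quasiconvexification2 (f (Du x + E₁ x)) (D2u x + E₂ x) ≤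
      (∫ x in Ω, quasiconvexification2 (f (Du x)) (D2u x)) + σ + 2 * L * τ := by
    have i3 : IntegrableOn (fun x => L * (‖E₁ x‖ ^ p + ‖E₂ x‖ ^ p)) Ω volume :=
      (hE₁.1.add hE₂.1).const_mul L
    have i12 : IntegrableOn (fun x => quasiconvexification2 (f (Du x)) (D2u x) + b x) Ω volume :=
      hQu.add hb
    refine (integral_mono_ae hQw (i12.add i3) hdens).trans ?_
    have : ∫ x in Ω, L * (‖E₁ x‖ ^ p + ‖E₂ x‖ ^ p) ≤ L * (τ + τ) := by
      rw [integral_const_mul, integral_add hE₁.1 hE₂.1]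
      exact mul_le_mul_of_nonneg_left (add_le_add hE₁.2 hE₂.2) hL
    have e : ∫ x in Ω, (quasiconvexification2 (f (Du x)) (D2u x) + b x +
        L * (‖E₁ x‖ ^ p + ‖E₂ x‖ ^ p)) =
        (∫ x in Ω, quasiconvexification2 (f (Du x)) (D2u x)) + (∫ x in Ω, b x) +
          ∫ x in Ω, L * (‖E₁ x‖ ^ p + ‖E₂ x‖ ^ p) := by
      rw [integral_add i12 i3, integral_add hQu hb]
    refine (le_of_eq e).trans ?_
    linarith
  have e3 : ∫ x in Ω \ S, f (Dw x) (D2w x) ≤ σ + C * 2 ^ p * τ := by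
    have i1 : IntegrableOn (fun x => C * (1 + 2 ^ p * ‖D2u x‖ ^ p)) (Ω \ S) volume :=
      IntegrableOn.mono_set (s := Ω \ S) (t := Ω)
        (((integrable_const 1).add (h1.const_mul _)).const_mul C) sdiff_subset
    have i2 : IntegrableOn (fun x => C * 2 ^ p * ‖E₂ x‖ ^ p) (Ω \ S) volume :=
      (hE₂.1.mono_set sdiff_subset).const_mul _
    calc ∫ x in Ω \ S, f (Dw x) (D2w x)
        ≤ ∫ x in Ω \ S, (C * (1 + 2 ^ p * ‖D2u x‖ ^ p) + C * 2 ^ p * ‖E₂ x‖ ^ p) := by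
          refine setIntegral_mono_on (iw.mono_set sdiff_subset) (i1.add i2) hΩS fun x hx => ?_
          refine (H.le _ _).trans ?_
          rw [hout x hx]
          have s1 := Real.rpow_le_rpow (norm_nonneg _) (norm_add_le (D2u x) (E₂ x))
            (by linarith : 0 ≤ p)
          have s2 := s1.trans (add_rpow_le_two_rpow_mul (by linarith : 0 ≤ p)
            (norm_nonneg (D2u x)) (norm_nonneg (E₂ x)))
          have := mul_le_mul_of_nonneg_left s2 hC
          linarith
      _ = (∫ x in Ω \ S, C * (1 + 2 ^ p * ‖D2u x‖ ^ p)) +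
          C * 2 ^ p * ∫ x in Ω \ S, ‖E₂ x‖ ^ p := by
          rw [integral_add i1 i2, integral_const_mul (C * 2 ^ p)]
      _ ≤ σ + C * 2 ^ p * τ := by
          refine add_le_add hsmall (mul_le_mul_of_nonneg_left ?_ (by positivity))
          refine le_trans ?_ hE₂.2
          exact setIntegral_mono_set hE₂.1 (ae_of_all _ fun x => by positivity)
            (Filter.Eventually.of_forall sdiff_subset)
  linarith

end IsGrowthIntegrand

/-! ### The relaxation theorem. -/

theorem proposition4p1 {m : ℕ} (p : ℝ) (hp : 1 ≤ p)
    (f : GradSpace m → HessSpace m → ℝ) (hf : Measurable (Function.uncurry f))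
    (C : ℝ)
    (hgrowth : ∀ v ξ, 0 ≤ f v ξ ∧ f v ξ ≤ C * (1 + ‖ξ‖ ^ p))
    (hlip : ∀ v v' ξ, |f v ξ - f v' ξ| ≤ C * ‖v - v'‖ * max (f v ξ) (f v' ξ))
    (hlipQ : ∀ v v' ξ,
      |quasiconvexification2 (f v) ξ - quasiconvexification2 (f v') ξ| ≤
        C * ‖v - v'‖ * max (quasiconvexification2 (f v) ξ) (quasiconvexification2 (f v') ξ))
    (Ω : Set Plane) (hΩ : IsOpen Ω) (hΩb : Bornology.IsBounded Ω) (hΩs : HasSmoothBoundary Ω)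
    (u : Plane → Vec m) (Du : Plane → GradSpace m) (D2u : Plane → HessSpace m)
    (hu : IsSobolev2 Ω (ENNReal.ofReal p) u Du D2u)
    (δ : ℝ) (hδ : 0 < δ) :
    ∃ (w : Plane → Vec m) (Dw : Plane → GradSpace m) (D2w : Plane → HessSpace m),
      IsSobolev2 Ω (ENNReal.ofReal p) w Dw D2w ∧
      sobolev1Norm Ω p (fun x => u x - w x) (fun x => Du x - Dw x) < ENNReal.ofReal δ ∧
      IntegrableOn (fun x => f (Dw x) (D2w x)) Ω volume ∧
      IntegrableOn (fun x => quasiconvexification2 (f (Du x)) (D2u x)) Ω volume ∧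
      ∫ x in Ω, f (Dw x) (D2w x) <
        (∫ x in Ω, quasiconvexification2 (f (Du x)) (D2u x)) + δ := by

  have H : IsGrowthIntegrand p C f :=
    ⟨hp, hf, fun v ξ => (hgrowth v ξ).1, fun v ξ => (hgrowth v ξ).2, hlip, hlipQ⟩
  have hC := H.const_nonneg
  set q : ℝ≥0∞ := ENNReal.ofReal p with hq
  have hq1 : 1 ≤ q := by simpa [hq] using hp
  have hqt : q ≠ ⊤ := ENNReal.ofReal_ne_top
  have hΩf : volume Ω < ⊤ := hΩb.measure_lt_top
  have hfin : IsFiniteMeasure (volume.restrict Ω) := ⟨by simpa using hΩf⟩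
  -- Order of choices: `σ` determines `L`, `b` and `ν`; then come the cutoff and `V`, then `τ` in
  -- terms of `L`, then `ψ`, and last the size `ε` of the oscillations.
  set σ := δ / 8 with hσ
  have hσ0 : 0 < σ := by positivity
  obtain ⟨L, hL, b, hb, hbσ, hdens⟩ := H.exists_relaxed_density_le Du hu.memLp_hess hσ0
  obtain ⟨ν, hν, hsmall⟩ := H.exists_measure_small hu.memLp_hess hσ0
  -- `Ω \ V` and `V \ S` each receive a quarter of `min ν 1`; the minimum keeps this finite, so that
  -- the sum is strictly below `ν`.
  obtain ⟨χ, hχ, hχc, hχs, V, hV, hVΩ, hχ1, hVν⟩ := exists_cutoff_of_measure_lt hΩ hΩf.ne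
    (ν := min ν 1 / 4) (by simpa using hν.ne')
  obtain ⟨τ₀, hτ₀, hτL⟩ := exists_pos_mul_rpow_le (L := 2 * L + C * 2 ^ p) hp (by positivity) hσ0
  set τ := min τ₀ (δ / 8) with hτ
  have hτ0 : 0 < τ := by positivity
  obtain ⟨m0, m1, m2⟩ := hu.memLp_cutoff hΩ.measurableSet hχ hχc hχs
  have hχu := hu.hasWeakDerivs.cutoff hχ hχc hχs
  -- The thickening radius one is arbitrary: only compactness of the support of `ψ` matters, and it
  -- may leave `Ω`.
  obtain ⟨ψ, hψ, hψs, a0, a1, a2⟩ := hχu.exists_smooth_approx hq1 hqt m0 m1 m2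
    (K := tsupport χ) (fun x hx => by simp [image_eq_zero_of_notMem_tsupport hx]) one_pos
    (ε := ENNReal.ofReal τ) (by simpa using hτ0)
  have hψc : HasCompactSupport ψ :=
    hχc.isCompact.cthickening.of_isClosed_subset (isClosed_tsupport _) hψs
  have c1 := (contDiff_classicalGrad hψ).continuous
  have c2 := (contDiff_classicalHess hψ).continuous
  have hψ0 : MemLp ψ q volume := hψ.continuous.memLp_of_hasCompactSupport hψc
  have hψ1 : MemLp (classicalGrad ψ) q volume := c1.memLp_of_hasCompactSupport
    (hψc.of_isClosed_subset (isClosed_tsupport _) (tsupport_classicalGrad_subset ψ))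
  have hψ2 : MemLp (classicalHess ψ) q volume := c2.memLp_of_hasCompactSupport
    (hψc.of_isClosed_subset (isClosed_tsupport _) (tsupport_classicalHess_subset ψ))
  set E₀ : Plane → Vec m := fun x => ψ x - χ x • u x with hE₀
  set E₁ : Plane → GradSpace m := fun x => classicalGrad ψ x - cutoffGrad χ u Du x with hE₁
  set E₂ : Plane → HessSpace m := fun x => classicalHess ψ x - cutoffHess χ u Du D2u x with hE₂
  have M0 : MemLp E₀ q volume := hψ0.sub m0
  have M1 : MemLp E₁ q volume := hψ1.sub m1
  have M2 : MemLp E₂ q volume := hψ2.sub m2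
  have N0 : eLpNorm E₀ q volume ≤ ENNReal.ofReal τ := (eLpNorm_sub_comm _ _ _ _).le.trans a0
  have N1 : eLpNorm E₁ q volume ≤ ENNReal.ofReal τ := (eLpNorm_sub_comm _ _ _ _).le.trans a1
  have N2 : eLpNorm E₂ q volume ≤ ENNReal.ofReal τ := (eLpNorm_sub_comm _ _ _ _).le.trans a2
  have WE : HasWeakDerivs Ω E₀ E₁ E₂ :=
    ((HasWeakDerivs.of_contDiff hψ).sub hχu).mono (subset_univ Ω)
  have hEV : ∀ x ∈ V, Du x + E₁ x = classicalGrad ψ x ∧ D2u x + E₂ x = classicalHess ψ x := by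
    intro x hx
    obtain ⟨-, e1, e2⟩ := cutoff_eq_of_eq_one hV hχ1 u Du D2u hx
    simp [hE₁, hE₂, e1, e2]
  have hVf : volume V ≠ ⊤ := ((measure_mono hVΩ).trans_lt hΩf).ne
  -- `ε` bounds both the energy excess per unit area and the size of `θ` and `Dθ`.
  obtain ⟨ε, hε, hεσ, hεδ⟩ : ∃ ε : ℝ, 0 < ε ∧ ε * volume.real V ≤ σ ∧
      volume Ω ^ q.toReal⁻¹ * ENNReal.ofReal ε ≤ ENNReal.ofReal (δ / 8) := by
    have hc : volume Ω ^ q.toReal⁻¹ ≠ ⊤ := ENNReal.rpow_ne_top_of_nonneg (by positivity) hΩf.ne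
    set c := (volume Ω ^ q.toReal⁻¹).toReal with hcr
    have hc0 : 0 ≤ c := ENNReal.toReal_nonneg
    have hV0 : 0 ≤ volume.real V := measureReal_nonneg
    refine ⟨min (σ / (volume.real V + 1)) (δ / 8 / (c + 1)), by positivity, ?_, ?_⟩
    · have h1 : min (σ / (volume.real V + 1)) (δ / 8 / (c + 1)) * (volume.real V + 1) ≤ σ :=
        (le_div_iff₀ (by positivity)).mp (min_le_left _ _)
      have h2 : 0 < min (σ / (volume.real V + 1)) (δ / 8 / (c + 1)) := by positivity
      nlinarith
    · have h1 : min (σ / (volume.real V + 1)) (δ / 8 / (c + 1)) * (c + 1) ≤ δ / 8 :=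
        (le_div_iff₀ (by positivity)).mp (min_le_right _ _)
      have h2 : 0 < min (σ / (volume.real V + 1)) (δ / 8 / (c + 1)) := by positivity
      rw [← ENNReal.ofReal_toReal hc, ← hcr, ← ENNReal.ofReal_mul hc0]
      exact ENNReal.ofReal_le_ofReal (by nlinarith)
  obtain ⟨S, θ, Dθ, D2θ, hS, hSV, hVS, hθ, hθε, hE⟩ := H.exists_global_perturbation hψ hψc hV hVf
    hε (ν := min ν 1 / 4) (ENNReal.div_pos (by simpa using hν.ne') (by simp))
  have hSΩ := hSV.trans hVΩ
  have hSf : volume S ≠ ⊤ := ((measure_mono hSΩ).trans_lt hΩf).ne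
  obtain ⟨t0, t1, t2⟩ := hθ.memLp hSf q
  have W : IsSobolev2 Ω q (fun x => u x + E₀ x + θ x) (fun x => Du x + E₁ x + Dθ x)
      (fun x => D2u x + E₂ x + D2θ x) := by
    have hw := (hu.hasWeakDerivs.add WE).add (hθ.weak.mono (subset_univ Ω))
    exact ⟨(hu.memLp.add (M0.restrict Ω)).add (t0.restrict Ω),
      (hu.memLp_grad.add (M1.restrict Ω)).add (t1.restrict Ω),
      (hu.memLp_hess.add (M2.restrict Ω)).add (t2.restrict Ω), hw.weak_grad, hw.weak_hess⟩
  have iQu : IntegrableOn (fun x => quasiconvexification2 (f (Du x)) (D2u x)) Ω volume :=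
    H.integrable_quasiconvexification2 hu.memLp_grad.1 hu.memLp_hess
      (hu.hasWeakDerivs.isSymmHess_ae hΩ)
  have iQw : IntegrableOn (fun x => quasiconvexification2 (f (Du x + E₁ x)) (D2u x + E₂ x)) Ω
      volume := H.integrable_quasiconvexification2 (hu.memLp_grad.add (M1.restrict Ω)).1
    (hu.memLp_hess.add (M2.restrict Ω)) ((hu.hasWeakDerivs.add WE).isSymmHess_ae hΩ)
  refine ⟨_, _, _, W, ?_, H.integrable W.memLp_grad.1 W.memLp_hess, iQu, ?_⟩
  · refine (sobolev1Norm_le Ω hp _ _).trans_lt ?_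
    have n0 := eLpNorm_neg_add_le (Ω := Ω) hq1 M0.1 t0.1 N0 fun x => (hθε x).1
    have n1 := eLpNorm_neg_add_le (Ω := Ω) hq1 M1.1 t1.1 N1 fun x => (hθε x).2
    have e0 : (fun x => u x - (u x + E₀ x + θ x)) = fun x => -(E₀ x + θ x) := by
      ext1 x; abel
    have e1 : (fun x => Du x - (Du x + E₁ x + Dθ x)) = fun x => -(E₁ x + Dθ x) := by
      ext1 x; abel
    rw [e0, e1]
    refine (add_le_add (n0.trans (add_le_add_right hεδ _))
      (n1.trans (add_le_add_right hεδ _))).trans_lt ?_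
    -- Four contributions of at most `δ / 8`: the approximation error and `θ`, each for the map and
    -- for its gradient.
    rw [← ENNReal.ofReal_add hτ0.le (by positivity),
      ← ENNReal.ofReal_add (by positivity) (by positivity), ENNReal.ofReal_lt_ofReal_iff hδ]
    have : τ ≤ δ / 8 := min_le_right _ _
    linarith
  · have hΩS : ∫ x in Ω \ S, C * (1 + 2 ^ p * ‖D2u x‖ ^ p) ≤ σ := by
      have hm : (volume.restrict Ω) (Ω \ S) < ν := by
        refine (Measure.restrict_apply_le _ _).trans_lt ?_
        have hsub : Ω \ S ⊆ (Ω \ V) ∪ (V \ S) := fun x hx => by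
          by_cases hxV : x ∈ V
          · exact Or.inr ⟨hxV, hx.2⟩
          · exact Or.inl ⟨hx.1, hxV⟩
        refine ((measure_mono hsub).trans (measure_union_le _ _)).trans_lt ?_
        refine (add_le_add hVν hVS.le).trans_lt ?_
        have hlt : min ν 1 / 4 + min ν 1 / 4 < min ν 1 := by
          have hne : min ν 1 ≠ ⊤ := ((min_le_right _ _).trans_lt ENNReal.one_lt_top).ne
          have hpos : 0 < (min ν 1).toReal := ENNReal.toReal_pos (by simpa using hν.ne') hne
          rw [← ENNReal.ofReal_toReal hne, ← ENNReal.ofReal_ofNat 4,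
            ← ENNReal.ofReal_div_of_pos (by norm_num),
            ← ENNReal.ofReal_add (by positivity) (by positivity),
            ENNReal.ofReal_lt_ofReal_iff hpos]
          linarith
        exact hlt.trans_le (min_le_left _ _)
      have := hsmall (Ω \ S) hm
      rwa [Measure.restrict_restrict (hΩ.measurableSet.diff hS),
        inter_eq_left.mpr sdiff_subset] at this
    have hin : ∫ x in S, f (Du x + E₁ x + Dθ x) (D2u x + E₂ x + D2θ x) ≤
        (∫ x in S, quasiconvexification2 (f (Du x + E₁ x)) (D2u x + E₂ x)) + σ := by
      have e1 : ∫ x in S, f (Du x + E₁ x + Dθ x) (D2u x + E₂ x + D2θ x) =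
          ∫ x in S, f (classicalGrad ψ x + Dθ x) (classicalHess ψ x + D2θ x) :=
        setIntegral_congr_fun hS fun x hx => by
          simp only [(hEV x (hSV hx)).1, (hEV x (hSV hx)).2]
      have e2 : ∫ x in S, quasiconvexification2 (f (Du x + E₁ x)) (D2u x + E₂ x) =
          ∫ x in S, quasiconvexification2 (f (classicalGrad ψ x)) (classicalHess ψ x) :=
        setIntegral_congr_fun hS fun x hx => by
          simp only [(hEV x (hSV hx)).1, (hEV x (hSV hx)).2]
      rw [e1, e2]
      linarith
    have hsymm : ∀ᵐ x ∂(volume.restrict Ω), IsSymmHess (E₂ x) := WE.isSymmHess_ae hΩ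
    have key := H.setIntegral_le_of_split hΩ.measurableSet hS hSΩ (τ := τ ^ p) hL hu.memLp_hess
      W.memLp_grad.1 W.memLp_hess iQu iQw hb hbσ
      (by filter_upwards [hsymm] with x hx using hdens x (E₁ x) (E₂ x) hx)
      (setIntegral_norm_rpow_le hp hτ0.le M1 N1) (setIntegral_norm_rpow_le hp hτ0.le M2 N2)
      hΩS (fun x hx => by rw [(hθ.eq_zero x hx.2).2.2, add_zero]) hin
    have := hτL τ hτ0.le (min_le_left _ _)
    -- The errors add up to at most `4 * σ = δ / 2`.
    refine key.trans_lt ?_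
    linarith
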